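/- Let $D\ge 3$ and $n\ge 0$. A curvature invariant of order $n$ (without covariant derivatives of the curvature) is a linear combination, with constant real coefficients, of complete contractions of $n$ Riemann tensors with the metric, for $D$-dimensional Lorentzian metrics. For such an invariant $\mathcal L$: - $\mathcal L$ is *reducible* if $\sqrt{|g|}\,\mathcal L$ is a total derivative when evaluated on Ricci-flat metrics, i.e. if there is a current $J^a$, a smooth function of the metric components and finitely many of their partial derivatives, with $\sqrt{|g|}\,\mathcal L=\partial_aJ^a$ for every Ricci-flat metric; otherwise $\mathcal L$ is *irreducible*. - An SSS metric is $ds^2=-N(r)^2f(r)\,dt^2+dr^2/f(r)+r^2d\Omega^2_{(D-2)}$. $\mathcal L$ is *non-trivial* if it does not vanish identically on SSS metrics. - $\mathcal L$ is a *GQTG density* if $L_f(r,f,f',f'',\dots)=r^{D-2}\,\mathcal L|_{\mathrm{SSS},\,N=1}$ satisfies $\frac{\partial L_f}{\partial f}-\frac{d}{dr}\frac{\partial L_f}{\partial f'}+\frac{d^2}{dr^2}\frac{\partial L_f}{\partial f''}-\cdots=0$ for all functions $f(r)$. - $\mathcal L$ is *completable* if there is a GQTG density $\mathcal Q$ of the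 same kind and order such that $\mathcal L-\mathcal Q$ is reducible. Suppose that among the curvature invariants of order $n$ there is one that is an irreducible and non-trivial GQTG density. Then every curvature invariant $\mathcal L$ of order $n$ is completable. Moreover, $\mathcal Q$ in the definition of completability can be chosen so that $\mathcal L$ is mapped to $\mathcal Q$ by a field redefinition at leading order: there is a symmetric tensor $K_{ab}$, a linear combination of contractions of $n-1$ Riemann tensors with the metric ($K_{ab}=0$ being allowed), such that the substitution $g_{ab}\to g_{ab}+\varepsilon K_{ab}$ turns $\sqrt{|g|}\,(R+\varepsilon\mathcal L)$ into $\sqrt{|g|}\,(R+\varepsilon\mathcal Q)$ up to $O(\varepsilon^2)$ and up to a total derivative. (For $n=0$ read $n-1$ as $0$.) -/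

import Mathlib

open scoped ContDiff

noncomputable section

namespace GQTG

/-! ## Metrics and curvature in local coordinates -/

/-- A field of (covariant) rank-two tensors in local coordinates, given by its components
`g x a b = g_{ab}(x)`. -/
abbrev MetricField (D : ℕ) := (Fin D → ℝ) → Fin D → Fin D → ℝ

/-- A scalar built from a metric: it assigns to a metric and a point the value of the scalar. -/
abbrev Density (D : ℕ) := MetricField D → (Fin D → ℝ) → ℝ

/-- The coordinate derivative `∂_a F`. -/
def pd {D : ℕ} (a : Fin D) (F : (Fin D → ℝ) → ℝ) (x : Fin D → ℝ) : ℝ :=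
  fderiv ℝ F x (Pi.single a 1)

/-- The components `g^{ab}` of the inverse metric. -/
def inverseMetric {D : ℕ} (g : MetricField D) (x : Fin D → ℝ) (a b : Fin D) : ℝ :=
  (Matrix.of (g x))⁻¹ a b

/-- The volume factor `√|g|`. -/
def volumeFactor {D : ℕ} (g : MetricField D) (x : Fin D → ℝ) : ℝ :=
  Real.sqrt |(Matrix.of (g x)).det|

/-- The Christoffel symbols `Γ^a_{bc}` of the Levi-Civita connection. -/
def christoffel {D : ℕ} (g : MetricField D) (x : Fin D → ℝ) (a b c : Fin D) : ℝ :=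
  (1 / 2) * ∑ e, inverseMetric g x a e *
    (pd b (fun y => g y e c) x + pd c (fun y => g y e b) x - pd e (fun y => g y b c) x)

/-- The Riemann tensor `R^a_{bcd}`. -/
def riemannUp {D : ℕ} (g : MetricField D) (x : Fin D → ℝ) (a b c d : Fin D) : ℝ :=
  pd c (fun y => christoffel g y a d b) x - pd d (fun y => christoffel g y a c b) x
    + ∑ e, (christoffel g x a c e * christoffel g x e d b
      - christoffel g x a d e * christoffel g x e c b)

/-- The Riemann tensor `R_{abcd}`. -/
def riemann {D : ℕ} (g : MetricField D) (x : Fin D → ℝ) (a b c d : Fin D) : ℝ :=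
  ∑ e, g x a e * riemannUp g x e b c d

/-- The Ricci tensor `R_{bd} = R^a_{bad}`. -/
def ricci {D : ℕ} (g : MetricField D) (x : Fin D → ℝ) (b d : Fin D) : ℝ :=
  ∑ a, riemannUp g x a b a d

/-- The Ricci scalar. -/
def scalarCurvature {D : ℕ} (g : MetricField D) (x : Fin D → ℝ) : ℝ :=
  ∑ b, ∑ d, inverseMetric g x b d * ricci g x b d

/-- A matrix is Lorentzian if in some basis it becomes `diag(-1, 1, …, 1)`. -/
def IsLorentzian {D : ℕ} (M : Matrix (Fin D) (Fin D) ℝ) : Prop :=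
  ∃ P : Matrix (Fin D) (Fin D) ℝ, IsUnit P.det ∧
    P.transpose * M * P = Matrix.diagonal (fun i : Fin D => if (i : ℕ) = 0 then -1 else 1)

/-- `g` is a smooth Lorentzian metric on the coordinate domain `U`. -/
structure IsMetricOn {D : ℕ} (g : MetricField D) (U : Set (Fin D → ℝ)) : Prop where
  smooth : ContDiffOn ℝ ∞ g U
  lorentzian : ∀ x ∈ U, IsLorentzian (Matrix.of (g x))

/-- The Ricci tensor of `g` vanishes on `U`. -/
def IsRicciFlatOn {D : ℕ} (g : MetricField D) (U : Set (Fin D → ℝ)) : Prop :=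
  ∀ x ∈ U, ∀ b d, ricci g x b d = 0

/-! ## Curvature invariants without covariant derivatives -/

/-- The complete contraction, by inverse metrics, of a tensor `T` with lower index slots `S`:
the bijection `e` groups the slots into `m` pairs, and each pair is contracted with `g^{ab}`. -/
def contract {D : ℕ} {S : Type} [Fintype S] [DecidableEq S] {m : ℕ} (e : S ≃ Fin m × Fin 2)
    (ginv : Fin D → Fin D → ℝ) (T : (S → Fin D) → ℝ) : ℝ :=
  ∑ i : S → Fin D, T i * ∏ j : Fin m, ginv (i (e.symm (j, 0))) (i (e.symm (j, 1)))

/-- The components of the tensor product of `n` Riemann tensors; the slot `(k, s)` is the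
`s`-th index of the `k`-th factor. -/
def riemannPower {D : ℕ} (n : ℕ) (g : MetricField D) (x : Fin D → ℝ)
    (i : Fin n × Fin 4 → Fin D) : ℝ :=
  ∏ k : Fin n, riemann g x (i (k, 0)) (i (k, 1)) (i (k, 2)) (i (k, 3))

/-- The complete contraction of `n` Riemann tensors with the pattern `e`. -/
def riemannContraction {D : ℕ} (n : ℕ) (e : Fin n × Fin 4 ≃ Fin (2 * n) × Fin 2) : Density D :=
  fun g x => contract e (inverseMetric g x) (riemannPower n g x)

/-- The curvature invariants of order `n` which do not involve covariant derivatives of the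
curvature: linear combinations of the complete contractions of `n` Riemann tensors. -/
def curvatureInvariants (D n : ℕ) : Submodule ℝ (Density D) :=
  Submodule.span ℝ (Set.range (riemannContraction n))

/-- A contraction of `m` Riemann tensors with two free lower indices `a`, `b`: in
`Riem^{⊗ m} ⊗ g_{a ·} ⊗ g_{b ·}` all slots but the two free ones are contracted. -/
def tensorContraction {D : ℕ} (m : ℕ) (e : (Fin m × Fin 4) ⊕ Fin 2 ≃ Fin (2 * m + 1) × Fin 2)
    (g : MetricField D) : MetricField D :=
  fun x a b => contract e (inverseMetric g x)
    (fun i => riemannPower m g x (fun s => i (Sum.inl s))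
      * (g x a (i (Sum.inr 0)) * g x b (i (Sum.inr 1))))

/-- The symmetric rank-two tensors built from contractions of `m` Riemann tensors and the
metric. -/
def symmetricCurvatureTensors (D m : ℕ) : Submodule ℝ (MetricField D → MetricField D) :=
  Submodule.span ℝ (Set.range (fun e : (Fin m × Fin 4) ⊕ Fin 2 ≃ Fin (2 * m + 1) × Fin 2 =>
    fun (g : MetricField D) (x : Fin D → ℝ) (a b : Fin D) =>
      tensorContraction m e g x a b + tensorContraction m e g x b a))

/-! ## Total derivatives and reducible invariants -/

/-- The space of `k`-jets of metrics at a point: values for `∂_{a_1} ⋯ ∂_{a_i} g_{bc}`, `i ≤ k`. -/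
abbrev MetricJet (D k : ℕ) := (Σ i : Fin (k + 1), (Fin i → Fin D)) → Fin D → Fin D → ℝ

/-- The `k`-jet of `g` at `x`. -/
def metricJet {D : ℕ} (k : ℕ) (g : MetricField D) (x : Fin D → ℝ) : MetricJet D k :=
  fun w b c => iteratedFDeriv ℝ w.1 (fun y => g y b c) x (fun s => Pi.single (w.2 s) 1)

/-- The jets whose metric part is Lorentzian. -/
def lorentzianJets (D k : ℕ) : Set (MetricJet D k) :=
  {j | IsLorentzian (Matrix.of (j ⟨0, Fin.elim0⟩))}

/-- `F` (which carries the factor `√|g|`) is a total derivative when evaluated on the metrics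
satisfying `C`: there is a current `J^a`, a smooth function of the metric and of finitely many of
its derivatives, with `F = ∂_a J^a` for every such metric on every coordinate domain. -/
def IsTotalDerivativeOn {D : ℕ} (C : MetricField D → Set (Fin D → ℝ) → Prop)
    (F : Density D) : Prop :=
  ∃ (k : ℕ) (J : MetricJet D k → Fin D → ℝ), ContDiffOn ℝ ∞ J (lorentzianJets D k) ∧
    ∀ (U : Set (Fin D → ℝ)) (g : MetricField D), IsOpen U → IsMetricOn g U → C g U →
      ∀ x ∈ U, F g x = ∑ a, pd a (fun y => J (metricJet k g y) a) x

/-- `ℒ` is reducible: `√|g| ℒ` is a total derivative when evaluated on any Ricci-flat metric. -/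
def IsReducible {D : ℕ} (L : Density D) : Prop :=
  IsTotalDerivativeOn IsRicciFlatOn (fun g x => volumeFactor g x * L g x)

/-- `ℒ` is irreducible if it is not reducible. -/
def IsIrreducible {D : ℕ} (L : Density D) : Prop := ¬ IsReducible L

/-! ## Static and spherically symmetric metrics and GQTG densities

The spacetime dimension is `D = d + 2`; the coordinates are `x 0 = t`, `x 1 = r`, and
stereographic coordinates `x 2, …, x (d + 1)` on the unit sphere `S^d`. -/

/-- The metric `ds² = -N(r)² f(r) dt² + dr² / f(r) + r² dΩ²_d`, where
`dΩ²_d = 4 |dy|² / (1 + |y|²)²` in stereographic coordinates `y`. -/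
def sssMetric (d : ℕ) (N f : ℝ → ℝ) : MetricField (d + 2) := fun x a b =>
  if a = b then
    if a = 0 then -(N (x 1) ^ 2 * f (x 1))
    else if a = 1 then (f (x 1))⁻¹
    else (x 1) ^ 2 *
      (2 / (1 + ∑ k ∈ Finset.univ.filter (fun k : Fin (d + 2) => 2 ≤ (k : ℕ)), x k ^ 2)) ^ 2
  else 0

/-- The point of radius `r` at `t = 0` and at the origin of the stereographic coordinates. -/
def radialPoint (d : ℕ) (r : ℝ) : Fin (d + 2) → ℝ := fun i => if i = 1 then r else 0

/-- The reduced Lagrangian `L_{N,f} = N r^{D-2} ℒ|_SSS` as a function of `r`. -/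
def reducedLagrangian {d : ℕ} (L : Density (d + 2)) (N f : ℝ → ℝ) (r : ℝ) : ℝ :=
  N r * r ^ d * L (sssMetric d N f) (radialPoint d r)

/-- The `k`-jet `(f(r), f'(r), …, f^{(k)}(r))`. -/
def radialJet (k : ℕ) (f : ℝ → ℝ) (r : ℝ) : Fin (k + 1) → ℝ :=
  fun i => iteratedDeriv i f r

/-- The Euler-Lagrange expression
`∂Λ/∂f - d/dr (∂Λ/∂f') + d²/dr² (∂Λ/∂f'') - ⋯` of `Λ(r, f, f', …, f^{(k)})`. -/
def eulerLagrange {k : ℕ} (Λ : ℝ × (Fin (k + 1) → ℝ) → ℝ) (f : ℝ → ℝ) (r : ℝ) : ℝ :=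
  ∑ i : Fin (k + 1), (-1) ^ (i : ℕ) *
    iteratedDeriv i
      (fun s => fderiv ℝ (fun v => Λ (s, v)) (radialJet k f s) (Pi.single i 1)) r

/-- `ℒ` belongs to the GQTG family: `L_f = L_{1,f}` is a smooth function of `r > 0` and of finitely
many derivatives of `f` (where `f ≠ 0`, so that the metric is defined), and its Euler-Lagrange
expression vanishes identically, for all `f`. -/
def IsGQTG {d : ℕ} (L : Density (d + 2)) : Prop :=
  ∃ (k : ℕ) (Λ : ℝ × (Fin (k + 1) → ℝ) → ℝ),
    ContDiffOn ℝ ∞ Λ {p | 0 < p.1 ∧ p.2 0 ≠ 0} ∧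
    ∀ f : ℝ → ℝ, ContDiffOn ℝ ∞ f (Set.Ioi 0) → ∀ r : ℝ, 0 < r → f r ≠ 0 →
      reducedLagrangian L (fun _ => 1) f r = Λ (r, radialJet k f r) ∧ eulerLagrange Λ f r = 0

/-- `ℒ` is non-trivial: it does not vanish (identically) on static and spherically symmetric
metrics. -/
def IsNonTrivial {d : ℕ} (L : Density (d + 2)) : Prop :=
  ∃ N f : ℝ → ℝ, ContDiffOn ℝ ∞ N (Set.Ioi 0) ∧ ContDiffOn ℝ ∞ f (Set.Ioi 0) ∧
    ∃ r : ℝ, 0 < r ∧ 0 < N r ∧ f r ≠ 0 ∧ L (sssMetric d N f) (radialPoint d r) ≠ 0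

/-- The invariant `ℒ` of order `n` is completable to a GQTG density: there is a GQTG density `𝒬`
(again of order `n`) such that `ℒ - 𝒬` is reducible. -/
def IsCompletable {d : ℕ} (n : ℕ) (L : Density (d + 2)) : Prop :=
  ∃ Q ∈ curvatureInvariants (d + 2) n, IsGQTG Q ∧ IsReducible (L - Q)

/-! ## Field redefinitions -/

/-- At leading order in the coupling `ε`, a field redefinition `g → g + ε K(g)`, with `K` a
symmetric tensor built from `m` Riemann tensors, maps `∫ √|g| (R + ε ℒ)` to `∫ √|g| (R + ε 𝒬)`:
the Lagrangians agree up to `O(ε²)` and up to a total derivative (on all metrics). -/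
def IsMappedByFieldRedefinition {D : ℕ} (m : ℕ) (L Q : Density D) : Prop :=
  ∃ K ∈ symmetricCurvatureTensors D m, ∃ T : Density D,
    IsTotalDerivativeOn (fun _ _ => True) T ∧
    ∀ (U : Set (Fin D → ℝ)) (g : MetricField D), IsOpen U → IsMetricOn g U → ∀ x ∈ U,
      HasDerivAt
        (fun ε : ℝ => volumeFactor (g + ε • K g) x *
          (scalarCurvature (g + ε • K g) x + ε * L (g + ε • K g) x))
        (volumeFactor g x * Q g x + T g x) 0

end GQTG

end

/-! The proof splits off everything that vanishes on Ricci-flat metrics, and then uses the fact that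
what remains is determined, on static spherically symmetric metrics, by a single number. In
dimension `D = d + 2` write Riemann as Weyl plus the Kulkarni–Nomizu product of the metric with the
Schouten tensor. An invariant of order `n ≥ 1` is then its Weyl part plus contractions that contain
at least one Schouten factor (`exists_schouten_part`). The Weyl part is again an invariant of order
`n` (`exists_weylPart`). Schouten is, up to scale, a trace adjustment of the Einstein tensor. A
contraction with it therefore equals the Einstein tensor contracted with some symmetric `K` built
from `n - 1` Riemann tensors (`exists_einstein_pairing`). Such a term vanishes on Ricci-flat
metrics. By the first variation of the Einstein–Hilbert Lagrangian (`hasDerivAt_lagrangian`) it is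
also exactly what the redefinition `g → g + ε K` removes, up to the divergence of the Palatini
current. Thus `isReducible_and_isMapped` handles both reducibility and the field redefinition, and
it suffices to find a GQTG density with the right Weyl part modulo Schouten terms. On static
spherically symmetric metrics with `N = 1` the curvature is given by three sectional curvatures `A =
-f''/2`, `B = -f'/(2r)`, `ψ = (1 - f)/r²` (`riemann_sss`), and the Weyl tensor is a scalar amplitude
times a fixed tensor (`weyl_sssCurv`). The Weyl part of any invariant therefore takes the value `c
W^n`, with `W` the amplitude and `c` the `weylCoeff`. One GQTG density `Z` with non-zero `weylCoeff`
is thus enough. With `t` the quotient of the coefficients, `Q = L_Weyl - t Z_Weyl + t Z` agrees with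
`t Z` on these metrics, hence is GQTG, while `L - Q` consists of Schouten terms (`exists_gqtg`).
Such a `Z` is constructed explicitly for `d ≥ 2`, `n ≥ 2`. Its values `gqtgPoly` satisfy `r^d P =
d/dr (r^(d+1) G(ψ, B))` for an explicit potential (`gqtgPotential_spec`), so its Euler–Lagrange
expression vanishes (`eulerLagrange_totalDeriv`). They come from an actual curvature invariant
(`isRealized_gqtgPoly`), and the coefficient is found by evaluation at a Ricci-flat curvature
(`weylCoeff_ne_zero`). In the remaining cases the value `c W^n` vanishes (`D = 3` or `n = 1`), or
the invariant is a constant (`n = 0`). -/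

noncomputable section
namespace GQTG

/-! ## Contractions as linear maps, and their calculus -/

section Contractions

variable {D : ℕ} {S S' : Type} [Fintype S] [DecidableEq S] [Fintype S'] [DecidableEq S']

/-- Complete contraction with a fixed pattern, as a linear map of the contracted tensor. -/
def contractLin {m : ℕ} (e : S ≃ Fin m × Fin 2) (γ : Fin D → Fin D → ℝ) :
    ((S → Fin D) → ℝ) →ₗ[ℝ] ℝ where
  toFun := contract e γ
  map_add' T T' := by simp [contract, add_mul, Finset.sum_add_distrib]
  map_smul' c T := by simp [contract, Finset.mul_sum, mul_assoc]

/-- Linear combinations of the complete contractions of tensors with slots `S`. -/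
def contractions (D : ℕ) (S : Type) [Fintype S] [DecidableEq S] :
    Submodule ℝ ((Fin D → Fin D → ℝ) → ((S → Fin D) → ℝ) →ₗ[ℝ] ℝ) :=
  Submodule.span ℝ (Set.range fun p : Σ m, S ≃ Fin m × Fin 2 => contractLin p.2)

lemma contractLin_mem {m : ℕ} (e : S ≃ Fin m × Fin 2) :
    (contractLin e : (Fin D → Fin D → ℝ) → _) ∈ contractions D S :=
  Submodule.subset_span ⟨⟨m, e⟩, rfl⟩

/-- Every linear combination of contractions of the family `T` is a linear combination, with the
same coefficients for all members of the family, of contractions of the family `T'`. -/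
def Transfer {ι : Type*} (γ : ι → Fin D → Fin D → ℝ) (T : ι → (S → Fin D) → ℝ)
    (T' : ι → (S' → Fin D) → ℝ) : Prop :=
  ∀ φ ∈ contractions D S, ∃ φ' ∈ contractions D S', ∀ x, φ (γ x) (T x) = φ' (γ x) (T' x)

/-- In `Transfer` the new combination is chosen before the member `x` of the family. This keeps the
coefficients constant, as required of an invariant, and makes the condition linear in `φ`, so single
patterns suffice. -/
lemma Transfer.of_contract {ι : Type*} {γ : ι → Fin D → Fin D → ℝ} {T : ι → (S → Fin D) → ℝ}
    {T' : ι → (S' → Fin D) → ℝ}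
    (h : ∀ (m : ℕ) (e : S ≃ Fin m × Fin 2), ∃ φ' ∈ contractions D S',
      ∀ x, contract e (γ x) (T x) = φ' (γ x) (T' x)) : Transfer γ T T' := by
  intro φ hφ
  induction hφ using Submodule.span_induction with
  | mem φ hφ =>
    obtain ⟨⟨m, e⟩, rfl⟩ := hφ
    exact h m e
  | zero => exact ⟨0, Submodule.zero_mem _, fun x => rfl⟩
  | add φ ψ _ _ h₁ h₂ =>
    obtain ⟨φ', hφ', h₁⟩ := h₁
    obtain ⟨ψ', hψ', h₂⟩ := h₂
    exact ⟨φ' + ψ', Submodule.add_mem _ hφ' hψ', fun x => by simp [h₁, h₂]⟩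
  | smul c φ _ h₁ =>
    obtain ⟨φ', hφ', h₁⟩ := h₁
    exact ⟨c • φ', Submodule.smul_mem _ c hφ', fun x => by simp [h₁]⟩

lemma Transfer.trans {S'' : Type} [Fintype S''] [DecidableEq S''] {ι : Type*}
    {γ : ι → Fin D → Fin D → ℝ} {T : ι → (S → Fin D) → ℝ} {T' : ι → (S' → Fin D) → ℝ}
    {T'' : ι → (S'' → Fin D) → ℝ} (h : Transfer γ T T') (h' : Transfer γ T' T'') :
    Transfer γ T T'' := by
  intro φ hφ
  obtain ⟨φ', hφ', h₁⟩ := h φ hφ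
  obtain ⟨φ'', hφ'', h₂⟩ := h' φ' hφ'
  exact ⟨φ'', hφ'', fun x => (h₁ x).trans (h₂ x)⟩

lemma Transfer.add {ι : Type*} {γ : ι → Fin D → Fin D → ℝ} {T₁ T₂ : ι → (S → Fin D) → ℝ}
    {T' : ι → (S' → Fin D) → ℝ} (h₁ : Transfer γ T₁ T') (h₂ : Transfer γ T₂ T') :
    Transfer γ (fun x => T₁ x + T₂ x) T' := by
  intro φ hφ
  obtain ⟨φ₁, hφ₁, h₁⟩ := h₁ φ hφ
  obtain ⟨φ₂, hφ₂, h₂⟩ := h₂ φ hφ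
  exact ⟨φ₁ + φ₂, Submodule.add_mem _ hφ₁ hφ₂, fun x => by simp [h₁, h₂]⟩

lemma Transfer.smul {ι : Type*} {γ : ι → Fin D → Fin D → ℝ} {T : ι → (S → Fin D) → ℝ}
    {T' : ι → (S' → Fin D) → ℝ} (c : ℝ) (h : Transfer γ T T') :
    Transfer γ (fun x => c • T x) T' := by
  intro φ hφ
  obtain ⟨φ', hφ', h⟩ := h φ hφ
  exact ⟨c • φ', Submodule.smul_mem _ c hφ', fun x => by simp [h]⟩

lemma Transfer.refl {ι : Type*} (γ : ι → Fin D → Fin D → ℝ) (T : ι → (S → Fin D) → ℝ) :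
    Transfer γ T T := fun φ hφ => ⟨φ, hφ, fun _ => rfl⟩

lemma contract_relabel {m : ℕ} (e : S ≃ Fin m × Fin 2) (ε : S ≃ S') (γ : Fin D → Fin D → ℝ)
    (T : (S → Fin D) → ℝ) :
    contract (ε.symm.trans e) γ (fun i => T (fun s => i (ε s))) = contract e γ T := by
  unfold contract
  rw [← (Equiv.arrowCongr ε (Equiv.refl (Fin D))).sum_comp]
  simp [Equiv.arrowCongr]

/-- Renaming the slots. -/
lemma Transfer.relabel {ι : Type*} (γ : ι → Fin D → Fin D → ℝ) (T : ι → (S → Fin D) → ℝ)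
    (ε : S ≃ S') : Transfer γ T (fun x i => T x (fun s => i (ε s))) :=
  Transfer.of_contract fun _ e => ⟨_, contractLin_mem (ε.symm.trans e), fun x =>
    (contract_relabel e ε (γ x) (T x)).symm⟩

/-- The tensor product of tensors with slots `S` and `S'`. -/
def tprod (T : (S → Fin D) → ℝ) (T' : (S' → Fin D) → ℝ) (i : S ⊕ S' → Fin D) : ℝ :=
  T (fun s => i (Sum.inl s)) * T' (fun s => i (Sum.inr s))

lemma sum_sumArrow (F : (S ⊕ S' → Fin D) → ℝ) :
    ∑ i, F i = ∑ i : S → Fin D, ∑ k : S' → Fin D, F (Sum.elim i k) := by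
  rw [← (Equiv.sumArrowEquivProdArrow S S' (Fin D)).symm.sum_comp, Fintype.sum_prod_type]
  rfl

lemma sum_finTwoArrow (F : (Fin 2 → Fin D) → ℝ) :
    ∑ k, F k = ∑ p, ∑ q, F ![p, q] := by
  rw [← (finTwoArrowEquiv (Fin D)).symm.sum_comp, Fintype.sum_prod_type]
  rfl

lemma contract_prod {m m' : ℕ} (e : S ≃ Fin m × Fin 2) (e' : S' ≃ Fin m' × Fin 2)
    (γ : Fin D → Fin D → ℝ) (T : (S → Fin D) → ℝ) (T' : (S' → Fin D) → ℝ) :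
    contract ((e.sumCongr e').trans ((Equiv.sumProdDistrib _ _ _).symm.trans
      (finSumFinEquiv.prodCongr (Equiv.refl _)))) γ (tprod T T')
      = contract e γ T * contract e' γ T' := by
  unfold contract
  rw [sum_sumArrow, Finset.sum_mul_sum]
  refine Finset.sum_congr rfl fun i _ => Finset.sum_congr rfl fun k _ => ?_
  rw [Fin.prod_univ_add]
  simp only [tprod, Equiv.symm_trans_apply, Equiv.prodCongr_symm, Equiv.prodCongr_apply]
  simp [Prod.map]
  ring

/-- A product of contractions is a contraction of the tensor product. -/
lemma exists_contractions_prod {φ : (Fin D → Fin D → ℝ) → ((S → Fin D) → ℝ) →ₗ[ℝ] ℝ}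
    {ψ : (Fin D → Fin D → ℝ) → ((S' → Fin D) → ℝ) →ₗ[ℝ] ℝ}
    (hφ : φ ∈ contractions D S) (hψ : ψ ∈ contractions D S') :
    ∃ χ ∈ contractions D (S ⊕ S'), ∀ γ T T', χ γ (tprod T T') = φ γ T * ψ γ T' := by
  induction hφ using Submodule.span_induction with
  | mem φ hφ =>
    obtain ⟨⟨m, e⟩, rfl⟩ := hφ
    induction hψ using Submodule.span_induction with
    | mem ψ hψ =>
      obtain ⟨⟨m', e'⟩, rfl⟩ := hψ
      exact ⟨_, contractLin_mem _, fun γ T T' => contract_prod e e' γ T T'⟩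
    | zero => exact ⟨0, Submodule.zero_mem _, by simp⟩
    | add φ ψ _ _ h₁ h₂ =>
      obtain ⟨φ', hφ', h₁⟩ := h₁
      obtain ⟨ψ', hψ', h₂⟩ := h₂
      exact ⟨φ' + ψ', Submodule.add_mem _ hφ' hψ', fun γ T T' => by simp [h₁, h₂, mul_add]⟩
    | smul c φ _ h₁ =>
      obtain ⟨φ', hφ', h₁⟩ := h₁
      refine ⟨c • φ', Submodule.smul_mem _ c hφ', fun γ T T' => ?_⟩
      simp [h₁]; ring
  | zero => exact ⟨0, Submodule.zero_mem _, by simp⟩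
  | add φ ψ _ _ h₁ h₂ =>
    obtain ⟨φ', hφ', h₁⟩ := h₁
    obtain ⟨ψ', hψ', h₂⟩ := h₂
    exact ⟨φ' + ψ', Submodule.add_mem _ hφ' hψ', fun γ T T' => by simp [h₁, h₂, add_mul]⟩
  | smul c φ _ h₁ =>
    obtain ⟨φ', hφ', h₁⟩ := h₁
    refine ⟨c • φ', Submodule.smul_mem _ c hφ', fun γ T T' => ?_⟩
    simp [h₁]; ring

/-- The slots of one pair. -/
def onePair : Fin 2 ≃ Fin 1 × Fin 2 := (Equiv.uniqueProd (Fin 2) (Fin 1)).symm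

/-- Contraction of two additional slots with each other. -/
lemma Transfer.addPair {ι : Type*} (γ : ι → Fin D → Fin D → ℝ)
    (T : ι → (S ⊕ Fin 2 → Fin D) → ℝ) :
    Transfer γ (fun x i => ∑ p, ∑ q, γ x p q * T x (Sum.elim i ![p, q])) T := by
  refine Transfer.of_contract fun m e => ⟨_, contractLin_mem ((e.sumCongr onePair).trans
    ((Equiv.sumProdDistrib _ _ _).symm.trans (finSumFinEquiv.prodCongr (Equiv.refl _)))),
    fun x => ?_⟩
  change _ = contract _ _ _
  unfold contract
  rw [sum_sumArrow]
  refine Finset.sum_congr rfl fun i _ => ?_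
  rw [sum_finTwoArrow, Finset.sum_mul]
  refine Finset.sum_congr rfl fun p _ => ?_
  rw [Finset.sum_mul]
  refine Finset.sum_congr rfl fun q _ => ?_
  rw [Fin.prod_univ_add]
  simp only [Equiv.symm_trans_apply, Equiv.prodCongr_symm, Equiv.prodCongr_apply]
  simp [Prod.map, onePair]
  ring

/-- `G` and `γ` are symmetric matrices inverse to each other. -/
structure IsInversePair (G γ : Fin D → Fin D → ℝ) : Prop where
  symm : ∀ a b, G a b = G b a
  symm' : ∀ a b, γ a b = γ b a
  mul : ∀ a c, ∑ b, G a b * γ b c = if a = c then 1 else 0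

lemma IsInversePair.mul' {G γ : Fin D → Fin D → ℝ} (h : IsInversePair G γ) (a c : Fin D) :
    ∑ b, γ a b * G b c = if a = c then 1 else 0 := by
  rw [← (show (if c = a then (1 : ℝ) else 0) = if a = c then 1 else 0 by simp [eq_comm]),
    ← h.mul c a]
  exact Finset.sum_congr rfl fun b _ => by rw [h.symm' a b, h.symm b c, mul_comm]

/-- Contracting a metric factor: a metric whose slots are contracted with each other gives a
dimension, otherwise the partners of its two slots become contracted with each other. -/
lemma exists_contract_metric {m : ℕ} (e : S ⊕ Fin 2 ≃ Fin m × Fin 2) :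
    ∃ φ ∈ contractions D S, ∀ (G γ : Fin D → Fin D → ℝ), IsInversePair G γ →
      ∀ T : (S → Fin D) → ℝ,
        contract e γ (tprod T (fun k => G (k 0) (k 1))) = φ γ T := by
  rcases h₁ : e (Sum.inr 0) with ⟨p₁, b₁⟩
  rcases h₂ : e (Sum.inr 1) with ⟨p₂, b₂⟩
  have hne : e (Sum.inr 0) ≠ e (Sum.inr 1) := by simp
  obtain ⟨m, rfl⟩ : ∃ m', m = m' + 1 := ⟨m - 1, by have := p₁.2; omega⟩
  have hcard : Fintype.card (Fin m × Fin 2) = Fintype.card S := by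
    have := Fintype.card_congr e
    simp at this ⊢; omega
  -- By symmetry of `γ`, the pair `p₂` can be read with the second metric slot first, whichever end
  -- of the pair it occupies.
  have key : ∀ (G γ : Fin D → Fin D → ℝ), IsInversePair G γ → ∀ (i : S → Fin D) (k : Fin 2 → Fin D),
      γ (Sum.elim i k (e.symm (p₂, 0))) (Sum.elim i k (e.symm (p₂, 1)))
        = γ (k 1) (Sum.elim i k (e.symm (p₂, 1 - b₂))) := by
    intro G γ hγ i k
    have hs : Sum.elim i k (e.symm (p₂, b₂)) = k 1 := by rw [← h₂]; simp
    rw [← hs]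
    fin_cases b₂
    · rfl
    · rw [hγ.symm']; rfl
  by_cases hp : p₁ = p₂
  -- The two metric slots are partners: `G_{pq} γ^{qp} = D`, and the other pairs already form a
  -- pattern on `S`.
  · subst hp
    have hb : e (Sum.inr 0) = (p₁, 1 - b₂) := by
      rw [h₁]; congr 1
      have : b₁ ≠ b₂ := by rintro rfl; exact hne (h₁.trans h₂.symm)
      clear key h₁ h₂ hne
      revert b₁ b₂; decide
    have hg : ∀ y : Fin m × Fin 2, ∃ s, e.symm (p₁.succAbove y.1, y.2) = Sum.inl s := by
      intro y
      rcases hy : e.symm (p₁.succAbove y.1, y.2) with s | s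
      · exact ⟨s, rfl⟩
      · rw [Equiv.symm_apply_eq] at hy
        exfalso
        have : s = 0 ∨ s = 1 := by fin_cases s <;> simp
        rcases this with rfl | rfl
        · rw [h₁] at hy; exact Fin.succAbove_ne _ _ (congrArg Prod.fst hy)
        · rw [h₂] at hy; exact Fin.succAbove_ne _ _ (congrArg Prod.fst hy)
    choose g hg using hg
    have hinj : Function.Injective g := by
      intro y y' h
      have := (hg y).trans ((congrArg Sum.inl h).trans (hg y').symm)
      have := e.symm.injective this
      simp only [Prod.mk.injEq, Fin.succAbove_right_inj] at this
      exact Prod.ext this.1 this.2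
    let e' : Fin m × Fin 2 ≃ S := Equiv.ofBijective g
      ((Fintype.bijective_iff_injective_and_card g).2 ⟨hinj, hcard⟩)
    refine ⟨(D : ℝ) • contractLin e'.symm, Submodule.smul_mem _ _ (contractLin_mem _), ?_⟩
    intro G γ hγ T
    change _ = (D : ℝ) * contract _ _ _
    unfold contract
    rw [sum_sumArrow, Finset.mul_sum]
    refine Finset.sum_congr rfl fun i _ => ?_
    have : ∀ k : Fin 2 → Fin D, tprod T (fun k => G (k 0) (k 1)) (Sum.elim i k) *
        ∏ j, γ (Sum.elim i k (e.symm (j, 0))) (Sum.elim i k (e.symm (j, 1)))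
        = (T i * ∏ j, γ (i (e'.symm.symm (j, 0))) (i (e'.symm.symm (j, 1))))
          * (G (k 0) (k 1) * γ (k 1) (k 0)) := by
      intro k
      rw [Fin.prod_univ_succAbove _ p₁, key G γ hγ i k, ← hb]
      have : ∀ y, Sum.elim i k (e.symm (p₁.succAbove y.1, y.2)) = i (g y) := by
        intro y; rw [hg]; rfl
      simp only [this (_, _), tprod, Sum.elim_inl, Sum.elim_inr, Equiv.symm_apply_apply]
      change _ = (T i * ∏ j, γ (i (g (j, 0))) (i (g (j, 1)))) * _
      ring
    simp_rw [this]
    rw [← Finset.mul_sum, sum_finTwoArrow]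
    have : ∑ p, ∑ q, G ((![p, q] : Fin 2 → Fin D) 0) ((![p, q] : Fin 2 → Fin D) 1) *
        γ ((![p, q] : Fin 2 → Fin D) 1) ((![p, q] : Fin 2 → Fin D) 0) = D := by
      simp [hγ.mul]
    rw [this]; ring
  -- The two metric slots lie in different pairs, so the partner `q` of the second one is a slot of
  -- `T`. Since `G_{k₀ k₁} γ^{k₁ q}` is a Kronecker delta, dropping the pair `p₂` puts `q` in the
  -- place of the first metric slot; the map `g` below encodes this new pattern.
  · obtain ⟨q, hq⟩ : ∃ q, e.symm (p₂, 1 - b₂) = Sum.inl q := by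
      rcases hy : e.symm (p₂, 1 - b₂) with s | s
      · exact ⟨s, rfl⟩
      · rw [Equiv.symm_apply_eq] at hy
        exfalso
        have : s = 0 ∨ s = 1 := by fin_cases s <;> simp
        rcases this with rfl | rfl
        · rw [h₁] at hy; exact hp (congrArg Prod.fst hy).symm
        · rw [h₂] at hy
          have h3 : 1 - b₂ = b₂ := congrArg Prod.snd hy
          exact (by decide : ∀ b : Fin 2, 1 - b ≠ b) b₂ h3
    have hg : ∀ y : Fin m × Fin 2, ∃ s,
        ((p₂.succAbove y.1, y.2) = e (Sum.inr 0) → s = q) ∧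
        ((p₂.succAbove y.1, y.2) ≠ e (Sum.inr 0) →
          e.symm (p₂.succAbove y.1, y.2) = Sum.inl s) := by
      intro y
      by_cases hc : (p₂.succAbove y.1, y.2) = e (Sum.inr 0)
      · exact ⟨q, fun _ => rfl, fun h => absurd hc h⟩
      rcases hy : e.symm (p₂.succAbove y.1, y.2) with s | s
      · exact ⟨s, fun h => absurd h hc, fun _ => rfl⟩
      · rw [Equiv.symm_apply_eq] at hy
        exfalso
        have : s = 0 ∨ s = 1 := by fin_cases s <;> simp
        rcases this with rfl | rfl
        · exact hc hy
        · rw [h₂] at hy; exact Fin.succAbove_ne _ _ (congrArg Prod.fst hy)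
    choose g hg₁ hg₂ using hg
    have hgq : ∀ y, (p₂.succAbove y.1, y.2) ≠ e (Sum.inr 0) → g y ≠ q := by
      intro y hy h
      have h' := hg₂ y hy
      rw [h, ← hq] at h'
      exact Fin.succAbove_ne _ _ (congrArg Prod.fst (e.symm.injective h'))
    have hinj : Function.Injective g := by
      intro y y' h
      have fin : (p₂.succAbove y.1, y.2) = (p₂.succAbove y'.1, y'.2) → y = y' := by
        intro this
        simp only [Prod.mk.injEq, Fin.succAbove_right_inj] at this
        exact Prod.ext this.1 this.2
      by_cases hc : (p₂.succAbove y.1, y.2) = e (Sum.inr 0) <;>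
        by_cases hc' : (p₂.succAbove y'.1, y'.2) = e (Sum.inr 0)
      · exact fin (hc.trans hc'.symm)
      · exact absurd (h.symm.trans (hg₁ y hc)) (hgq y' hc')
      · exact absurd (h.trans (hg₁ y' hc')) (hgq y hc)
      · exact fin (e.symm.injective ((hg₂ y hc).trans
          ((congrArg Sum.inl h).trans (hg₂ y' hc').symm)))
    let e' : Fin m × Fin 2 ≃ S := Equiv.ofBijective g
      ((Fintype.bijective_iff_injective_and_card g).2 ⟨hinj, hcard⟩)
    refine ⟨contractLin e'.symm, contractLin_mem _, ?_⟩
    intro G γ hγ T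
    change _ = contract _ _ _
    unfold contract
    rw [sum_sumArrow]
    refine Finset.sum_congr rfl fun i _ => ?_
    -- The remaining summand with the index `k₀` of the first metric slot still free; summing
    -- against the delta sets `k₀ = i q`.
    let F : Fin D → ℝ := fun k₀ => T i * ∏ j : Fin m,
      γ (if (p₂.succAbove j, 0) = e (Sum.inr 0) then k₀ else i (g (j, 0)))
        (if (p₂.succAbove j, 1) = e (Sum.inr 0) then k₀ else i (g (j, 1)))
    have : ∀ k : Fin 2 → Fin D, tprod T (fun k => G (k 0) (k 1)) (Sum.elim i k) *
        ∏ j, γ (Sum.elim i k (e.symm (j, 0))) (Sum.elim i k (e.symm (j, 1)))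
        = F (k 0) * (G (k 0) (k 1) * γ (k 1) (i q)) := by
      intro k
      rw [Fin.prod_univ_succAbove _ p₂, key G γ hγ i k, hq]
      have : ∀ y, Sum.elim i k (e.symm (p₂.succAbove y.1, y.2)) =
          if (p₂.succAbove y.1, y.2) = e (Sum.inr 0) then k 0 else i (g y) := by
        intro y
        split_ifs with hc
        · rw [hc]; simp
        · rw [hg₂ y hc]; rfl
      simp only [this (_, _), tprod, Sum.elim_inl, Sum.elim_inr, F]
      ring
    simp_rw [this]
    rw [sum_finTwoArrow]
    simp only [Matrix.cons_val_zero, Matrix.cons_val_one, ← Finset.mul_sum, hγ.mul]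
    simp only [mul_ite, mul_one, mul_zero, Finset.sum_ite_eq', Finset.mem_univ, if_true, F]
    congr 1
    refine Finset.prod_congr rfl fun j _ => ?_
    change _ = γ (i (g (j, 0))) (i (g (j, 1)))
    congr 1
    · split_ifs with hc
      · rw [hg₁ (j, 0) hc]
      · rfl
    · split_ifs with hc
      · rw [hg₁ (j, 1) hc]
      · rfl

/-- Metric factors can be contracted away. -/
lemma Transfer.metric {ι : Type*} {γ G : ι → Fin D → Fin D → ℝ}
    (h : ∀ x, IsInversePair (G x) (γ x)) (T : ι → (S → Fin D) → ℝ) :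
    Transfer γ (fun x => tprod (T x) (fun k : Fin 2 → Fin D => G x (k 0) (k 1))) T :=
  Transfer.of_contract fun _ e => by
    obtain ⟨φ, hφ, h'⟩ := exists_contract_metric (D := D) e
    exact ⟨φ, hφ, fun x => h' _ _ (h x) _⟩

end Contractions

/-! ## The algebraic Weyl tensor -/

section Weyl

variable {d : ℕ}

/-- The Ricci contraction of `R_{abcd}`. -/
def ricciOf {D : ℕ} (γ : Fin D → Fin D → ℝ) (R : Fin D → Fin D → Fin D → Fin D → ℝ)
    (b e : Fin D) : ℝ := ∑ p, ∑ q, γ p q * R p b q e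

/-- The scalar contraction of `R_{abcd}`. -/
def scalarOf {D : ℕ} (γ : Fin D → Fin D → ℝ) (R : Fin D → Fin D → Fin D → Fin D → ℝ) : ℝ :=
  ∑ b, ∑ e, γ b e * ricciOf γ R b e

/-- The Schouten tensor in dimension `d + 2`, with symmetrised Ricci tensor. -/
def schouten (G γ : Fin (d + 2) → Fin (d + 2) → ℝ)
    (R : Fin (d + 2) → Fin (d + 2) → Fin (d + 2) → Fin (d + 2) → ℝ) (a b : Fin (d + 2)) : ℝ :=
  (d : ℝ)⁻¹ * ((1 / 2) * (ricciOf γ R a b + ricciOf γ R b a)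
    - scalarOf γ R / (2 * (d + 1)) * G a b)

/-- The Kulkarni–Nomizu product. -/
def kulkarniNomizu {D : ℕ} (G P : Fin D → Fin D → ℝ) (a b c e : Fin D) : ℝ :=
  G a c * P b e - G a e * P b c - G b c * P a e + G b e * P a c

/-- The Weyl tensor. -/
def weyl (G γ : Fin (d + 2) → Fin (d + 2) → ℝ)
    (R : Fin (d + 2) → Fin (d + 2) → Fin (d + 2) → Fin (d + 2) → ℝ)
    (a b c e : Fin (d + 2)) : ℝ :=
  R a b c e - kulkarniNomizu G (schouten G γ R) a b c e

/-- A rank-two tensor, as a function of its slots. -/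
def tens₂ {D : ℕ} (Q : Fin D → Fin D → ℝ) (k : Fin 2 → Fin D) : ℝ := Q (k 0) (k 1)

/-- A rank-four tensor, as a function of its slots. -/
def tens₄ {D : ℕ} (R : Fin D → Fin D → Fin D → Fin D → ℝ) (j : Fin 4 → Fin D) : ℝ :=
  R (j 0) (j 1) (j 2) (j 3)

/-- The tensor power of a rank-four tensor. -/
def tensorPower {D : ℕ} (n : ℕ) (R : Fin D → Fin D → Fin D → Fin D → ℝ)
    (i : Fin n × Fin 4 → Fin D) : ℝ :=
  ∏ k : Fin n, R (i (k, 0)) (i (k, 1)) (i (k, 2)) (i (k, 3))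

variable {D : ℕ} {S : Type} [Fintype S] [DecidableEq S] {ι : Type*}
  {γ G Q : ι → Fin D → Fin D → ℝ} {T : ι → (S → Fin D) → ℝ}
  {R : ι → Fin D → Fin D → Fin D → Fin D → ℝ}

/-- The permutation of four slots with the given table. -/
def permOfTable (t u : Fin 4 → Fin 4) (h : ∀ s, u (t s) = s) (h' : ∀ s, t (u s) = s) :
    Fin 2 ⊕ Fin 2 ≃ Fin 4 :=
  finSumFinEquiv.trans ⟨t, u, h, h'⟩

/-- Treats one term of a Kulkarni–Nomizu product: `π` says which of the four slots belong to `Q`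
(left summand) and which to the metric (right summand). After a relabelling this is the removal of a
metric factor. -/
lemma Transfer.metric_mul (h : ∀ x, IsInversePair (G x) (γ x)) (T : ι → (S → Fin D) → ℝ)
    (π : Fin 2 ⊕ Fin 2 ≃ Fin 4) :
    Transfer γ (fun x => tprod (T x) (fun j : Fin 4 → Fin D =>
        G x (j (π (Sum.inr 0))) (j (π (Sum.inr 1))) *
          Q x (j (π (Sum.inl 0))) (j (π (Sum.inl 1)))))
      (fun x => tprod (T x) (tens₂ (Q x))) := by
  refine (Transfer.relabel _ _ (((Equiv.refl S).sumCongr π.symm).trans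
    (Equiv.sumAssoc S (Fin 2) (Fin 2)).symm)).trans ?_
  convert Transfer.metric h (fun x => tprod (T x) (tens₂ (Q x))) using 2 with x
  funext i
  simp [tprod, tens₂]
  ring

lemma Transfer.kulkarniNomizu (h : ∀ x, IsInversePair (G x) (γ x)) (T : ι → (S → Fin D) → ℝ)
    (Q : ι → Fin D → Fin D → ℝ) :
    Transfer γ (fun x => tprod (T x) (tens₄ (kulkarniNomizu (G x) (Q x))))
      (fun x => tprod (T x) (tens₂ (Q x))) := by
  -- In each table the first two entries are the slots of `Q` and the last two those of the metric;
  -- the second table is the inverse permutation.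
  have h₁ := Transfer.metric_mul (Q := Q) h T
    (permOfTable ![1, 3, 0, 2] ![2, 0, 3, 1] (by decide) (by decide))
  have h₂ := Transfer.metric_mul (Q := Q) h T
    (permOfTable ![1, 2, 0, 3] ![2, 0, 1, 3] (by decide) (by decide))
  have h₃ := Transfer.metric_mul (Q := Q) h T
    (permOfTable ![0, 3, 1, 2] ![0, 2, 3, 1] (by decide) (by decide))
  have h₄ := Transfer.metric_mul (Q := Q) h T
    (permOfTable ![0, 2, 1, 3] ![0, 2, 1, 3] (by decide) (by decide))
  convert ((h₁.add (h₂.smul (-1))).add (h₃.smul (-1))).add h₄ using 2 with x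
  funext i
  simp [tprod, tens₄, GQTG.kulkarniNomizu, permOfTable, finSumFinEquiv, Fin.natAdd, Fin.castAdd,
    Fin.castLE]
  ring

lemma Transfer.swap (γ Q : ι → Fin D → Fin D → ℝ) (T : ι → (S → Fin D) → ℝ) :
    Transfer γ (fun x => tprod (T x) (tens₂ fun a b => Q x b a))
      (fun x => tprod (T x) (tens₂ (Q x))) := by
  convert Transfer.relabel γ (fun x => tprod (T x) (tens₂ fun a b => Q x b a))
    ((Equiv.refl S).sumCongr (Equiv.swap (0 : Fin 2) 1)) using 2 with x
  funext i
  simp [tprod, tens₂, Equiv.swap_apply_def]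

/-- A Ricci factor is a Riemann factor whose first and third slots are paired by `γ`, so adding that
pair to a pattern for Ricci gives a pattern for Riemann. -/
lemma Transfer.ricci (γ : ι → Fin D → Fin D → ℝ) (T : ι → (S → Fin D) → ℝ)
    (R : ι → Fin D → Fin D → Fin D → Fin D → ℝ) :
    Transfer γ (fun x => tprod (T x) (tens₂ (ricciOf (γ x) (R x))))
      (fun x => tprod (T x) (tens₄ (R x))) := by
  have h := (Transfer.addPair γ (fun x (i : (S ⊕ Fin 2) ⊕ Fin 2 → Fin D) =>
    T x (fun s => i (Sum.inl (Sum.inl s))) * R x (i (Sum.inr 0)) (i (Sum.inl (Sum.inr 0)))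
      (i (Sum.inr 1)) (i (Sum.inl (Sum.inr 1))))).trans
    (Transfer.relabel _ _ ((Equiv.sumAssoc S (Fin 2) (Fin 2)).trans ((Equiv.refl S).sumCongr
      (permOfTable ![1, 3, 0, 2] ![2, 0, 3, 1] (by decide) (by decide)))))
  convert h using 2 with x x
  · funext i
    simp only [tprod, tens₂, ricciOf, Finset.mul_sum, Sum.elim_inl, Sum.elim_inr]
    refine Finset.sum_congr rfl fun p _ => Finset.sum_congr rfl fun q _ => ?_
    simp
    ring
  · funext i
    simp [tprod, tens₄, permOfTable, finSumFinEquiv, Fin.natAdd, Fin.castAdd, Fin.castLE]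

lemma Transfer.scalar_mul (γ : ι → Fin D → Fin D → ℝ) (T : ι → (S → Fin D) → ℝ)
    (R : ι → Fin D → Fin D → Fin D → Fin D → ℝ) :
    Transfer γ (fun x => scalarOf (γ x) (R x) • T x) (fun x => tprod (T x) (tens₄ (R x))) := by
  refine Transfer.trans ?_ (Transfer.ricci γ T R)
  convert Transfer.addPair γ (fun x => tprod (T x) (tens₂ (ricciOf (γ x) (R x)))) using 2 with x
  funext i
  simp only [tprod, tens₂, scalarOf, Finset.sum_mul, Sum.elim_inl, Sum.elim_inr, Pi.smul_apply,
    smul_eq_mul]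
  refine Finset.sum_congr rfl fun p _ => Finset.sum_congr rfl fun q _ => ?_
  simp
  ring

variable {γ G : ι → Fin (d + 2) → Fin (d + 2) → ℝ}

lemma Transfer.schouten (h : ∀ x, IsInversePair (G x) (γ x)) (T : ι → (S → Fin (d + 2)) → ℝ)
    (R : ι → Fin (d + 2) → Fin (d + 2) → Fin (d + 2) → Fin (d + 2) → ℝ) :
    Transfer γ (fun x => tprod (T x) (tens₂ (schouten (G x) (γ x) (R x))))
      (fun x => tprod (T x) (tens₄ (R x))) := by
  have h₁ := Transfer.ricci γ T R
  have h₂ := (Transfer.swap γ (fun x => ricciOf (γ x) (R x)) T).trans h₁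
  have h₃ := (Transfer.metric h (fun x => scalarOf (γ x) (R x) • T x)).trans
    (Transfer.scalar_mul γ T R)
  convert ((h₁.add h₂).smul ((d : ℝ)⁻¹ * (1 / 2))).add
    (h₃.smul (-(d : ℝ)⁻¹ / (2 * (d + 1)))) using 2 with x
  funext i
  simp only [tprod, tens₂, GQTG.schouten, Pi.smul_apply, Pi.add_apply, smul_eq_mul]
  ring

/-- A Weyl factor can be replaced by Riemann factors. -/
lemma Transfer.weyl (h : ∀ x, IsInversePair (G x) (γ x)) (T : ι → (S → Fin (d + 2)) → ℝ)
    (R : ι → Fin (d + 2) → Fin (d + 2) → Fin (d + 2) → Fin (d + 2) → ℝ) :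
    Transfer γ (fun x => tprod (T x) (tens₄ (weyl (G x) (γ x) (R x))))
      (fun x => tprod (T x) (tens₄ (R x))) := by
  have h₁ := (Transfer.kulkarniNomizu h T (fun x => GQTG.schouten (G x) (γ x) (R x))).trans
    (Transfer.schouten h T R)
  convert (Transfer.refl γ (fun x => tprod (T x) (tens₄ (R x)))).add (h₁.smul (-1)) using 2 with x
  funext i
  simp only [tprod, tens₄, GQTG.weyl, Pi.smul_apply, Pi.add_apply, smul_eq_mul]
  ring

/-- The slots of a tensor power, with the last factor singled out. -/
def slotSucc (n : ℕ) : Fin (n + 1) × Fin 4 ≃ (Fin n × Fin 4) ⊕ Fin 4 :=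
  (finSumFinEquiv.symm.prodCongr (Equiv.refl _)).trans ((Equiv.sumProdDistrib _ _ _).trans
    ((Equiv.refl _).sumCongr (Equiv.uniqueProd (Fin 4) (Fin 1))))

@[simp] lemma slotSucc_castSucc (n : ℕ) (k : Fin n) (s : Fin 4) :
    slotSucc n (k.castSucc, s) = Sum.inl (k, s) := by
  rw [← Equiv.eq_symm_apply]; simp [slotSucc]; rfl

@[simp] lemma slotSucc_last (n : ℕ) (s : Fin 4) : slotSucc n (Fin.last n, s) = Sum.inr s := by
  rw [← Equiv.eq_symm_apply]; simp [slotSucc]; rfl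

lemma tensorPower_succ {n : ℕ} (R : Fin D → Fin D → Fin D → Fin D → ℝ)
    (i : (Fin n × Fin 4) ⊕ Fin 4 → Fin D) :
    tensorPower (n + 1) R (fun s => i (slotSucc n s)) = tprod (tensorPower n R) (tens₄ R) i := by
  simp [tensorPower, tprod, tens₄, Fin.prod_univ_castSucc]

lemma Transfer.tensorPower_succ {D : ℕ} (γ : ι → Fin D → Fin D → ℝ) (T : ι → (S → Fin D) → ℝ)
    (R : ι → Fin D → Fin D → Fin D → Fin D → ℝ) (n : ℕ) :
    Transfer γ (fun x => tprod (T x) (tensorPower (n + 1) (R x)))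
      (fun x => tprod (tprod (T x) (tensorPower n (R x))) (tens₄ (R x))) := by
  convert Transfer.relabel γ (fun x => tprod (T x) (tensorPower (n + 1) (R x)))
    (((Equiv.refl S).sumCongr (slotSucc n)).trans (Equiv.sumAssoc _ _ _).symm) using 2 with x
  funext i
  have := GQTG.tensorPower_succ (R x) (fun s => i ((Equiv.sumAssoc S _ _).symm (Sum.inr s)))
  simp [tprod] at this ⊢
  rw [this, mul_assoc]

lemma Transfer.tensorPower_succ_symm {D : ℕ} (γ : ι → Fin D → Fin D → ℝ)
    (T : ι → (S → Fin D) → ℝ) (R : ι → Fin D → Fin D → Fin D → Fin D → ℝ) (n : ℕ) :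
    Transfer γ (fun x => tprod (tprod (T x) (tensorPower n (R x))) (tens₄ (R x)))
      (fun x => tprod (T x) (tensorPower (n + 1) (R x))) := by
  convert Transfer.relabel γ (fun x => tprod (tprod (T x) (tensorPower n (R x))) (tens₄ (R x)))
    (((Equiv.refl S).sumCongr (slotSucc n)).trans (Equiv.sumAssoc _ _ _).symm).symm using 2 with x
  funext i
  have := GQTG.tensorPower_succ (R x) (fun s => i (Sum.inr ((slotSucc n).symm s)))
  simp [tprod] at this ⊢
  rw [this, mul_assoc]

lemma Transfer.right_comm {S₁ S₂ : Type} [Fintype S₁] [DecidableEq S₁] [Fintype S₂]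
    [DecidableEq S₂] {D : ℕ} (γ : ι → Fin D → Fin D → ℝ) (T : ι → (S → Fin D) → ℝ)
    (T₁ : ι → (S₁ → Fin D) → ℝ) (T₂ : ι → (S₂ → Fin D) → ℝ) :
    Transfer γ (fun x => tprod (tprod (T x) (T₁ x)) (T₂ x))
      (fun x => tprod (tprod (T x) (T₂ x)) (T₁ x)) := by
  convert Transfer.relabel γ (fun x => tprod (tprod (T x) (T₁ x)) (T₂ x))
    ((Equiv.sumAssoc S S₁ S₂).trans (((Equiv.refl S).sumCongr (Equiv.sumComm _ _)).trans
      (Equiv.sumAssoc S S₂ S₁).symm)) using 2 with x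
  funext i
  simp [tprod]
  ring

lemma Transfer.rotate {S₁ S₂ S₃ : Type} [Fintype S₁] [DecidableEq S₁] [Fintype S₂]
    [DecidableEq S₂] [Fintype S₃] [DecidableEq S₃] {D : ℕ} (γ : ι → Fin D → Fin D → ℝ)
    (T : ι → (S → Fin D) → ℝ) (T₁ : ι → (S₁ → Fin D) → ℝ) (T₂ : ι → (S₂ → Fin D) → ℝ)
    (T₃ : ι → (S₃ → Fin D) → ℝ) :
    Transfer γ (fun x => tprod (tprod (tprod (T x) (T₁ x)) (T₂ x)) (T₃ x))
      (fun x => tprod (tprod (tprod (T x) (T₂ x)) (T₃ x)) (T₁ x)) := by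
  convert Transfer.relabel γ (fun x => tprod (tprod (tprod (T x) (T₁ x)) (T₂ x)) (T₃ x))
    (((Equiv.sumAssoc (S ⊕ S₁) S₂ S₃).trans (Equiv.sumAssoc S S₁ (S₂ ⊕ S₃))).trans
      (((Equiv.refl S).sumCongr (Equiv.sumComm _ _)).trans
      ((Equiv.sumAssoc S (S₂ ⊕ S₃) S₁).symm.trans
        ((Equiv.sumAssoc S S₂ S₃).symm.sumCongr (Equiv.refl _))))) using 2 with x
  funext i
  simp [tprod]
  ring

/-- Weyl factors can be replaced by Riemann factors. -/
lemma Transfer.weyl_pow (h : ∀ x, IsInversePair (G x) (γ x)) (T : ι → (S → Fin (d + 2)) → ℝ)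
    (R : ι → Fin (d + 2) → Fin (d + 2) → Fin (d + 2) → Fin (d + 2) → ℝ) (n : ℕ) :
    Transfer γ (fun x => tprod (T x) (tensorPower n (GQTG.weyl (G x) (γ x) (R x))))
      (fun x => tprod (T x) (tensorPower n (R x))) := by
  induction n generalizing S with
  | zero =>
    exact Transfer.refl γ (fun x => tprod (T x) (tensorPower 0 (R x)))
  | succ n ih =>
    refine (Transfer.tensorPower_succ _ _ _ n).trans ((Transfer.weyl h _ R).trans
      ((Transfer.right_comm _ _ _ _).trans ((ih _).trans ((Transfer.right_comm _ _ _ _).trans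
        (Transfer.tensorPower_succ_symm _ _ _ n)))))

/-- Riemann minus Weyl is a Kulkarni–Nomizu product; its metric factor contracts away and leaves one
Schouten factor. -/
lemma exists_weyl_step (h : ∀ x, IsInversePair (G x) (γ x)) (T : ι → (S → Fin (d + 2)) → ℝ)
    (R : ι → Fin (d + 2) → Fin (d + 2) → Fin (d + 2) → Fin (d + 2) → ℝ)
    {φ : (Fin (d + 2) → Fin (d + 2) → ℝ) → ((S ⊕ Fin 4 → Fin (d + 2)) → ℝ) →ₗ[ℝ] ℝ}
    (hφ : φ ∈ contractions (d + 2) (S ⊕ Fin 4)) :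
    ∃ φ' ∈ contractions (d + 2) (S ⊕ Fin 2), ∀ x, φ (γ x) (tprod (T x) (tens₄ (R x)))
      = φ (γ x) (tprod (T x) (tens₄ (GQTG.weyl (G x) (γ x) (R x))))
        + φ' (γ x) (tprod (T x) (tens₂ (GQTG.schouten (G x) (γ x) (R x)))) := by
  obtain ⟨φ', hφ', h'⟩ :=
    Transfer.kulkarniNomizu h T (fun x => GQTG.schouten (G x) (γ x) (R x)) φ hφ
  refine ⟨φ', hφ', fun x => ?_⟩
  rw [← h', ← map_add]
  congr 1
  funext i
  simp only [tprod, tens₄, GQTG.weyl, Pi.add_apply]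
  ring

/-- Up to contractions with the Schouten tensor, Riemann tensors can be replaced by Weyl
tensors. -/
lemma exists_weyl_pow (h : ∀ x, IsInversePair (G x) (γ x)) (T : ι → (S → Fin (d + 2)) → ℝ)
    (R : ι → Fin (d + 2) → Fin (d + 2) → Fin (d + 2) → Fin (d + 2) → ℝ) (n : ℕ)
    {φ : (Fin (d + 2) → Fin (d + 2) → ℝ) →
      ((S ⊕ Fin (n + 1) × Fin 4 → Fin (d + 2)) → ℝ) →ₗ[ℝ] ℝ}
    (hφ : φ ∈ contractions (d + 2) (S ⊕ Fin (n + 1) × Fin 4)) :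
    ∃ φ' ∈ contractions (d + 2) ((S ⊕ Fin n × Fin 4) ⊕ Fin 2),
      ∀ x, φ (γ x) (tprod (T x) (tensorPower (n + 1) (R x)))
      = φ (γ x) (tprod (T x) (tensorPower (n + 1) (GQTG.weyl (G x) (γ x) (R x))))
        + φ' (γ x) (tprod (tprod (T x) (tensorPower n (R x)))
            (tens₂ (GQTG.schouten (G x) (γ x) (R x)))) := by
  -- The family is indexed by all triples of inverse metric, tensor and curvature, so that the same
  -- `φ₁` serves both for `R` and for its Weyl tensor.
  obtain ⟨φ₁, hφ₁, h₁⟩ := Transfer.tensorPower_succ (ι := (Fin (d + 2) → Fin (d + 2) → ℝ) ×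
    ((S → Fin (d + 2)) → ℝ) × (Fin (d + 2) → Fin (d + 2) → Fin (d + 2) → Fin (d + 2) → ℝ))
    (fun p => p.1) (fun p => p.2.1) (fun p => p.2.2) n φ hφ
  obtain ⟨φ₂, hφ₂, h₂⟩ := exists_weyl_step h (fun x => tprod (T x) (tensorPower n (R x))) R hφ₁
  induction n generalizing S with
  | zero =>
    refine ⟨φ₂, hφ₂, fun x => ?_⟩
    rw [h₁ (γ x, T x, R x), h₁ (γ x, T x, _), h₂ x]
    rfl
  | succ n ih =>
    obtain ⟨φ₃, hφ₃, h₃⟩ := Transfer.right_comm (ι := (Fin (d + 2) → Fin (d + 2) → ℝ) ×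
      ((S → Fin (d + 2)) → ℝ) × ((Fin (n + 1) × Fin 4 → Fin (d + 2)) → ℝ) ×
      ((Fin 4 → Fin (d + 2)) → ℝ)) (fun p => p.1) (fun p => p.2.1) (fun p => p.2.2.1)
      (fun p => p.2.2.2) φ₁ hφ₁
    obtain ⟨φ₁', hφ₁', h₁'⟩ := Transfer.tensorPower_succ
      (ι := (Fin (d + 2) → Fin (d + 2) → ℝ) × ((S ⊕ Fin 4 → Fin (d + 2)) → ℝ) ×
        (Fin (d + 2) → Fin (d + 2) → Fin (d + 2) → Fin (d + 2) → ℝ))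
      (fun p => p.1) (fun p => p.2.1) (fun p => p.2.2) n φ₃ hφ₃
    obtain ⟨φ₂', hφ₂', h₂'⟩ := exists_weyl_step h (fun x => tprod (tprod (T x)
      (tens₄ (GQTG.weyl (G x) (γ x) (R x)))) (tensorPower n (R x))) R hφ₁'
    obtain ⟨φ₄, hφ₄, h₄⟩ := ih (fun x => tprod (T x) (tens₄ (GQTG.weyl (G x) (γ x) (R x))))
      hφ₃ φ₁' hφ₁' h₁' φ₂' hφ₂' h₂'
    -- The Schouten term from the induction hypothesis still carries the Weyl factor that was moved
    -- into `T`; `Transfer.weyl` turns it back into a Riemann factor, so that only Riemann tensors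
    -- accompany the Schouten tensor.
    obtain ⟨φ₅, hφ₅, h₅⟩ := ((Transfer.rotate γ T
      (fun x => tens₄ (GQTG.weyl (G x) (γ x) (R x))) (fun x => tensorPower n (R x))
      (fun x => tens₂ (GQTG.schouten (G x) (γ x) (R x)))).trans ((Transfer.weyl h _ R).trans
      ((Transfer.rotate _ _ _ _ _).trans ((Transfer.right_comm _ _ _ _).trans
      ((Transfer.tensorPower_succ_symm _ _ _ _).trans (Transfer.right_comm _ _ _ _)))))) φ₄ hφ₄
    refine ⟨φ₅ + φ₂, Submodule.add_mem _ hφ₅ hφ₂, fun x => ?_⟩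
    have e₁ := h₁ (γ x, T x, R x)
    have e₂ := h₁ (γ x, T x, GQTG.weyl (G x) (γ x) (R x))
    have e₃ := h₃ (γ x, T x, tensorPower (n + 1) (R x), tens₄ (GQTG.weyl (G x) (γ x) (R x)))
    have e₄ := h₃ (γ x, T x, tensorPower (n + 1) (GQTG.weyl (G x) (γ x) (R x)),
      tens₄ (GQTG.weyl (G x) (γ x) (R x)))
    dsimp only at e₁ e₂ e₃ e₄
    rw [e₁, e₂, h₂ x, e₃, e₄, h₄ x, h₅ x]
    simp [add_assoc]

end Weyl

/-! ## Curvature invariants and their Weyl parts -/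

section Invariants

variable {D d : ℕ}

lemma IsLorentzian.det_ne_zero {M : Matrix (Fin D) (Fin D) ℝ} (h : IsLorentzian M) :
    M.det ≠ 0 := by
  obtain ⟨P, hP, h⟩ := h
  have h' := congrArg Matrix.det h
  rw [Matrix.det_mul, Matrix.det_mul, Matrix.det_diagonal] at h'
  intro h0
  rw [h0, mul_zero, zero_mul, eq_comm, Finset.prod_eq_zero_iff] at h'
  obtain ⟨i, -, hi⟩ := h'
  split_ifs at hi <;> norm_num at hi

/-- `PᵀMP` is diagonal, hence symmetric, and the invertible `P` cancels. Symmetry of the metric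
comes from here, since it is not a separate field of `IsMetricOn`. -/
lemma IsLorentzian.transpose_eq {M : Matrix (Fin D) (Fin D) ℝ} (h : IsLorentzian M) :
    M.transpose = M := by
  obtain ⟨P, hP, h⟩ := h
  have h' := congrArg Matrix.transpose h
  rw [Matrix.transpose_mul, Matrix.transpose_mul, Matrix.transpose_transpose,
    Matrix.diagonal_transpose, ← h, ← Matrix.mul_assoc] at h'
  have hu : IsUnit P := (Matrix.isUnit_iff_isUnit_det P).2 hP
  have hu' : IsUnit P.transpose := by
    rw [Matrix.isUnit_iff_isUnit_det, Matrix.det_transpose]; exact hP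
  exact hu'.mul_left_cancel (hu.mul_right_cancel h')

lemma isInversePair_of_isLorentzian {g : MetricField D} {x : Fin D → ℝ}
    (h : IsLorentzian (Matrix.of (g x))) : IsInversePair (g x) (inverseMetric g x) := by
  have hs := h.transpose_eq
  have hu : IsUnit (Matrix.of (g x)).det := isUnit_iff_ne_zero.2 h.det_ne_zero
  refine ⟨fun a b => congrFun (congrFun hs b) a, fun a b => ?_, fun a c => ?_⟩
  · have : ((Matrix.of (g x))⁻¹).transpose = (Matrix.of (g x))⁻¹ := by
      rw [Matrix.transpose_nonsing_inv, hs]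
    exact congrFun (congrFun this b) a
  · have := congrFun (congrFun (Matrix.mul_nonsing_inv (Matrix.of (g x)) hu) a) c
    rw [Matrix.mul_apply, Matrix.one_apply] at this
    exact this

lemma ricciOf_riemann {g : MetricField D} {x : Fin D → ℝ}
    (h : IsInversePair (g x) (inverseMetric g x)) :
    ricciOf (inverseMetric g x) (riemann g x) = ricci g x := by
  funext b e
  unfold ricciOf ricci riemann
  simp_rw [Finset.mul_sum]
  have : ∀ p, ∑ q, ∑ s, inverseMetric g x p q * (g x p s * riemannUp g x s b q e)
      = ∑ q, ∑ s, inverseMetric g x q p * g x p s * riemannUp g x s b q e := by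
    intro p
    refine Finset.sum_congr rfl fun q _ => Finset.sum_congr rfl fun s _ => ?_
    rw [h.symm' q p, mul_assoc]
  simp_rw [this]
  rw [Finset.sum_comm]
  refine Finset.sum_congr rfl fun q _ => ?_
  rw [Finset.sum_comm]
  simp_rw [← Finset.sum_mul, h.mul']
  simp

lemma scalarOf_riemann {g : MetricField D} {x : Fin D → ℝ}
    (h : IsInversePair (g x) (inverseMetric g x)) :
    scalarOf (inverseMetric g x) (riemann g x) = scalarCurvature g x := by
  simp only [scalarOf, ricciOf_riemann h, scalarCurvature]

/-- The invariant of order `n` given by a linear combination of contractions. -/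
def invariantOf (n : ℕ)
    (φ : (Fin D → Fin D → ℝ) → ((Fin n × Fin 4 → Fin D) → ℝ) →ₗ[ℝ] ℝ) : Density D :=
  fun g x => φ (inverseMetric g x) (tensorPower n (riemann g x))

lemma invariantOf_mem {n : ℕ} {φ : (Fin D → Fin D → ℝ) → ((Fin n × Fin 4 → Fin D) → ℝ) →ₗ[ℝ] ℝ}
    (hφ : φ ∈ contractions D (Fin n × Fin 4)) : invariantOf n φ ∈ curvatureInvariants D n := by
  induction hφ using Submodule.span_induction with
  | mem φ hφ =>
    obtain ⟨⟨m, e⟩, rfl⟩ := hφ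
    obtain rfl : m = 2 * n := by
      have := Fintype.card_congr e
      simp at this; omega
    exact Submodule.subset_span ⟨e, rfl⟩
  | zero => exact Submodule.zero_mem _
  | add φ ψ _ _ h₁ h₂ => exact Submodule.add_mem _ h₁ h₂
  | smul c φ _ h₁ => exact Submodule.smul_mem _ c h₁

lemma exists_invariantOf {n : ℕ} {L : Density D} (hL : L ∈ curvatureInvariants D n) :
    ∃ φ ∈ contractions D (Fin n × Fin 4), L = invariantOf n φ := by
  induction hL using Submodule.span_induction with
  | mem L hL =>
    obtain ⟨e, rfl⟩ := hL
    exact ⟨_, contractLin_mem e, rfl⟩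
  | zero => exact ⟨0, Submodule.zero_mem _, rfl⟩
  | add L L' _ _ h₁ h₂ =>
    obtain ⟨φ, hφ, rfl⟩ := h₁
    obtain ⟨ψ, hψ, rfl⟩ := h₂
    exact ⟨φ + ψ, Submodule.add_mem _ hφ hψ, rfl⟩
  | smul c L _ h₁ =>
    obtain ⟨φ, hφ, rfl⟩ := h₁
    exact ⟨c • φ, Submodule.smul_mem _ c hφ, rfl⟩

/-- The tensor `G_{a·} G_{b·}` which carries the free indices `a`, `b`. -/
def freeSlots (G : Fin D → Fin D → ℝ) (a b : Fin D) (k : Fin 2 → Fin D) : ℝ :=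
  G a (k 0) * G b (k 1)

/-- The rank-two tensor given by a linear combination of contractions. -/
def tensorOf (m : ℕ)
    (ψ : (Fin D → Fin D → ℝ) → (((Fin m × Fin 4) ⊕ Fin 2 → Fin D) → ℝ) →ₗ[ℝ] ℝ)
    (g : MetricField D) : MetricField D :=
  fun x a b => ψ (inverseMetric g x) (tprod (tensorPower m (riemann g x)) (freeSlots (g x) a b))

lemma tensorOf_mem {m : ℕ}
    {ψ : (Fin D → Fin D → ℝ) → (((Fin m × Fin 4) ⊕ Fin 2 → Fin D) → ℝ) →ₗ[ℝ] ℝ}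
    (hψ : ψ ∈ contractions D ((Fin m × Fin 4) ⊕ Fin 2)) :
    (fun (g : MetricField D) x a b => tensorOf m ψ g x a b + tensorOf m ψ g x b a)
      ∈ symmetricCurvatureTensors D m := by
  induction hψ using Submodule.span_induction with
  | mem φ hφ =>
    obtain ⟨⟨k, e⟩, rfl⟩ := hφ
    obtain rfl : k = 2 * m + 1 := by
      have := Fintype.card_congr e
      simp at this; omega
    exact Submodule.subset_span ⟨e, rfl⟩
  | zero =>
    convert Submodule.zero_mem _
    simp [tensorOf]
  | add φ ψ _ _ h₁ h₂ =>
    convert Submodule.add_mem _ h₁ h₂ using 1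
    funext g x a b
    simp [tensorOf]; ring
  | smul c φ _ h₁ =>
    convert Submodule.smul_mem _ c h₁ using 1
    funext g x a b
    simp [tensorOf]; ring

/-- The full contraction `A_{ab} B^{ab}`. -/
def pairing (γ A B : Fin D → Fin D → ℝ) : ℝ :=
  ∑ a, ∑ b, ∑ c, ∑ e, γ a c * γ b e * A a b * B c e

lemma pairing_metric {G γ : Fin D → Fin D → ℝ} (h : IsInversePair G γ) (B : Fin D → Fin D → ℝ) :
    pairing γ G B = ∑ c, ∑ e, γ c e * B c e := by
  unfold pairing
  have : ∀ a b, ∑ c, ∑ e, γ a c * γ b e * G a b * B c e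
      = ∑ c, ∑ e, γ c a * B c e * (G a b * γ b e) := fun a b =>
    Finset.sum_congr rfl fun c _ => Finset.sum_congr rfl fun e _ => by rw [h.symm' c a]; ring
  simp_rw [this]
  have : ∀ a, ∑ b, ∑ c, ∑ e, γ c a * B c e * (G a b * γ b e)
      = ∑ c, γ c a * B c a := by
    intro a
    rw [Finset.sum_comm]
    refine Finset.sum_congr rfl fun c _ => ?_
    rw [Finset.sum_comm]
    simp_rw [← Finset.mul_sum, h.mul]
    simp
  simp_rw [this]
  rw [Finset.sum_comm]

lemma pairing_transpose (γ A B : Fin D → Fin D → ℝ) :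
    pairing γ (fun a b => A b a) (fun a b => B b a) = pairing γ A B := by
  unfold pairing
  rw [Finset.sum_comm]
  refine Finset.sum_congr rfl fun a _ => Finset.sum_congr rfl fun b _ => ?_
  rw [Finset.sum_comm]
  refine Finset.sum_congr rfl fun c _ => Finset.sum_congr rfl fun e _ => ?_
  ring

lemma pairing_lin_left (γ A A' B : Fin D → Fin D → ℝ) (s t : ℝ) :
    pairing γ (fun a b => s * A a b + t * A' a b) B = s * pairing γ A B + t * pairing γ A' B := by
  simp only [pairing, Finset.mul_sum, ← Finset.sum_add_distrib]
  refine Finset.sum_congr rfl fun a _ => Finset.sum_congr rfl fun b _ =>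
    Finset.sum_congr rfl fun c _ => Finset.sum_congr rfl fun e _ => ?_
  ring

lemma pairing_comm {γ : Fin D → Fin D → ℝ} (h : ∀ a b, γ a b = γ b a) (A B : Fin D → Fin D → ℝ) :
    pairing γ A B = pairing γ B A := by
  have e : ∀ A B : Fin D → Fin D → ℝ, pairing γ A B
      = ∑ p : Fin D × Fin D, ∑ q : Fin D × Fin D, γ p.1 q.1 * γ p.2 q.2 * A p.1 p.2 * B q.1 q.2 :=
    fun A B => by simp only [pairing, Fintype.sum_prod_type]
  rw [e, e, Finset.sum_comm]
  refine Finset.sum_congr rfl fun p _ => Finset.sum_congr rfl fun q _ => ?_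
  rw [h p.1, h p.2]; ring

/-- The metrics in `freeSlots` lower the free indices and the pairing raises them again, so the
second tensor ends up in the two open slots. Concretely, `tens₂ P` is expanded in the tensors
`freeSlots G a b`, and `ψ` is linear. -/
lemma pairing_tensorOf {m : ℕ} {G γ : Fin D → Fin D → ℝ} (h : IsInversePair G γ)
    (ψ : (((Fin m × Fin 4) ⊕ Fin 2 → Fin D) → ℝ) →ₗ[ℝ] ℝ) (T : (Fin m × Fin 4 → Fin D) → ℝ)
    (P : Fin D → Fin D → ℝ) :
    pairing γ (fun a b => ψ (tprod T (freeSlots G a b))) P = ψ (tprod T (tens₂ P)) := by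
  have : tprod T (tens₂ P) = ∑ a, ∑ b, ∑ c, ∑ e, (γ a c * γ b e * P c e) •
      tprod T (freeSlots G a b) := by
    funext i
    simp only [Finset.sum_apply, Pi.smul_apply, smul_eq_mul, tprod, tens₂, freeSlots]
    generalize T _ = t
    generalize i (Sum.inr 0) = p
    generalize i (Sum.inr 1) = q
    have e₁ : ∀ a b c, ∑ e, γ a c * γ b e * P c e * (t * (G a p * G b q))
        = ∑ e, t * γ a c * G a p * P c e * (γ e b * G b q) := fun a b c =>
      Finset.sum_congr rfl fun e _ => by rw [h.symm' e b]; ring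
    simp_rw [e₁]
    have e₂ : ∀ a, ∑ b, ∑ c, ∑ e, t * γ a c * G a p * P c e * (γ e b * G b q)
        = ∑ c, t * P c q * (γ c a * G a p) := by
      intro a
      rw [Finset.sum_comm]
      refine Finset.sum_congr rfl fun c _ => ?_
      rw [Finset.sum_comm]
      simp_rw [← Finset.mul_sum, h.mul']
      simp [h.symm' c a]; ring
    simp_rw [e₂]
    rw [Finset.sum_comm]
    simp_rw [← Finset.mul_sum, h.mul']
    simp
  rw [this]
  simp only [map_sum, map_smul, smul_eq_mul, pairing]
  refine Finset.sum_congr rfl fun a _ => Finset.sum_congr rfl fun b _ =>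
    Finset.sum_congr rfl fun c _ => Finset.sum_congr rfl fun e _ => ?_
  ring

/-- The data of a metric, its inverse and a rank-four tensor at a point. -/
abbrev PointData (D : ℕ) : Type := {p : (Fin D → Fin D → ℝ) × (Fin D → Fin D → ℝ) ×
  (Fin D → Fin D → Fin D → Fin D → ℝ) // IsInversePair p.1 p.2.1}

/-- Together with `Transfer.to_empty` this inserts or removes a factor without slots, so that the
results about products `T ⊗ ⋯` apply when there is no further factor. -/
lemma Transfer.of_empty {S : Type} [Fintype S] [DecidableEq S] {ι : Type*}
    (γ : ι → Fin D → Fin D → ℝ) (T : ι → (S → Fin D) → ℝ) :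
    Transfer γ (fun x => tprod (fun _ : Empty → Fin D => (1 : ℝ)) (T x)) T := by
  convert Transfer.relabel γ (fun x => tprod (fun _ : Empty → Fin D => (1 : ℝ)) (T x))
    (Equiv.emptySum Empty S) using 2 with x
  funext i
  simp [tprod]

lemma Transfer.to_empty {S : Type} [Fintype S] [DecidableEq S] {ι : Type*}
    (γ : ι → Fin D → Fin D → ℝ) (T : ι → (S → Fin D) → ℝ) :
    Transfer γ T (fun x => tprod (fun _ : Empty → Fin D => (1 : ℝ)) (T x)) := by
  convert Transfer.relabel γ T (Equiv.emptySum Empty S).symm using 2 with x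
  funext i
  simp [tprod]

/-- The Weyl part of an invariant is an invariant. -/
lemma exists_weylPart {n : ℕ}
    {φ : (Fin (d + 2) → Fin (d + 2) → ℝ) → ((Fin n × Fin 4 → Fin (d + 2)) → ℝ) →ₗ[ℝ] ℝ}
    (hφ : φ ∈ contractions (d + 2) (Fin n × Fin 4)) :
    ∃ φ' ∈ contractions (d + 2) (Fin n × Fin 4), ∀ G γ R, IsInversePair G γ →
      φ' γ (tensorPower n R) = φ γ (tensorPower n (weyl G γ R)) := by
  obtain ⟨φ', hφ', h⟩ := ((Transfer.to_empty (fun p : PointData (d + 2) => p.1.2.1)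
    (fun p => tensorPower n (weyl p.1.1 p.1.2.1 p.1.2.2))).trans ((Transfer.weyl_pow
      (fun p => p.2) _ _ n).trans (Transfer.of_empty _ _))) φ hφ
  exact ⟨φ', hφ', fun G γ R hG => (h ⟨(G, γ, R), hG⟩).symm⟩

/-- An invariant differs from its Weyl part by a contraction with the Schouten tensor. -/
lemma exists_schouten_part {m : ℕ}
    {φ : (Fin (d + 2) → Fin (d + 2) → ℝ) → ((Fin (m + 1) × Fin 4 → Fin (d + 2)) → ℝ) →ₗ[ℝ] ℝ}
    (hφ : φ ∈ contractions (d + 2) (Fin (m + 1) × Fin 4)) :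
    ∃ ψ ∈ contractions (d + 2) ((Fin m × Fin 4) ⊕ Fin 2), ∀ G γ R, IsInversePair G γ →
      φ γ (tensorPower (m + 1) R) = φ γ (tensorPower (m + 1) (weyl G γ R))
        + ψ γ (tprod (tensorPower m R) (tens₂ (schouten G γ R))) := by
  obtain ⟨φ₁, hφ₁, h₁⟩ := Transfer.to_empty
    (ι := (Fin (d + 2) → Fin (d + 2) → ℝ) × ((Fin (m + 1) × Fin 4 → Fin (d + 2)) → ℝ))
    (fun p => p.1) (fun p => p.2) φ hφ
  obtain ⟨ψ₁, hψ₁, h₂⟩ := exists_weyl_pow (ι := PointData (d + 2)) (γ := fun p => p.1.2.1)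
    (G := fun p => p.1.1) (fun p => p.2) (fun _ _ => 1) (fun p => p.1.2.2) m hφ₁
  obtain ⟨ψ, hψ, h₃⟩ := Transfer.relabel (fun p : PointData (d + 2) => p.1.2.1)
    (fun p => tprod (tprod (fun _ : Empty → Fin (d + 2) => (1 : ℝ)) (tensorPower m p.1.2.2))
      (tens₂ (schouten p.1.1 p.1.2.1 p.1.2.2)))
    ((Equiv.emptySum Empty (Fin m × Fin 4)).sumCongr (Equiv.refl (Fin 2))) ψ₁ hψ₁
  refine ⟨ψ, hψ, fun G γ R hG => ?_⟩
  have e₁ := h₁ (γ, tensorPower (m + 1) R)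
  have e₂ := h₁ (γ, tensorPower (m + 1) (weyl G γ R))
  have e₃ := h₂ ⟨(G, γ, R), hG⟩
  have e₄ := h₃ ⟨(G, γ, R), hG⟩
  dsimp only at e₁ e₂ e₃ e₄
  rw [e₁, e₂, e₃, e₄]
  congr 2
  funext i
  simp [tprod, tens₂]

/-- A contraction with the Schouten tensor is a contraction of the Einstein tensor with a
symmetric tensor built from curvature. -/
lemma exists_einstein_pairing (hd : 1 ≤ d) {m : ℕ}
    {ψ : (Fin (d + 2) → Fin (d + 2) → ℝ) → (((Fin m × Fin 4) ⊕ Fin 2 → Fin (d + 2)) → ℝ) →ₗ[ℝ] ℝ}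
    (hψ : ψ ∈ contractions (d + 2) ((Fin m × Fin 4) ⊕ Fin 2)) :
    ∃ K ∈ symmetricCurvatureTensors (d + 2) m,
      ∀ (g : MetricField (d + 2)) x, IsInversePair (g x) (inverseMetric g x) →
        ψ (inverseMetric g x) (tprod (tensorPower m (riemann g x))
            (tens₂ (schouten (g x) (inverseMetric g x) (riemann g x))))
          = pairing (inverseMetric g x) (K g x) (ricci g x)
            - 1 / 2 * scalarCurvature g x * ∑ a, ∑ b, inverseMetric g x a b * K g x a b := by
  -- `ψ₁` is the trace of the rank-two tensor given by `ψ`, obtained by putting the metric into its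
  -- two open slots; `ψ₂` below is this trace times `g_{ab}`.
  obtain ⟨ψ₁, hψ₁, h₁⟩ := Transfer.metric (γ := fun p : PointData (d + 2) => p.1.2.1)
    (G := fun p => p.1.1) (fun p => p.2) (fun p => tensorPower m p.1.2.2) ψ hψ
  obtain ⟨ψ₂, hψ₂, h₂⟩ := Transfer.addPair
    (ι := PointData (d + 2) × Fin (d + 2) × Fin (d + 2)) (fun p => p.1.1.2.1)
    (fun p => tprod (tensorPower m p.1.1.2.2) (freeSlots p.1.1.1 p.2.1 p.2.2)) ψ₁ hψ₁
  -- With `E` the Einstein tensor of the symmetrised Ricci tensor, Schouten is `(E - tr E/(d+1)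
  -- g)/d`. This trace adjustment is self-adjoint, so contracting `X` with Schouten is contracting
  -- `(X - tr X/(d+1) g)/d` with `E`. The extra factor `1/2` compensates for the sum over both
  -- orders of the indices in `tensorOf_mem`.
  let χ := (1 / (2 * d) : ℝ) • ψ - (1 / (2 * d * (d + 1)) : ℝ) • ψ₂
  have hχ : χ ∈ contractions (d + 2) ((Fin m × Fin 4) ⊕ Fin 2) :=
    Submodule.sub_mem _ (Submodule.smul_mem _ _ hψ) (Submodule.smul_mem _ _ hψ₂)
  refine ⟨_, tensorOf_mem hχ, fun g x hG => ?_⟩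
  have e₁ := h₁ ⟨(g x, inverseMetric g x, riemann g x), hG⟩
  have e₂ := fun a b => h₂ (⟨(g x, inverseMetric g x, riemann g x), hG⟩, a, b)
  dsimp only at e₁ e₂
  have hric := ricciOf_riemann hG
  have hsc := scalarOf_riemann hG
  have hP := pairing_tensorOf hG (ψ (inverseMetric g x)) (tensorPower m (riemann g x))
    (schouten (g x) (inverseMetric g x) (riemann g x))
  have htr := pairing_tensorOf hG (ψ (inverseMetric g x)) (tensorPower m (riemann g x)) (g x)
  set γ := inverseMetric g x
  set R := riemann g x
  set X : Fin (d + 2) → Fin (d + 2) → ℝ := fun a b => ψ γ (tprod (tensorPower m R)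
    (freeSlots (g x) a b)) with hX
  set τ : ℝ := ψ₁ γ (tensorPower m R) with hτ
  have hχx : ∀ a b, tensorOf m χ g x a b = (1 / (2 * d)) * X a b
      + (-(1 / (2 * d * (d + 1))) * τ) * g x a b := by
    intro a b
    have : ψ₂ γ (tprod (tensorPower m R) (freeSlots (g x) a b)) = τ * g x a b := by
      rw [← e₂ a b, hτ, mul_comm, ← smul_eq_mul, ← map_smul]
      congr 1
      funext i
      have e₃ : ∀ p, ∑ q, γ p q * (tensorPower m R i * (g x a p * g x b q))
          = tensorPower m R i * g x a p * if p = b then 1 else 0 := by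
        intro p
        rw [← hG.mul' p b, Finset.mul_sum]
        exact Finset.sum_congr rfl fun q _ => by rw [hG.symm b q]; ring
      simp only [tprod, freeSlots, Sum.elim_inl, Sum.elim_inr, Pi.smul_apply, smul_eq_mul,
        Matrix.cons_val_zero, Matrix.cons_val_one, e₃]
      simp; ring
    change (1 / (2 * d) : ℝ) * ψ γ _ - (1 / (2 * d * (d + 1)) : ℝ) * ψ₂ γ _ = _
    rw [this]; ring
  have hτ' : τ = ∑ a, ∑ b, γ a b * X a b := by
    rw [← pairing_metric hG, pairing_comm hG.symm', htr]
    exact e₁.symm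
  have hgg : ∑ a, ∑ b, γ a b * g x a b = d + 2 := by
    have : ∀ a, ∑ b, γ a b * g x a b = 1 := by
      intro a
      have := hG.mul' a a
      rw [if_pos rfl] at this
      rw [← this]
      exact Finset.sum_congr rfl fun b _ => by rw [hG.symm a b]
    simp [this]
  have hK : (fun a b => tensorOf m χ g x a b + tensorOf m χ g x b a)
      = fun a b => 1 * (1 * tensorOf m χ g x a b + 1 * tensorOf m χ g x b a)
        + 0 * g x a b := by funext a b; ring
  have hA : ∀ B, pairing γ (tensorOf m χ g x) B
      = (1 / (2 * d)) * pairing γ X B + (-(1 / (2 * d * (d + 1))) * τ) * ∑ a, ∑ b, γ a b * B a b := by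
    intro B
    have : tensorOf m χ g x = fun a b => (1 / (2 * d)) * X a b
      + (-(1 / (2 * d * (d + 1))) * τ) * g x a b := by funext a b; exact hχx a b
    rw [this, pairing_lin_left, pairing_metric hG]
  have hT : ∀ B, pairing γ (fun a b => tensorOf m χ g x b a) B
      = pairing γ (tensorOf m χ g x) (fun a b => B b a) := fun B =>
    pairing_transpose γ (tensorOf m χ g x) (fun a b => B b a)
  have hsum : ∀ B, pairing γ (fun a b => tensorOf m χ g x a b + tensorOf m χ g x b a) B
      = pairing γ (tensorOf m χ g x) B + pairing γ (tensorOf m χ g x) (fun a b => B b a) := by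
    intro B
    have := pairing_lin_left γ (tensorOf m χ g x) (fun a b => tensorOf m χ g x b a) B 1 1
    simp only [one_mul] at this
    rw [this, hT]
  have hS : ∑ a, ∑ b, γ a b * ricci g x a b = scalarCurvature g x := rfl
  have hS' : ∑ a, ∑ b, γ a b * ricci g x b a = scalarCurvature g x := by
    rw [← hS, Finset.sum_comm]
    exact Finset.sum_congr rfl fun a _ => Finset.sum_congr rfl fun b _ => by rw [hG.symm' b a]
  have htrK : ∑ a, ∑ b, γ a b * (tensorOf m χ g x a b + tensorOf m χ g x b a)
      = 2 * ((1 / (2 * d)) * τ + (-(1 / (2 * d * (d + 1))) * τ) * (d + 2)) := by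
    rw [← pairing_metric hG, pairing_comm hG.symm', hsum]
    have : (fun a b => g x b a) = g x := by funext a b; exact hG.symm b a
    rw [this, hA, hgg, htr]
    have : τ = ψ γ (tprod (tensorPower m R) (tens₂ (g x))) := e₁.symm
    rw [← this]; ring
  have hXP : pairing γ X (schouten (g x) γ R)
      = (d : ℝ)⁻¹ * (1 / 2 * (pairing γ X (ricci g x) + pairing γ X (fun a b => ricci g x b a))
        - scalarCurvature g x / (2 * (d + 1)) * τ) := by
    have : schouten (g x) γ R = fun a b => (d : ℝ)⁻¹ * (1 * (1 / 2 * ricci g x a b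
        + 1 / 2 * ricci g x b a) + (- (scalarCurvature g x / (2 * (d + 1)))) * g x a b)
          + 0 * g x a b := by
      funext a b
      simp only [schouten, hric, hsc]; ring
    rw [pairing_comm hG.symm', this, pairing_lin_left, pairing_lin_left, pairing_lin_left,
      pairing_metric hG, ← hτ', pairing_comm hG.symm' _ X, pairing_comm hG.symm' _ X]
    ring
  rw [← hP, hXP, hsum, htrK, hA, hA, hS, hS']
  have : (d : ℝ) ≠ 0 := by positivity
  field_simp
  ring

end Invariants

/-! ## Tensors given by sectional curvatures -/

section Sectional

variable {D d : ℕ}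

/-- The matrix `diag(h)`. -/
def diagMat (h : Fin D → ℝ) (a b : Fin D) : ℝ := if a = b then h a else 0

/-- The tensor with sectional curvatures `κ` in an orthogonal frame with norms `h`. -/
def sectional (κ : Fin D → Fin D → ℝ) (h : Fin D → ℝ) (a b c e : Fin D) : ℝ :=
  κ a b * (h a * h b) * ((if a = c then 1 else 0) * (if b = e then 1 else 0)
    - (if a = e then 1 else 0) * (if b = c then 1 else 0))

lemma sectional_eq_mul (κ : Fin D → Fin D → ℝ) (h : Fin D → ℝ) (a b c e : Fin D) :
    sectional κ h a b c e = h a * h b * sectional κ 1 a b c e := by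
  simp [sectional]; ring

lemma prod_comp_eq {α : Type*} [Fintype α] (h : Fin D → ℝ) (f : α → Fin D) :
    ∏ x, h (f x) = ∏ a, h a ^ (∑ x, if f x = a then 1 else 0) := by
  simp_rw [← Finset.prod_pow_eq_pow_sum]
  rw [Finset.prod_comm]
  refine Finset.prod_congr rfl fun x _ => ?_
  rw [Finset.prod_eq_single (f x)]
  · simp
  · intro b _ hb; simp [hb.symm]
  · simp

lemma sectional_one_ne_zero {κ : Fin D → Fin D → ℝ} {a b c e : Fin D}
    (h : sectional κ 1 a b c e ≠ 0) : (a = c ∧ b = e) ∨ (a = e ∧ b = c) := by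
  unfold sectional at h
  by_contra hn
  push Not at hn
  apply h
  by_cases h₁ : a = c <;> by_cases h₂ : a = e <;> simp_all

/-- Contractions of sectional curvature tensors do not depend on the norms of the frame. -/
lemma contract_sectional {n m : ℕ} (e : Fin n × Fin 4 ≃ Fin m × Fin 2) (κ : Fin D → Fin D → ℝ)
    {h : Fin D → ℝ} (hh : ∀ a, h a ≠ 0) :
    contract e (diagMat h⁻¹) (tensorPower n (sectional κ h))
      = contract e (diagMat 1) (tensorPower n (sectional κ 1)) := by
  unfold contract
  refine Finset.sum_congr rfl fun i _ => ?_
  -- The contracting matrices are diagonal, so only index assignments that are constant on each pair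
  -- contribute.
  by_cases h₁ : ∀ j, i (e.symm (j, 0)) = i (e.symm (j, 1))
  swap
  · push Not at h₁
    obtain ⟨j, hj⟩ := h₁
    rw [Finset.prod_eq_zero (Finset.mem_univ j), Finset.prod_eq_zero (Finset.mem_univ j)] <;>
      simp [diagMat, hj]
  have e₁ : ∀ k : Fin D → ℝ, ∏ j, diagMat k (i (e.symm (j, 0))) (i (e.symm (j, 1)))
      = ∏ j, k (i (e.symm (j, 0))) := fun k =>
    Finset.prod_congr rfl fun j _ => by simp [diagMat, h₁ j]
  have e₂ : tensorPower n (sectional κ h) i = (∏ p : Fin n × Fin 2, h (i (p.1, p.2.castLE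
      (by norm_num)))) * tensorPower n (sectional κ 1) i := by
    simp only [tensorPower, sectional_eq_mul κ h, Finset.prod_mul_distrib, Fintype.prod_prod_type]
    simp [Finset.prod_mul_distrib]
  rw [e₁, e₁, e₂]
  by_cases h₂ : tensorPower n (sectional κ 1) i = 0
  · simp [h₂]
  have h₃ : ∀ k, (i (k, 0) = i (k, 2) ∧ i (k, 1) = i (k, 3)) ∨
      (i (k, 0) = i (k, 3) ∧ i (k, 1) = i (k, 2)) := fun k =>
    sectional_one_ne_zero (Finset.prod_ne_zero_iff.1 h₂ k (Finset.mem_univ k))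
  -- In both products the exponent of `h a` is half the number of slots carrying the index `a`: each
  -- pair uses an index twice, and in a non-zero sectional factor the last two indices repeat the
  -- first two.
  have key : ∏ p : Fin n × Fin 2, h (i (p.1, p.2.castLE (by norm_num)))
      = ∏ j, h (i (e.symm (j, 0))) := by
    rw [prod_comp_eq h, prod_comp_eq h]
    refine Finset.prod_congr rfl fun a _ => ?_
    congr 1
    have t : ∑ s, (if i s = a then 1 else 0) = 2 * ∑ j, if i (e.symm (j, 0)) = a then 1 else 0 := by
      rw [← e.symm.sum_comp, Fintype.sum_prod_type, Finset.mul_sum]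
      refine Finset.sum_congr rfl fun j _ => ?_
      rw [Fin.sum_univ_two, ← h₁ j]; ring
    have t' : ∑ s, (if i s = a then 1 else 0)
        = 2 * ∑ p : Fin n × Fin 2, if i (p.1, p.2.castLE (by norm_num)) = a then 1 else 0 := by
      rw [Fintype.sum_prod_type, Fintype.sum_prod_type, Finset.mul_sum]
      refine Finset.sum_congr rfl fun k _ => ?_
      rw [Fin.sum_univ_four, Fin.sum_univ_two]
      simp only [Fin.castLE_zero, Fin.isValue]
      rw [show (Fin.castLE (by norm_num : 2 ≤ 4) 1) = 1 from rfl]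
      rcases h₃ k with ⟨u, v⟩ | ⟨u, v⟩ <;> rw [u, v] <;> ring
    omega
  rw [key, mul_right_comm]
  simp only [Pi.inv_apply, Finset.prod_inv_distrib, Pi.one_apply, Finset.prod_const_one, mul_one]
  rw [mul_inv_cancel₀ (Finset.prod_ne_zero_iff.2 fun j _ => hh _), one_mul]

/-- The norms `h` may be negative, so this also removes the Lorentzian signature: invariants of
static spherically symmetric metrics can be computed with the identity matrix as metric. -/
lemma contractions_sectional {n : ℕ}
    {φ : (Fin D → Fin D → ℝ) → ((Fin n × Fin 4 → Fin D) → ℝ) →ₗ[ℝ] ℝ}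
    (hφ : φ ∈ contractions D (Fin n × Fin 4)) (κ : Fin D → Fin D → ℝ)
    {h : Fin D → ℝ} (hh : ∀ a, h a ≠ 0) :
    φ (diagMat h⁻¹) (tensorPower n (sectional κ h))
      = φ (diagMat 1) (tensorPower n (sectional κ 1)) := by
  induction hφ using Submodule.span_induction with
  | mem φ hφ =>
    obtain ⟨⟨m, e⟩, rfl⟩ := hφ
    exact contract_sectional e κ hh
  | zero => rfl
  | add φ ψ _ _ h₁ h₂ => simp [h₁, h₂]
  | smul c φ _ h₁ => simp [h₁]

/-- Contraction with the identity matrix is a sum over one index for each pair. -/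
lemma contract_one {S : Type} [Fintype S] [DecidableEq S] {m : ℕ} (e : S ≃ Fin m × Fin 2)
    (T : (S → Fin D) → ℝ) :
    contract e (diagMat 1) T = ∑ k : Fin m → Fin D, T (fun s => k (e s).1) := by
  symm
  refine Finset.sum_of_injOn (fun k s => k (e s).1) ?_ (fun _ _ => by simp) ?_ ?_
  · intro k _ k' _ h
    funext j
    have := congrFun h (e.symm (j, 0))
    simpa using this
  · intro i _ hi
    by_cases h : ∀ j, i (e.symm (j, 0)) = i (e.symm (j, 1))
    · exfalso
      refine hi ⟨fun j => i (e.symm (j, 0)), by simp, ?_⟩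
      funext s
      obtain ⟨⟨j, b⟩, rfl⟩ := e.symm.surjective s
      simp only [Equiv.apply_symm_apply]
      rcases (by fin_cases b <;> simp : b = 0 ∨ b = 1) with rfl | rfl
      · rfl
      · exact h j
    · push Not at h
      obtain ⟨j, hj⟩ := h
      rw [Finset.prod_eq_zero (Finset.mem_univ j), mul_zero]
      simp [diagMat, hj]
  · intro k _
    rw [Finset.prod_eq_one, mul_one]
    intro j _
    simp [diagMat]

lemma isInversePair_one : IsInversePair (diagMat 1 : Fin D → Fin D → ℝ) (diagMat 1) := by
  refine ⟨fun a b => ?_, fun a b => ?_, fun a c => ?_⟩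
  · simp [diagMat, eq_comm]
  · simp [diagMat, eq_comm]
  · simp [diagMat]

variable {κ : Fin D → Fin D → ℝ}

lemma sectional_mul_sum (κ : Fin D → Fin D → ℝ) (a b : Fin D) (F : Fin D → Fin D → ℝ) :
    ∑ c, ∑ e, sectional κ 1 a b c e * F c e = κ a b * (F a b - F b a) := by
  simp [sectional, mul_sub, sub_mul, Finset.sum_sub_distrib]

lemma sectional_trace (h0 : ∀ a, κ a a = 0) (p b e : Fin D) :
    sectional κ 1 p b p e = if b = e then κ p b else 0 := by
  by_cases h₁ : b = e <;> by_cases h₂ : p = e <;> by_cases h₃ : b = p <;> simp_all [sectional]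

lemma sectional_swap_left (hs : ∀ a b, κ a b = κ b a) (a b c e : Fin D) :
    sectional κ 1 b a c e = - sectional κ 1 a b c e := by
  simp only [sectional, hs b a]; ring

lemma ricciOf_sectional (h0 : ∀ a, κ a a = 0) (b e : Fin D) :
    ricciOf (diagMat 1) (sectional κ 1) b e = diagMat (fun b => ∑ p, κ p b) b e := by
  simp only [ricciOf, diagMat, Pi.one_apply, ite_mul, one_mul, zero_mul, Finset.sum_ite_eq,
    Finset.mem_univ, if_true, sectional_trace h0]
  split_ifs <;> simp

lemma scalarOf_sectional (h0 : ∀ a, κ a a = 0) :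
    scalarOf (diagMat 1) (sectional κ 1) = ∑ b, ∑ p, κ p b := by
  simp only [scalarOf, ricciOf_sectional h0]
  simp [diagMat]

lemma sum_vecCons {n : ℕ} (F : (Fin (n + 1) → Fin D) → ℝ) :
    ∑ k, F k = ∑ p, ∑ k : Fin n → Fin D, F (Matrix.vecCons p k) := by
  rw [← (Fin.consEquiv (fun _ => Fin D)).sum_comp, Fintype.sum_prod_type]
  rfl

/-! ## Static spherically symmetric sectional curvatures -/

/-- The sectional curvatures `A` of the plane `(t, r)`, `B` of the mixed planes and `ψ` of the
angular planes. -/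
def sssCurv (d : ℕ) (A B ψ : ℝ) (a b : Fin (d + 2)) : ℝ :=
  if a = b then 0 else if (a : ℕ) < 2 ∧ (b : ℕ) < 2 then A
    else if (a : ℕ) < 2 ∨ (b : ℕ) < 2 then B else ψ

lemma sssCurv_self (A B ψ : ℝ) (a : Fin (d + 2)) : sssCurv d A B ψ a a = 0 := by simp [sssCurv]

lemma sssCurv_symm (A B ψ : ℝ) (a b : Fin (d + 2)) :
    sssCurv d A B ψ a b = sssCurv d A B ψ b a := by
  simp only [sssCurv, eq_comm, and_comm, or_comm]

lemma sum_fin_add_two (F : Fin (d + 2) → ℝ) :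
    ∑ a, F a = F 0 + F 1 + ∑ i : Fin d, F i.succ.succ := by
  rw [Fin.sum_univ_succ, Fin.sum_univ_succ, ← add_assoc]; rfl

lemma sum_ite_ne (x : ℝ) (i : Fin d) : ∑ j : Fin d, (if i = j then 0 else x) = (d - 1) * x := by
  have : ∀ j : Fin d, (if i = j then 0 else x) = x - if i = j then x else 0 := by
    intro j; split_ifs <;> simp
  simp [this, Finset.sum_sub_distrib]; ring

lemma sssCurv_zero_one (A B ψ : ℝ) : sssCurv d A B ψ 0 1 = A := by simp [sssCurv]
lemma sssCurv_one_zero (A B ψ : ℝ) : sssCurv d A B ψ 1 0 = A := by simp [sssCurv]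
lemma sssCurv_zero_succ (A B ψ : ℝ) (i : Fin d) : sssCurv d A B ψ 0 i.succ.succ = B := by
  simp [sssCurv, Fin.ext_iff]
lemma sssCurv_one_succ (A B ψ : ℝ) (i : Fin d) : sssCurv d A B ψ 1 i.succ.succ = B := by
  simp [sssCurv, Fin.ext_iff]
lemma sssCurv_succ_zero (A B ψ : ℝ) (i : Fin d) : sssCurv d A B ψ i.succ.succ 0 = B := by
  rw [sssCurv_symm, sssCurv_zero_succ]
lemma sssCurv_succ_one (A B ψ : ℝ) (i : Fin d) : sssCurv d A B ψ i.succ.succ 1 = B := by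
  rw [sssCurv_symm, sssCurv_one_succ]
lemma sssCurv_succ_succ (A B ψ : ℝ) (i j : Fin d) :
    sssCurv d A B ψ i.succ.succ j.succ.succ = if i = j then 0 else ψ := by
  simp [sssCurv]

/-- A function of the two kinds of directions. -/
def twoBlock (d : ℕ) (u v : ℝ) (a : Fin (d + 2)) : ℝ := if (a : ℕ) < 2 then u else v

lemma twoBlock_zero (u v : ℝ) : twoBlock d u v 0 = u := by simp [twoBlock]
lemma twoBlock_one (u v : ℝ) : twoBlock d u v 1 = u := by simp [twoBlock]
lemma twoBlock_succ (u v : ℝ) (i : Fin d) : twoBlock d u v i.succ.succ = v := by simp [twoBlock]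

lemma fin_add_two_cases {p : Fin (d + 2) → Prop} (h0 : p 0) (h1 : p 1)
    (hs : ∀ i : Fin d, p i.succ.succ) : ∀ a, p a := by
  intro a
  refine Fin.cases h0 (fun b => ?_) a
  exact Fin.cases h1 hs b

/-- These row sums are the Ricci eigenvalues, one for the directions `t`, `r` and one for the
angular directions. -/
lemma sum_sssCurv_left (A B ψ : ℝ) (b : Fin (d + 2)) :
    ∑ p, sssCurv d A B ψ p b = twoBlock d (A + d * B) (2 * B + (d - 1) * ψ) b := by
  simp_rw [sssCurv_symm _ _ _ _ b]
  revert b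
  refine fin_add_two_cases ?_ ?_ (fun i => ?_)
  · rw [sum_fin_add_two, twoBlock_zero]
    simp [sssCurv_self, sssCurv_zero_one, sssCurv_zero_succ]
  · rw [sum_fin_add_two, twoBlock_one]
    simp [sssCurv_self, sssCurv_one_zero, sssCurv_one_succ]
  · rw [sum_fin_add_two, twoBlock_succ]
    simp only [sssCurv_succ_zero, sssCurv_succ_one, sssCurv_succ_succ, sum_ite_ne]
    ring

lemma sum_twoBlock (F : ℝ → ℝ) (u v : ℝ) : ∑ a, F (twoBlock d u v a) = 2 * F u + d * F v := by
  rw [sum_fin_add_two]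
  simp [twoBlock_zero, twoBlock_one, twoBlock_succ]; ring

lemma sum_sssCurv_comp (F : ℝ → ℝ) (hF : F 0 = 0) (A B ψ : ℝ) :
    ∑ a, ∑ b, F (sssCurv d A B ψ a b) = 2 * F A + 4 * d * F B + d * (d - 1) * F ψ := by
  have : ∀ i j : Fin d, F (if i = j then 0 else ψ) = if i = j then 0 else F ψ := by
    intro i j; split_ifs <;> simp [hF]
  simp only [sum_fin_add_two, sssCurv_self, hF, sssCurv_zero_one, sssCurv_one_zero,
    sssCurv_zero_succ, sssCurv_one_succ, sssCurv_succ_zero, sssCurv_succ_one, sssCurv_succ_succ,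
    this, Finset.sum_add_distrib, sum_ite_ne]
  simp; ring

lemma sum_sssCurv_twoBlock (A B ψ u v : ℝ) :
    ∑ a, ∑ b, sssCurv d A B ψ a b * (twoBlock d u v a * twoBlock d u v b)
      = 2 * A * u ^ 2 + 4 * d * B * u * v + d * (d - 1) * ψ * v ^ 2 := by
  simp only [sum_fin_add_two, sssCurv_self, sssCurv_zero_one, sssCurv_one_zero, ite_mul, zero_mul,
    sssCurv_zero_succ, sssCurv_one_succ, sssCurv_succ_zero, sssCurv_succ_one, sssCurv_succ_succ,
    twoBlock_zero, twoBlock_one, twoBlock_succ, Finset.sum_add_distrib, sum_ite_ne]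
  simp; ring

/-- The amplitude of the Weyl tensor of a static and spherically symmetric metric. -/
def weylAmp (d : ℕ) (A B ψ : ℝ) : ℝ := (d - 1) / (d + 1) * (A - 2 * B + ψ)

/-- The sectional curvatures of the Weyl tensor of amplitude one. -/
def weylCurv (d : ℕ) : Fin (d + 2) → Fin (d + 2) → ℝ := sssCurv d 1 (-1 / d) (2 / (d * (d - 1)))

/-- The Schouten tensor is diagonal with entries `p`, constant on the two blocks, so the
Kulkarni–Nomizu product subtracts `p a + p b` from each sectional curvature. Of the three
parameters, tracelessness leaves only one. -/
lemma weyl_sssCurv (hd : 1 ≤ d) (A B ψ : ℝ) :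
    weyl (diagMat 1) (diagMat 1) (sectional (sssCurv d A B ψ) 1)
      = fun a b c e => weylAmp d A B ψ * sectional (weylCurv d) 1 a b c e := by
  have hd0 : (d : ℝ) ≠ 0 := by positivity
  have hd1 : (d + 1 : ℝ) ≠ 0 := by positivity
  set S := 2 * (A + d * B) + d * (2 * B + (d - 1) * ψ) with hS
  set p := twoBlock d ((d : ℝ)⁻¹ * (A + d * B - S / (2 * (d + 1))))
    ((d : ℝ)⁻¹ * (2 * B + (d - 1) * ψ - S / (2 * (d + 1)))) with hp
  have hsch : schouten (diagMat 1) (diagMat 1) (sectional (sssCurv d A B ψ) 1)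
      = diagMat p := by
    funext a b
    simp only [schouten, ricciOf_sectional (sssCurv_self A B ψ),
      scalarOf_sectional (sssCurv_self A B ψ), sum_sssCurv_left]
    rw [sum_twoBlock (fun x => x), ← hS]
    simp only [diagMat, hp]
    by_cases hab : a = b
    · subst hab
      simp only [if_true, twoBlock]
      split_ifs <;> simp only [Pi.one_apply] <;> ring
    · simp [hab, Ne.symm hab]
  funext a b c e
  have h₁ : weyl (diagMat 1) (diagMat 1) (sectional (sssCurv d A B ψ) 1) a b c e
      = (sssCurv d A B ψ a b - p a - p b) * ((if a = c then 1 else 0) * (if b = e then 1 else 0)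
    - (if a = e then 1 else 0) * (if b = c then 1 else 0)) := by
    simp only [weyl, hsch, kulkarniNomizu, diagMat, sectional, Pi.one_apply]
    by_cases h₁ : a = c <;> by_cases h₂ : a = e <;> by_cases h₃ : b = c <;>
      by_cases h₄ : b = e <;> simp_all <;> ring
  rw [h₁]
  by_cases hab : a = b
  · subst hab
    simp [sectional, mul_comm]
  have h₂ : sssCurv d A B ψ a b - p a - p b = weylAmp d A B ψ * weylCurv d a b := by
    simp only [hp, sssCurv, weylCurv, twoBlock, hab, if_false, weylAmp]
    by_cases ha : (a : ℕ) < 2 <;> by_cases hb : (b : ℕ) < 2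
    · simp only [ha, hb, and_self, if_true, hS]; field_simp; ring
    · simp only [ha, hb, and_false, if_false, true_or, if_true, hS]; field_simp; ring
    · simp only [ha, hb, false_and, if_false, or_true, if_true, hS]; field_simp; ring
    -- A plane spanned by two distinct angular directions exists only for `d ≥ 2`; for `d = 1` the
    -- division by `d - 1` in `weylCurv` is never met off the diagonal.
    · have : (d - 1 : ℝ) ≠ 0 := by
        have h3 : 2 ≤ d := by
          have := a.2; have := b.2
          have : (a : ℕ) ≠ b := fun h => hab (Fin.ext h)
          omega
        have : (2 : ℝ) ≤ d := by exact_mod_cast h3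
        intro h; linarith
      simp only [ha, hb, and_self, if_false, or_self, hS]; field_simp; ring
  rw [h₂]
  simp [sectional]; ring

lemma tensorPower_smul (n : ℕ) (s : ℝ) (R : Fin D → Fin D → Fin D → Fin D → ℝ) :
    tensorPower n (fun a b c e => s * R a b c e) = s ^ n • tensorPower n R := by
  funext i
  simp [tensorPower, Finset.prod_mul_distrib]

lemma weylCurv_row (hd : 2 ≤ d) (b : Fin (d + 2)) : ∑ p, weylCurv d p b = 0 := by
  have h2 : (2 : ℝ) ≤ d := by exact_mod_cast hd
  have hd0 : (d : ℝ) ≠ 0 := by positivity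
  have hd1 : (d - 1 : ℝ) ≠ 0 := by intro h; linarith
  rw [weylCurv, sum_sssCurv_left]
  have e₁ : (1 : ℝ) + d * (-1 / d) = 0 := by field_simp; ring
  have e₂ : 2 * (-1 / d) + (d - 1) * (2 / (d * (d - 1))) = (0 : ℝ) := by field_simp; ring
  rw [e₁, e₂]
  simp [twoBlock]

/-- The contractions of a single Weyl tensor vanish. -/
lemma contractions_weylCurv_one (hd : 2 ≤ d)
    {φ : (Fin (d + 2) → Fin (d + 2) → ℝ) → ((Fin 1 × Fin 4 → Fin (d + 2)) → ℝ) →ₗ[ℝ] ℝ}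
    (hφ : φ ∈ contractions (d + 2) (Fin 1 × Fin 4)) :
    φ (diagMat 1) (tensorPower 1 (sectional (weylCurv d) 1)) = 0 := by
  induction hφ using Submodule.span_induction with
  | mem φ hφ =>
    obtain ⟨⟨m, e⟩, rfl⟩ := hφ
    obtain rfl : m = 2 := by
      have := Fintype.card_congr e
      simp at this; omega
    change contract _ _ _ = 0
    -- Only the pair containing each of the four slots matters. In every case the summand vanishes
    -- by antisymmetry or is, up to sign, the double trace of `weylCurv`, which is zero.
    rw [contract_one]
    simp only [tensorPower, Fin.prod_univ_one]
    generalize (e (0, 0)).1 = u₀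
    generalize (e (0, 1)).1 = u₁
    generalize (e (0, 2)).1 = u₂
    generalize (e (0, 3)).1 = u₃
    have h0 : ∀ a, weylCurv d a a = 0 := sssCurv_self _ _ _
    have hrow : ∑ a, ∑ b, weylCurv d a b = 0 := by
      rw [Finset.sum_comm]; exact Finset.sum_eq_zero fun b _ => weylCurv_row hd b
    have hrow' : ∑ a, ∑ b, weylCurv d b a = 0 :=
      Finset.sum_eq_zero fun b _ => weylCurv_row hd b
    have e₀ : ∀ a c e, sectional (weylCurv d) 1 a a c e = 0 := by
      intro a c e; simp [sectional, h0]
    have e₁ : ∀ a b c, sectional (weylCurv d) 1 a b c c = 0 := by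
      intro a b c; simp [sectional]
    have e₂ : ∀ a b, sectional (weylCurv d) 1 a b a b = weylCurv d a b := by
      intro a b; rw [sectional_trace h0]; simp
    have e₃ : ∀ a b, sectional (weylCurv d) 1 a b b a = - weylCurv d a b := by
      intro a b
      by_cases hab : a = b
      · subst hab; simp [e₀, h0]
      · simp [sectional, hab]
    have f : ∀ u : Fin 2, u = 0 ∨ u = 1 := by decide
    simp only [sum_vecCons, Fintype.sum_unique]
    rcases f u₀ with rfl | rfl <;> rcases f u₁ with rfl | rfl <;> rcases f u₂ with rfl | rfl <;>
      rcases f u₃ with rfl | rfl <;> simp [e₀, e₁, e₂, e₃, hrow, hrow']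
  | zero => rfl
  | add φ ψ _ _ h₁ h₂ => simp [h₁, h₂]
  | smul c φ _ h₁ => simp [h₁]

end Sectional

/-! ## Polynomials realized by curvature invariants -/

section Realized

variable {d : ℕ}

/-- The function `P` of the sectional curvatures is the value of an invariant of order `n`. -/
def IsRealized (d n : ℕ) (P : ℝ → ℝ → ℝ → ℝ) : Prop :=
  ∃ φ ∈ contractions (d + 2) (Fin n × Fin 4), ∀ A B ψ,
    φ (diagMat 1) (tensorPower n (sectional (sssCurv d A B ψ) 1)) = P A B ψ

lemma IsRealized.add {n : ℕ} {P P' : ℝ → ℝ → ℝ → ℝ} (h : IsRealized d n P)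
    (h' : IsRealized d n P') : IsRealized d n (fun A B ψ => P A B ψ + P' A B ψ) := by
  obtain ⟨φ, hφ, h⟩ := h
  obtain ⟨φ', hφ', h'⟩ := h'
  exact ⟨φ + φ', Submodule.add_mem _ hφ hφ', fun A B ψ => by simp [h, h']⟩

lemma IsRealized.smul {n : ℕ} {P : ℝ → ℝ → ℝ → ℝ} (c : ℝ) (h : IsRealized d n P) :
    IsRealized d n (fun A B ψ => c * P A B ψ) := by
  obtain ⟨φ, hφ, h⟩ := h
  exact ⟨c • φ, Submodule.smul_mem _ c hφ, fun A B ψ => by simp [h]⟩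

lemma IsRealized.mul {n m : ℕ} {P P' : ℝ → ℝ → ℝ → ℝ} (h : IsRealized d n P)
    (h' : IsRealized d m P') : IsRealized d (n + m) (fun A B ψ => P A B ψ * P' A B ψ) := by
  obtain ⟨φ, hφ, h⟩ := h
  obtain ⟨φ', hφ', h'⟩ := h'
  obtain ⟨χ, hχ, hχ'⟩ := exists_contractions_prod hφ hφ'
  obtain ⟨χ', hχm, h₁⟩ := Transfer.relabel
    (fun R : Fin (d + 2) → Fin (d + 2) → Fin (d + 2) → Fin (d + 2) → ℝ => diagMat 1)
    (fun R => tprod (tensorPower n R) (tensorPower m R))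
    ((Equiv.sumProdDistrib _ _ _).symm.trans (finSumFinEquiv.prodCongr (Equiv.refl (Fin 4)))) χ hχ
  refine ⟨χ', hχm, fun A B ψ => ?_⟩
  change _ = P A B ψ * P' A B ψ
  rw [← h, ← h', ← hχ', h₁]
  congr 1
  funext i
  simp [tprod, tensorPower, Fin.prod_univ_add]

/-- The contraction pattern of the scalar curvature. -/
def scalarPattern : Fin 1 × Fin 4 ≃ Fin 2 × Fin 2 where
  toFun s := ![(0, 0), (1, 0), (0, 1), (1, 1)] s.2
  invFun p := (0, ![![0, 2], ![1, 3]] p.1 p.2)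
  left_inv := by decide
  right_inv := by decide

/-- The contraction pattern of `R_{ab} R^{ab}`. -/
def ricciSqPattern : Fin 2 × Fin 4 ≃ Fin 4 × Fin 2 where
  toFun s := ![![(2, 0), (0, 0), (2, 1), (1, 0)], ![(3, 0), (0, 1), (3, 1), (1, 1)]] s.1 s.2
  invFun p := ![![(0, 1), (1, 1)], ![(0, 3), (1, 3)], ![(0, 0), (0, 2)], ![(1, 0), (1, 2)]] p.1 p.2
  left_inv := by decide
  right_inv := by decide

/-- The contraction pattern of `R_{ac} R_{be} R^{abce}`. -/
def ricciRicciPattern : Fin 3 × Fin 4 ≃ Fin 6 × Fin 2 where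
  toFun s := ![![(4, 0), (0, 1), (4, 1), (2, 1)], ![(5, 0), (1, 1), (5, 1), (3, 1)],
    ![(0, 0), (1, 0), (2, 0), (3, 0)]] s.1 s.2
  invFun p := ![![(2, 0), (0, 1)], ![(2, 1), (1, 1)], ![(2, 2), (0, 3)], ![(2, 3), (1, 3)],
    ![(0, 0), (0, 2)], ![(1, 0), (1, 2)]] p.1 p.2
  left_inv := by decide
  right_inv := by decide

/-- The contraction pattern of `R_{ab}^{ce} R_{ce}^{fg} R_{fg}^{ab}`. -/
def cubicPattern : Fin 3 × Fin 4 ≃ Fin 6 × Fin 2 where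
  toFun s := ![![(0, 0), (1, 0), (2, 0), (3, 0)], ![(2, 1), (3, 1), (4, 0), (5, 0)],
    ![(4, 1), (5, 1), (0, 1), (1, 1)]] s.1 s.2
  invFun p := ![![(0, 0), (2, 2)], ![(0, 1), (2, 3)], ![(0, 2), (1, 0)], ![(0, 3), (1, 1)],
    ![(1, 2), (2, 0)], ![(1, 3), (2, 1)]] p.1 p.2
  left_inv := by decide
  right_inv := by decide

/-! ### Explicit contractions of sectional curvature tensors, and the polynomials they realize -/

variable {D : ℕ} {κ : Fin D → Fin D → ℝ}

lemma contract_scalarPattern (h0 : ∀ a, κ a a = 0) :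
    contract scalarPattern (diagMat 1) (tensorPower 1 (sectional κ 1)) = ∑ b, ∑ p, κ p b := by
  rw [contract_one, Finset.sum_comm]
  simp only [sum_vecCons, Fintype.sum_unique, tensorPower, Fin.prod_univ_one]
  simp [scalarPattern, sectional_trace h0]

lemma contract_prodComm (h0 : ∀ a, κ a a = 0) (hs : ∀ a b, κ a b = κ b a) :
    contract (Equiv.prodComm (Fin 2) (Fin 4)) (diagMat 1) (tensorPower 2 (sectional κ 1))
      = 2 * ∑ a, ∑ b, κ a b ^ 2 := by
  rw [contract_one]
  simp only [sum_vecCons, Fintype.sum_unique, tensorPower, Fin.prod_univ_two]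
  simp only [Equiv.prodComm_apply, Prod.fst_swap, Matrix.cons_val_zero, Matrix.cons_val_one,
    Matrix.cons_val, sectional_mul_sum]
  rw [Finset.mul_sum]
  refine Finset.sum_congr rfl fun a _ => ?_
  rw [Finset.mul_sum]
  refine Finset.sum_congr rfl fun b _ => ?_
  have e₃ : sectional κ 1 a b b a = - κ a b := by
    rw [sectional_swap_left hs, sectional_trace h0, hs]; simp
  rw [e₃, sectional_trace h0]; simp; ring

lemma contract_ricciSqPattern (h0 : ∀ a, κ a a = 0) :
    contract ricciSqPattern (diagMat 1) (tensorPower 2 (sectional κ 1))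
      = ∑ b, (∑ p, κ p b) ^ 2 := by
  rw [contract_one]
  simp only [sum_vecCons, Fintype.sum_unique, tensorPower, Fin.prod_univ_two]
  simp only [ricciSqPattern, Equiv.coe_fn_mk, Matrix.cons_val_zero, Matrix.cons_val_one,
    Matrix.cons_val, sectional_trace h0]
  refine Finset.sum_congr rfl fun a _ => ?_
  rw [Finset.sum_eq_single a]
  · simp [sq, Finset.sum_mul_sum]
  · intro b _ hb; simp [hb.symm]
  · simp

/-- The third factor has its own curvatures `w`: it is later replaced by the Weyl tensor while the
two Ricci factors stay those of the full Riemann tensor. -/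
lemma contract_ricciRicciPattern (h0 : ∀ a, κ a a = 0) {w : Fin D → Fin D → ℝ}
    (w0 : ∀ a, w a a = 0) :
    contract ricciRicciPattern (diagMat 1) (fun i => tprod (tensorPower 2 (sectional κ 1))
        (tens₄ (sectional w 1)) (fun s => i ((slotSucc 2).symm s)))
      = ∑ a, ∑ b, w a b * ((∑ p, κ p a) * (∑ p, κ p b)) := by
  have e₀ : (slotSucc 2).symm = fun s => Sum.elim (fun s : Fin 2 × Fin 4 => (s.1.castSucc, s.2))
      (fun s => (Fin.last 2, s)) s := by
    funext s
    rw [Equiv.symm_apply_eq]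
    rcases s with ⟨k, s⟩ | s
    · simp
    · exact (slotSucc_last 2 s).symm
  rw [contract_one]
  simp only [e₀, tprod, tens₄, Sum.elim_inl, Sum.elim_inr, tensorPower, Fin.prod_univ_two]
  simp only [sum_vecCons, Fintype.sum_unique]
  simp only [ricciRicciPattern, Equiv.coe_fn_mk, Matrix.cons_val_zero, Matrix.cons_val_one,
    Matrix.cons_val, sectional_trace h0, Fin.castSucc_zero, Fin.castSucc_one, Fin.reduceLast]
  refine Finset.sum_congr rfl fun a _ => Finset.sum_congr rfl fun b _ => ?_
  rw [Finset.sum_eq_single a]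
  · rw [Finset.sum_eq_single b]
    · simp only [if_true, sectional_trace w0, Finset.sum_mul_sum]
      simp only [Finset.mul_sum]
      refine Finset.sum_congr rfl fun p _ => Finset.sum_congr rfl fun q _ => ?_
      ring
    · intro c _ hc; simp [hc.symm]
    · simp
  · intro c _ hc; simp [hc.symm]
  · simp

lemma contract_cubicPattern (h0 : ∀ a, κ a a = 0) (hs : ∀ a b, κ a b = κ b a) :
    contract cubicPattern (diagMat 1) (tensorPower 3 (sectional κ 1))
      = 4 * ∑ a, ∑ b, κ a b ^ 3 := by
  rw [contract_one]
  simp only [sum_vecCons, Fintype.sum_unique, tensorPower, Fin.prod_univ_three]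
  simp only [cubicPattern, Equiv.coe_fn_mk, Matrix.cons_val_zero, Matrix.cons_val_one,
    Matrix.cons_val]
  have e₁ : ∀ a b c e, ∑ f, ∑ g, sectional κ 1 a b c e * sectional κ 1 c e f g *
      sectional κ 1 f g a b = sectional κ 1 a b c e * (2 * κ c e * sectional κ 1 c e a b) := by
    intro a b c e
    simp_rw [mul_assoc, ← Finset.mul_sum]
    rw [sectional_mul_sum κ c e (fun f g => sectional κ 1 f g a b), sectional_swap_left hs c e]
    ring
  simp_rw [e₁]
  have e₂ : ∀ a b, ∑ c, ∑ e, sectional κ 1 a b c e * (2 * κ c e * sectional κ 1 c e a b)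
      = 4 * κ a b ^ 3 := by
    intro a b
    have e₃ : sectional κ 1 b a a b = - κ a b := by
      rw [sectional_swap_left hs, sectional_trace h0]; simp
    rw [sectional_mul_sum κ a b (fun c e => 2 * κ c e * sectional κ 1 c e a b),
      sectional_trace h0, e₃, hs b a]
    simp; ring
  simp_rw [e₂, Finset.mul_sum]

lemma isRealized_scalar : IsRealized d 1
    (fun A B ψ => 2 * (A + d * B) + d * (2 * B + (d - 1) * ψ)) := by
  refine ⟨_, contractLin_mem scalarPattern, fun A B ψ => ?_⟩
  change contract _ _ _ = _
  rw [contract_scalarPattern (sssCurv_self A B ψ)]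
  simp only [sum_sssCurv_left]
  exact sum_twoBlock (fun x => x) _ _

lemma isRealized_ricciSq : IsRealized d 2
    (fun A B ψ => 2 * (A + d * B) ^ 2 + d * (2 * B + (d - 1) * ψ) ^ 2) := by
  refine ⟨_, contractLin_mem ricciSqPattern, fun A B ψ => ?_⟩
  change contract _ _ _ = _
  rw [contract_ricciSqPattern (sssCurv_self A B ψ)]
  simp only [sum_sssCurv_left]
  exact sum_twoBlock (fun x => x ^ 2) _ _

/-- The coefficient of the Weyl part of an invariant on static spherically symmetric metrics. -/
def weylCoeff {n : ℕ}
    (φ : (Fin (d + 2) → Fin (d + 2) → ℝ) → ((Fin n × Fin 4 → Fin (d + 2)) → ℝ) →ₗ[ℝ] ℝ) : ℝ :=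
  φ (diagMat 1) (tensorPower n (sectional (weylCurv d) 1))

lemma weylCoeff_spec (hd : 1 ≤ d) {n : ℕ}
    (φ : (Fin (d + 2) → Fin (d + 2) → ℝ) → ((Fin n × Fin 4 → Fin (d + 2)) → ℝ) →ₗ[ℝ] ℝ)
    (A B ψ : ℝ) :
    φ (diagMat 1) (tensorPower n (weyl (diagMat 1) (diagMat 1) (sectional (sssCurv d A B ψ) 1)))
      = weylAmp d A B ψ ^ n * weylCoeff φ := by
  rw [weyl_sssCurv hd, tensorPower_smul, map_smul, smul_eq_mul, weylCoeff]

/-- The Weyl part of the contraction `e` is an invariant with value `weylAmp ^ n` times a constant,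
so one pattern with non-zero constant suffices. -/
lemma isRealized_weylAmp_pow (hd : 1 ≤ d) {n m : ℕ} (e : Fin n × Fin 4 ≃ Fin m × Fin 2)
    (h : contract e (diagMat 1) (tensorPower n (sectional (weylCurv d) 1)) ≠ 0) :
    IsRealized d n (fun A B ψ => weylAmp d A B ψ ^ n) := by
  obtain ⟨φ', hφ', h'⟩ := exists_weylPart (contractLin_mem (D := d + 2) e)
  have : IsRealized d n (fun A B ψ => (contract e (diagMat 1)
      (tensorPower n (sectional (weylCurv d) 1)))⁻¹ * (weylAmp d A B ψ ^ n *
        weylCoeff (contractLin (D := d + 2) e))) :=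
    IsRealized.smul _ ⟨φ', hφ', fun A B ψ => by
      rw [h' _ _ _ isInversePair_one, weylCoeff_spec hd]⟩
  convert this using 4 with A B ψ
  change _ = _ * (_ * contract e (diagMat 1) (tensorPower n (sectional (weylCurv d) 1)))
  field_simp

lemma isRealized_weylAmp_sq (hd : 2 ≤ d) : IsRealized d 2 (fun A B ψ => weylAmp d A B ψ ^ 2) := by
  refine isRealized_weylAmp_pow (by omega) (Equiv.prodComm (Fin 2) (Fin 4)) ?_
  rw [contract_prodComm (κ := weylCurv d) (sssCurv_self _ _ _) (sssCurv_symm _ _ _), weylCurv,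
    sum_sssCurv_comp (fun x => x ^ 2) (by norm_num)]
  have h2 : (2 : ℝ) ≤ d := by exact_mod_cast hd
  have hd1 : (0 : ℝ) < d - 1 := by linarith
  positivity

lemma isRealized_weylAmp_cube (hd : 2 ≤ d) :
    IsRealized d 3 (fun A B ψ => weylAmp d A B ψ ^ 3) := by
  refine isRealized_weylAmp_pow (by omega) cubicPattern ?_
  rw [contract_cubicPattern (κ := weylCurv d) (sssCurv_self _ _ _) (sssCurv_symm _ _ _), weylCurv,
    sum_sssCurv_comp (fun x => x ^ 3) (by norm_num)]
  have h2 : (2 : ℝ) ≤ d := by exact_mod_cast hd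
  have hd1 : (0 : ℝ) < d - 1 := by linarith
  -- The mixed planes give the only negative term of the cubic sum; it is at most 1 in absolute
  -- value for `d ≥ 2` and is outweighed by the 2 from the `(t, r)` plane.
  have h3 : 4 * (d : ℝ) * (-1 / d) ^ 3 = - (4 / d ^ 2) := by field_simp
  have h4 : 4 / (d : ℝ) ^ 2 ≤ 1 := by rw [div_le_one (by positivity)]; nlinarith
  have h5 : 0 < (d : ℝ) * (d - 1) * (2 / (d * (d - 1))) ^ 3 := by positivity
  rw [h3]
  have : (0 : ℝ) < 4 * (2 * 1 ^ 3 + -(4 / d ^ 2) + d * (d - 1) * (2 / (d * (d - 1))) ^ 3) := by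
    linarith
  exact this.ne'

/-- The invariant is `R_{ac} R_{be} C^{abce}`. Since Weyl is traceless, only the trace-free Ricci
tensor enters: with Ricci eigenvalues `u`, `v` and unit amplitude the sum is `2 (u - v)²`, whence
the factor `1/2` in the proof. -/
lemma isRealized_weylAmp_mul (hd : 2 ≤ d) : IsRealized d 3 (fun A B ψ => weylAmp d A B ψ *
    (A + d * B - (2 * B + (d - 1) * ψ)) ^ 2) := by
  obtain ⟨φ₁, hφ₁, h₁⟩ := Transfer.relabel
    (fun _ : (Fin 3 × Fin 4 → Fin (d + 2)) → ℝ => diagMat 1) (fun T => T) (slotSucc 2) _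
    (contractLin_mem (D := d + 2) ricciRicciPattern)
  obtain ⟨φ₂, hφ₂, h₂⟩ := Transfer.weyl (γ := fun p : PointData (d + 2) => p.1.2.1)
    (G := fun p => p.1.1) (fun p => p.2) (fun p => tensorPower 2 p.1.2.2) (fun p => p.1.2.2) φ₁ hφ₁
  obtain ⟨φ₃, hφ₃, h₃⟩ := Transfer.relabel
    (fun _ : ((Fin 2 × Fin 4) ⊕ Fin 4 → Fin (d + 2)) → ℝ => diagMat 1) (fun T => T)
    (slotSucc 2).symm φ₂ hφ₂
  have key : IsRealized d 3 (fun A B ψ => (1 / 2) * (weylAmp d A B ψ *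
      ∑ a, ∑ b, weylCurv d a b * ((∑ p, sssCurv d A B ψ p a) * (∑ p, sssCurv d A B ψ p b)))) := by
    refine IsRealized.smul _ ⟨φ₃, hφ₃, fun A B ψ => ?_⟩
    set R := sectional (sssCurv d A B ψ) 1 with hR
    have e₃ := h₃ (tprod (tensorPower 2 R) (tens₄ R))
    have e₂ := h₂ ⟨(diagMat 1, diagMat 1, R), isInversePair_one⟩
    have e₁ := h₁ (fun i => tprod (tensorPower 2 R) (tens₄ (weyl (diagMat 1) (diagMat 1) R))
      (fun s => i ((slotSucc 2).symm s)))
    dsimp only at e₁ e₂ e₃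
    have e₄ : (fun i : Fin 3 × Fin 4 → Fin (d + 2) => tprod (tensorPower 2 R) (tens₄ R)
        fun s => i ((slotSucc 2).symm s)) = tensorPower 3 R := by
      funext i
      rw [← tensorPower_succ]
      simp
    simp only [Equiv.apply_symm_apply] at e₁
    rw [e₄] at e₃
    rw [← e₃, ← e₂, ← e₁, hR, weyl_sssCurv (by omega), ← hR]
    have e₅ : (fun i : Fin 3 × Fin 4 → Fin (d + 2) => tprod (tensorPower 2 R)
        (tens₄ fun a b c e => weylAmp d A B ψ * sectional (weylCurv d) 1 a b c e)
        fun s => i ((slotSucc 2).symm s)) = weylAmp d A B ψ • fun i => tprod (tensorPower 2 R)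
        (tens₄ (sectional (weylCurv d) 1)) fun s => i ((slotSucc 2).symm s) := by
      funext i
      simp [tprod, tens₄]; ring
    rw [e₅, map_smul, smul_eq_mul]
    congr 1
    exact contract_ricciRicciPattern (sssCurv_self A B ψ) (sssCurv_self _ _ _)
  convert key using 4 with A B ψ
  simp only [sum_sssCurv_left, weylCurv]
  rw [sum_sssCurv_twoBlock]
  have h2 : (2 : ℝ) ≤ d := by exact_mod_cast hd
  have hd1 : (d - 1 : ℝ) ≠ 0 := by intro h; linarith
  field_simp
  ring

/-! ## The invariants which give GQTG densities -/

/-- The scalar curvature, normalised to be one on the unit sphere. -/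
def meanCurv (d : ℕ) (A B ψ : ℝ) : ℝ :=
  (2 * (A + d * B) + d * (2 * B + (d - 1) * ψ)) / ((d + 1) * (d + 2))

/-- The combination of `B` and `ψ` which does not involve the traceless Ricci tensor. -/
def mixCurv (d : ℕ) (B ψ : ℝ) : ℝ := ((d - 2) * ψ + 4 * B) / (d + 2)

/-- The difference of the Ricci eigenvalues. -/
def ricciGap (d : ℕ) (A B ψ : ℝ) : ℝ := A + d * B - (2 * B + (d - 1) * ψ)

/-- The Weyl amplitude, normalised such that `mixCurv = meanCurv + weylDev`. -/
def weylDev (d : ℕ) (A B ψ : ℝ) : ℝ := mixCurv d B ψ - meanCurv d A B ψ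

lemma weylDev_eq (hd : 2 ≤ d) (A B ψ : ℝ) :
    weylDev d A B ψ = -2 / ((d + 2) * (d - 1)) * weylAmp d A B ψ := by
  have h2 : (2 : ℝ) ≤ d := by exact_mod_cast hd
  have hd1 : (d - 1 : ℝ) ≠ 0 := by intro h; linarith
  simp only [weylDev, mixCurv, meanCurv, weylAmp]
  field_simp
  ring

lemma isRealized_meanCurv : IsRealized d 1 (meanCurv d) := by
  convert (isRealized_scalar (d := d)).smul (((d : ℝ) + 1) * (d + 2))⁻¹ using 1
  funext A B ψ
  simp only [meanCurv]; ring

/-- The square of the trace-free Ricci tensor, `R_{ab} R^{ab} - R²/(d+2)`, equals `2d/(d+2)` times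
the squared difference of the two eigenvalues. -/
lemma isRealized_ricciGap_sq (hd : 2 ≤ d) :
    IsRealized d 2 (fun A B ψ => ricciGap d A B ψ ^ 2) := by
  convert ((isRealized_ricciSq (d := d)).smul ((d + 2) / (2 * d))).add
    ((isRealized_scalar.mul isRealized_scalar).smul (-1 / (2 * d))) using 4 with A B ψ
  simp only [ricciGap]
  have : (d : ℝ) ≠ 0 := by positivity
  field_simp
  ring

lemma isRealized_weylDev_sq (hd : 2 ≤ d) : IsRealized d 2 (fun A B ψ => weylDev d A B ψ ^ 2) := by
  convert (isRealized_weylAmp_sq hd).smul ((-2 / ((d + 2) * (d - 1))) ^ 2) using 4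
  rw [weylDev_eq hd]; ring

lemma isRealized_weylDev_cube (hd : 2 ≤ d) :
    IsRealized d 3 (fun A B ψ => weylDev d A B ψ ^ 3) := by
  convert (isRealized_weylAmp_cube hd).smul ((-2 / ((d + 2) * (d - 1))) ^ 3) using 4
  rw [weylDev_eq hd]; ring

lemma isRealized_weylDev_mul (hd : 2 ≤ d) :
    IsRealized d 3 (fun A B ψ => weylDev d A B ψ * ricciGap d A B ψ ^ 2) := by
  convert (isRealized_weylAmp_mul hd).smul (-2 / ((d + 2) * (d - 1))) using 4
  rw [weylDev_eq hd, ricciGap]; ring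

/-- Write `U = S + X` for `mixCurv`, `meanCurv`, `weylDev`. Here `S` and `X²` are realized, but `X`
alone is not available, so `q U^n` and `X q U^n` are treated together: multiplying by `U` turns each
into `S` times itself plus the other one, with a factor `X²` in the second case. -/
lemma isRealized_mul_mixCurv_pow (hd : 2 ≤ d) {q : ℝ → ℝ → ℝ → ℝ} (h : IsRealized d 2 q)
    (h' : IsRealized d 3 (fun A B ψ => weylDev d A B ψ * q A B ψ)) (n : ℕ) :
    IsRealized d (n + 2) (fun A B ψ => q A B ψ * mixCurv d B ψ ^ n) ∧
    IsRealized d (n + 3) (fun A B ψ => weylDev d A B ψ * q A B ψ * mixCurv d B ψ ^ n) := by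
  have hU : ∀ A B ψ, mixCurv d B ψ = meanCurv d A B ψ + weylDev d A B ψ := by
    intro A B ψ; simp [weylDev]
  induction n with
  | zero => simpa using ⟨h, h'⟩
  | succ n ih =>
    constructor
    · have := (ih.1.mul isRealized_meanCurv).add ih.2
      convert this using 4 with A B ψ
      rw [pow_succ]
      nth_rw 2 [hU A]
      ring
    · have := (ih.2.mul isRealized_meanCurv).add (ih.1.mul (isRealized_weylDev_sq hd))
      convert this using 4 with A B ψ
      rw [pow_succ]
      nth_rw 2 [hU A]
      ring

/-- With `U = S + X`, subtracting `(n+2) X U^(n+1)` removes the term of `U^(n+2)` linear in `X`,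
which contractions with a single Weyl factor do not supply. These polynomials `P_n` satisfy `P_{n+1}
= S P_n - (n+2) X² U^(n+1)`, with `P_0 = S² - X²`. -/
lemma isRealized_mixCurv (hd : 2 ≤ d) (n : ℕ) : IsRealized d (n + 2) (fun A B ψ =>
    mixCurv d B ψ ^ (n + 2) - (n + 2) * weylDev d A B ψ * mixCurv d B ψ ^ (n + 1)) := by
  have hU : ∀ A B ψ, mixCurv d B ψ = meanCurv d A B ψ + weylDev d A B ψ := by
    intro A B ψ; simp [weylDev]
  have h2 := isRealized_weylDev_sq hd
  have h3 : IsRealized d 3 (fun A B ψ => weylDev d A B ψ * weylDev d A B ψ ^ 2) := by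
    convert isRealized_weylDev_cube hd using 4; ring
  induction n with
  | zero =>
    convert (isRealized_meanCurv.mul isRealized_meanCurv).add (h2.smul (-1)) using 4 with A B ψ
    simp only [Nat.cast_zero]
    rw [hU A]; ring
  | succ n ih =>
    convert (ih.mul isRealized_meanCurv).add
      ((isRealized_mul_mixCurv_pow hd h2 h3 (n + 1)).1.smul (-(n + 2))) using 4 with A B ψ
    push_cast
    have : meanCurv d A B ψ = mixCurv d B ψ - weylDev d A B ψ := by simp [weylDev]
    rw [this]; ring

/-- The values on static spherically symmetric metrics of a GQTG density of order `n + 2`. -/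
def gqtgPoly (d n : ℕ) (A B ψ : ℝ) : ℝ :=
  mixCurv d B ψ ^ n * (mixCurv d B ψ ^ 2 - (n + 2) * weylDev d A B ψ * mixCurv d B ψ
    + (n + 1) * (n + 2) * (d + 1) / d * weylDev d A B ψ ^ 2
    - 4 * (n + 1) * (n + 2) / (d * (d + 1) * (d + 2) ^ 2) * ricciGap d A B ψ ^ 2)

lemma isRealized_gqtgPoly (hd : 2 ≤ d) (n : ℕ) : IsRealized d (n + 2) (gqtgPoly d n) := by
  have h2 := isRealized_weylDev_sq hd
  have h3 : IsRealized d 3 (fun A B ψ => weylDev d A B ψ * weylDev d A B ψ ^ 2) := by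
    convert isRealized_weylDev_cube hd using 4; ring
  convert ((isRealized_mixCurv hd n).add ((isRealized_mul_mixCurv_pow hd h2 h3 n).1.smul
    ((n + 1) * (n + 2) * (d + 1) / d))).add ((isRealized_mul_mixCurv_pow hd
      (isRealized_ricciGap_sq hd) (isRealized_weylDev_mul hd) n).1.smul
      (-(4 * (n + 1) * (n + 2) / (d * (d + 1) * (d + 2) ^ 2)))) using 4
  simp only [gqtgPoly]
  ring

/-- Evaluated at a Ricci-flat choice of sectional curvatures, where Riemann equals Weyl, the value
of the invariant is `weylAmp ^ (n+2)` times the coefficient. There `meanCurv` and `ricciGap` vanish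
and `weylDev = mixCurv`, so `gqtgPoly` becomes a non-zero power times `(n+1) ((n+2)(d+1)/d - 1) >
0`. -/
lemma weylCoeff_ne_zero (hd : 2 ≤ d) {n : ℕ}
    {φ : (Fin (d + 2) → Fin (d + 2) → ℝ) → ((Fin (n + 2) × Fin 4 → Fin (d + 2)) → ℝ) →ₗ[ℝ] ℝ}
    (h : ∀ A B ψ, φ (diagMat 1) (tensorPower (n + 2) (sectional (sssCurv d A B ψ) 1))
      = gqtgPoly d n A B ψ) : weylCoeff φ ≠ 0 := by
  have h2 : (2 : ℝ) ≤ d := by exact_mod_cast hd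
  have hd0 : (d : ℝ) ≠ 0 := by positivity
  set A : ℝ := d * (d - 1) / 2
  set B : ℝ := -(d - 1) / 2
  have e₁ : A + d * B = 0 := by simp only [A, B]; ring
  have e₂ : 2 * B + (d - 1) * 1 = 0 := by simp only [B]; ring
  have e₃ : 2 * B + (d - 1) = 0 := by simp only [B]; ring
  have hw := weylCoeff_spec (by omega) φ A B 1
  have hsch : schouten (diagMat 1) (diagMat 1) (sectional (sssCurv d A B 1) 1) = 0 := by
    funext a b
    simp only [schouten, ricciOf_sectional (sssCurv_self A B 1),
      scalarOf_sectional (sssCurv_self A B 1), sum_sssCurv_left, e₁, e₂]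
    simp [twoBlock, diagMat]
  have hR : weyl (diagMat 1) (diagMat 1) (sectional (sssCurv d A B 1) 1)
      = sectional (sssCurv d A B 1) 1 := by
    funext a b c e
    simp [weyl, hsch, kulkarniNomizu]
  rw [hR, h] at hw
  intro h0
  rw [h0, mul_zero] at hw
  have hmean : meanCurv d A B 1 = 0 := by simp [meanCurv, e₁, e₃]
  have hgap : ricciGap d A B 1 = 0 := by simp [ricciGap, e₁, e₃]
  have hU : mixCurv d B 1 ≠ 0 := by
    have : mixCurv d B 1 = -(d / (d + 2)) := by
      simp only [mixCurv, B]; ring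
    rw [this]
    have : (d : ℝ) / (d + 2) ≠ 0 := by positivity
    exact neg_ne_zero.2 this
  have hX : weylDev d A B 1 = mixCurv d B 1 := by simp [weylDev, hmean]
  rw [gqtgPoly, hgap, hX] at hw
  have : mixCurv d B 1 ^ n * mixCurv d B 1 ^ 2 * ((n + 1) * ((n + 2) * ((d + 1) / d) - 1)) = 0 := by
    rw [← hw]; ring
  have h5 : (1 : ℝ) ≤ (d + 1) / d := by rw [one_le_div (by positivity)]; linarith
  have h6 : (0 : ℝ) ≤ n := Nat.cast_nonneg n
  have h7 : (0 : ℝ) < (n + 2) * ((d + 1) / d) - 1 := by nlinarith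
  have h8 : (n + 1 : ℝ) * ((n + 2) * ((d + 1) / d) - 1) ≠ 0 := by positivity
  simp [hU, h8] at this

/-- The potential of the total derivative `r^d * gqtgPoly`. -/
def gqtgPotential (d n : ℕ) (p : ℝ × ℝ) : ℝ :=
  mixCurv d p.2 p.1 ^ (n + 1) * ((n + 2) * p.1 - n * mixCurv d p.2 p.1) / (2 * (d + 1))

lemma contDiff_gqtgPotential (n : ℕ) : ContDiff ℝ ∞ (gqtgPotential d n) := by
  unfold gqtgPotential mixCurv
  fun_prop

/-- As `r ψ' = 2 (B - ψ)` and `r B' = A - B`, the right side is `r^(-d) d/dr (r^(d+1) G)`. Being a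
total derivative of a function of `r, f, f'`, it is affine in `A = -f''/2`; accordingly the
coefficients of `weylDev²` and `ricciGap²` in `gqtgPoly` are such that the `A²` terms cancel. -/
lemma gqtgPotential_spec (hd : 2 ≤ d) (n : ℕ) (A B ψ : ℝ) :
    gqtgPoly d n A B ψ = (d + 1) * gqtgPotential d n (ψ, B)
      + fderiv ℝ (gqtgPotential d n) (ψ, B) (2 * (B - ψ), A - B) := by
  have hd0 : (d : ℝ) ≠ 0 := by positivity
  -- The Fréchet derivative is found by differentiating the potential along a line in two ways, by
  -- the chain rule and by the product rule.
  have h1 : HasDerivAt (fun s : ℝ => (ψ + s * (2 * (B - ψ)), B + s * (A - B)))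
      (2 * (B - ψ), A - B) 0 := by
    refine HasDerivAt.prodMk ?_ ?_
    · simpa using ((hasDerivAt_id (0 : ℝ)).mul_const (2 * (B - ψ))).const_add ψ
    · simpa using ((hasDerivAt_id (0 : ℝ)).mul_const (A - B)).const_add B
  have h2 : HasFDerivAt (gqtgPotential d n) (fderiv ℝ (gqtgPotential d n) (ψ, B))
      ((fun s : ℝ => (ψ + s * (2 * (B - ψ)), B + s * (A - B))) 0) := by
    simpa using (((contDiff_gqtgPotential (d := d) n).differentiable (by simp)) (ψ, B)).hasFDerivAt
  have h3 := h2.comp_hasDerivAt (0 : ℝ) h1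
  have hψ : HasDerivAt (fun s : ℝ => ψ + s * (2 * (B - ψ))) (2 * (B - ψ)) 0 := by
    simpa using ((hasDerivAt_id (0 : ℝ)).mul_const (2 * (B - ψ))).const_add ψ
  have hB : HasDerivAt (fun s : ℝ => B + s * (A - B)) (A - B) 0 := by
    simpa using ((hasDerivAt_id (0 : ℝ)).mul_const (A - B)).const_add B
  have hU : HasDerivAt (fun s : ℝ => mixCurv d (B + s * (A - B)) (ψ + s * (2 * (B - ψ))))
      (((d - 2) * (2 * (B - ψ)) + 4 * (A - B)) / (d + 2)) 0 :=
    ((hψ.const_mul _).add (hB.const_mul _)).div_const _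
  have h4 := ((hU.pow (n + 1)).mul ((hψ.const_mul ((n : ℝ) + 2)).sub
    (hU.const_mul (n : ℝ)))).div_const (2 * ((d : ℝ) + 1))
  have h5 := h3.unique h4
  rw [h5]
  simp only [zero_mul, add_zero, Nat.add_sub_cancel, gqtgPotential, gqtgPoly,
    Pi.sub_apply, Pi.pow_apply]
  have key : mixCurv d B ψ ^ 2 - (n + 2) * weylDev d A B ψ * mixCurv d B ψ
    + (n + 1) * (n + 2) * (d + 1) / d * weylDev d A B ψ ^ 2
    - 4 * (n + 1) * (n + 2) / (d * (d + 1) * (d + 2) ^ 2) * ricciGap d A B ψ ^ 2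
    = (1 / 2) * mixCurv d B ψ * ((n + 2) * ψ - n * mixCurv d B ψ)
      + ((n + 1) * (((d - 2) * (2 * (B - ψ)) + 4 * (A - B)) / (d + 2))
          * ((n + 2) * ψ - n * mixCurv d B ψ)
        + mixCurv d B ψ * ((n + 2) * (2 * (B - ψ))
          - n * (((d - 2) * (2 * (B - ψ)) + 4 * (A - B)) / (d + 2)))) / (2 * (d + 1)) := by
    simp only [weylDev, meanCurv, mixCurv, ricciGap]
    field_simp
    ring
  rw [key, pow_succ]
  push_cast
  field_simp

end Realized

/-! ## Total derivatives have vanishing Euler–Lagrange expression -/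

section EulerLagrange

/-- The half space on which potentials are defined. -/
lemma isOpen_halfSpace : IsOpen {p : ℝ × ℝ × ℝ | 0 < p.1} :=
  isOpen_lt continuous_const continuous_fst

/-- The total derivative of a potential `H(r, f, f')`. -/
def totalDeriv (H : ℝ × ℝ × ℝ → ℝ) (p : ℝ × (Fin 3 → ℝ)) : ℝ :=
  fderiv ℝ H (p.1, p.2 0, p.2 1) (1, p.2 1, p.2 2)

lemma contDiffOn_totalDeriv {H : ℝ × ℝ × ℝ → ℝ} (hH : ContDiffOn ℝ ∞ H {p | 0 < p.1}) :
    ContDiffOn ℝ ∞ (totalDeriv H) {p | 0 < p.1} := by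
  have h := hH.fderiv_of_isOpen isOpen_halfSpace (m := ∞) (by simp)
  refine ContDiffOn.clm_apply (h.comp (s := {p : ℝ × (Fin 3 → ℝ) | 0 < p.1})
    (f := fun p : ℝ × (Fin 3 → ℝ) => (p.1, p.2 0, p.2 1)) ?_ (fun p hp => hp)) ?_
  · exact ContDiff.contDiffOn (by fun_prop)
  · exact ContDiff.contDiffOn (by fun_prop)

/-- With `a = H_f` and `b = H_{f'}` along the curve, the partial derivatives of the total derivative
with respect to `f`, `f'`, `f''` are `a'`, `b' + a`, `b`. The alternating sum is `a' - (b'' + a') +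
b'' = 0`. Symmetry of the second derivative of `H` enters in identifying `a'` and `b'`. -/
lemma eulerLagrange_totalDeriv {H : ℝ × ℝ × ℝ → ℝ} (hH : ContDiffOn ℝ ∞ H {p | 0 < p.1})
    {f : ℝ → ℝ} (hf : ContDiffOn ℝ ∞ f (Set.Ioi 0)) {r : ℝ} (hr : 0 < r) :
    eulerLagrange (k := 2) (totalDeriv H) f r = 0 := by
  have hH1 := hH.fderiv_of_isOpen isOpen_halfSpace (m := ∞) (by simp)
  have hf1 : ContDiffOn ℝ ∞ (deriv f) (Set.Ioi 0) :=
    hf.deriv_of_isOpen isOpen_Ioi (by simp)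
  set γ : ℝ → ℝ × ℝ × ℝ := fun s => (s, f s, deriv f s) with hγ
  have hγc : ContDiffOn ℝ ∞ γ (Set.Ioi 0) := contDiffOn_id.prodMk (hf.prodMk hf1)
  set a : ℝ → ℝ := fun s => fderiv ℝ H (γ s) (0, 1, 0) with ha
  set b : ℝ → ℝ := fun s => fderiv ℝ H (γ s) (0, 0, 1) with hb
  have hac : ContDiffOn ℝ ∞ a (Set.Ioi 0) :=
    (hH1.comp hγc fun s hs => hs).clm_apply contDiffOn_const
  have hbc : ContDiffOn ℝ ∞ b (Set.Ioi 0) :=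
    (hH1.comp hγc fun s hs => hs).clm_apply contDiffOn_const
  have hb1 : ContDiffOn ℝ ∞ (deriv b) (Set.Ioi 0) :=
    hbc.deriv_of_isOpen isOpen_Ioi (by simp)
  have diffAt : ∀ {u : ℝ → ℝ}, ContDiffOn ℝ ∞ u (Set.Ioi 0) → ∀ s, 0 < s → DifferentiableAt ℝ u s :=
    fun hu s hs => (hu.contDiffAt (Ioi_mem_nhds hs)).differentiableAt (by simp)
  have hD2 : ∀ s, 0 < s → HasFDerivAt (fderiv ℝ H) (fderiv ℝ (fderiv ℝ H) (γ s)) (γ s) :=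
    fun s hs => ((hH1.contDiffAt (isOpen_halfSpace.mem_nhds hs)).differentiableAt
      (by simp)).hasFDerivAt
  have hsym : ∀ s, 0 < s → ∀ u w, fderiv ℝ (fderiv ℝ H) (γ s) u w
      = fderiv ℝ (fderiv ℝ H) (γ s) w u := fun s hs u w =>
    ((hH.contDiffAt (isOpen_halfSpace.mem_nhds (x := γ s) hs)).isSymmSndFDerivAt
      (by simpa using (WithTop.coe_le_coe.2 le_top : ((2 : ℕ∞) : WithTop ℕ∞) ≤ ((⊤ : ℕ∞) : WithTop ℕ∞)))).eq u w
  have hγd : ∀ s, 0 < s → HasDerivAt γ (1, deriv f s, deriv (deriv f) s) s := fun s hs =>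
    (hasDerivAt_id s).prodMk ((diffAt hf s hs).hasDerivAt.prodMk (diffAt hf1 s hs).hasDerivAt)
  have hd : ∀ (w : ℝ × ℝ × ℝ) s, 0 < s → HasDerivAt (fun s => fderiv ℝ H (γ s) w)
      (fderiv ℝ (fderiv ℝ H) (γ s) w (1, deriv f s, deriv (deriv f) s)) s := by
    intro w s hs
    have := ((hD2 s hs).comp_hasDerivAt s (hγd s hs)).clm_apply (hasDerivAt_const s w)
    rw [hsym s hs]
    simpa using this
  have hj0 : ∀ s, radialJet 2 f s 0 = f s := fun s => by simp [radialJet]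
  have hj1 : ∀ s, radialJet 2 f s 1 = deriv f s := fun s => by simp [radialJet, iteratedDeriv_one]
  have hj2 : ∀ s, radialJet 2 f s 2 = deriv (deriv f) s := fun s => by
    simp [radialJet, iteratedDeriv_succ, iteratedDeriv_zero]
  have hΛ : ∀ s, 0 < s → ∀ w : Fin 3 → ℝ,
      fderiv ℝ (fun v => totalDeriv H (s, v)) (radialJet 2 f s) w
      = fderiv ℝ (fderiv ℝ H) (γ s) (0, w 0, w 1) (1, deriv f s, deriv (deriv f) s)
        + fderiv ℝ H (γ s) (0, w 1, w 2) := by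
    intro s hs w
    have p : ∀ i : Fin 3, HasFDerivAt (fun v : Fin 3 → ℝ => v i)
      (ContinuousLinearMap.proj (R := ℝ) (φ := fun _ : Fin 3 => ℝ) i) (radialJet 2 f s) :=
      fun i => hasFDerivAt_apply i _
    have h1 : HasFDerivAt (fun v : Fin 3 → ℝ => (s, v 0, v 1)) _ (radialJet 2 f s) :=
      (hasFDerivAt_const s _).prodMk ((p 0).prodMk (p 1))
    have h2 : HasFDerivAt (fun v : Fin 3 → ℝ => ((1 : ℝ), v 1, v 2)) _ (radialJet 2 f s) :=
      (hasFDerivAt_const 1 _).prodMk ((p 1).prodMk (p 2))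
    have hD2' := hD2 s hs
    have e : γ s = (s, radialJet 2 f s 0, radialJet 2 f s 1) := by rw [hj0, hj1]
    rw [e] at hD2'
    have h3 := (HasFDerivAt.comp (f := fun v : Fin 3 → ℝ => (s, v 0, v 1)) _ hD2' h1).clm_apply h2
    have h4 : HasFDerivAt (fun v => totalDeriv H (s, v)) _ (radialJet 2 f s) := h3
    rw [h4.fderiv]
    simp [hj0, hj1, hj2, hγ, add_comm]
  have c0 : ∀ s, 0 < s → fderiv ℝ (fun v => totalDeriv H (s, v)) (radialJet 2 f s)
      (Pi.single 0 1) = deriv a s := by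
    intro s hs
    rw [hΛ s hs, (hd (0, 1, 0) s hs).deriv]
    simp [show ((0 : ℝ), (0 : ℝ), (0 : ℝ)) = 0 from rfl]
  have c1 : ∀ s, 0 < s → fderiv ℝ (fun v => totalDeriv H (s, v)) (radialJet 2 f s)
      (Pi.single 1 1) = deriv b s + a s := by
    intro s hs
    rw [hΛ s hs, (hd (0, 0, 1) s hs).deriv]
    simp [ha]
  have c2 : ∀ s, 0 < s → fderiv ℝ (fun v => totalDeriv H (s, v)) (radialJet 2 f s)
      (Pi.single 2 1) = b s := by
    intro s hs
    rw [hΛ s hs]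
    simp [hb, show ((0 : ℝ), (0 : ℝ), (0 : ℝ)) = 0 from rfl]
  have hev : ∀ᶠ s in nhds r, 0 < s := lt_mem_nhds hr
  unfold eulerLagrange
  rw [Fin.sum_univ_three]
  have d0 : iteratedDeriv 0 (fun s => fderiv ℝ (fun v => totalDeriv H (s, v)) (radialJet 2 f s)
      (Pi.single 0 1)) r = deriv a r := by rw [iteratedDeriv_zero, c0 r hr]
  have d1 : iteratedDeriv 1 (fun s => fderiv ℝ (fun v => totalDeriv H (s, v)) (radialJet 2 f s)
      (Pi.single 1 1)) r = deriv (deriv b) r + deriv a r := by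
    rw [iteratedDeriv_one]
    have : (fun s => fderiv ℝ (fun v => totalDeriv H (s, v)) (radialJet 2 f s)
      (Pi.single 1 1)) =ᶠ[nhds r] deriv b + a := hev.mono fun s hs => c1 s hs
    rw [this.deriv_eq, deriv_add (diffAt hb1 r hr) (diffAt hac r hr)]
  have d2 : iteratedDeriv 2 (fun s => fderiv ℝ (fun v => totalDeriv H (s, v)) (radialJet 2 f s)
      (Pi.single 2 1)) r = deriv (deriv b) r := by
    have : (fun s => fderiv ℝ (fun v => totalDeriv H (s, v)) (radialJet 2 f s)
      (Pi.single 2 1)) =ᶠ[nhds r] b := hev.mono fun s hs => c2 s hs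
    rw [this.iteratedDeriv_eq]
    simp [iteratedDeriv_succ, iteratedDeriv_zero]
  have e0 : ((0 : Fin 3) : ℕ) = 0 := rfl
  have e1 : ((1 : Fin 3) : ℕ) = 1 := rfl
  have e2 : ((2 : Fin 3) : ℕ) = 2 := rfl
  simp only [e0, e1, e2]
  rw [d0, d1, d2]
  ring

/-- An invariant whose values on static spherically symmetric metrics come from a potential is a
GQTG density. -/
lemma isGQTG_of_potential {d : ℕ} {L : Density (d + 2)} {G : ℝ × ℝ → ℝ} (hG : ContDiff ℝ ∞ G)
    (h : ∀ f : ℝ → ℝ, ContDiffOn ℝ ∞ f (Set.Ioi 0) → ∀ r : ℝ, 0 < r → f r ≠ 0 →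
      L (sssMetric d (fun _ => 1) f) (radialPoint d r)
        = (d + 1) * G ((1 - f r) / r ^ 2, -deriv f r / (2 * r))
          + fderiv ℝ G ((1 - f r) / r ^ 2, -deriv f r / (2 * r))
            (2 * (-deriv f r / (2 * r) - (1 - f r) / r ^ 2),
              -deriv (deriv f) r / 2 - -deriv f r / (2 * r))) : IsGQTG L := by
  set H : ℝ × ℝ × ℝ → ℝ := fun p => p.1 ^ (d + 1) *
    G ((1 - p.2.1) / p.1 ^ 2, -p.2.2 / (2 * p.1)) with hH
  have hHc : ContDiffOn ℝ ∞ H {p | 0 < p.1} := by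
    have h1 : ContDiffOn ℝ ∞ (fun p : ℝ × ℝ × ℝ => ((1 - p.2.1) / p.1 ^ 2, -p.2.2 / (2 * p.1)))
        {p | 0 < p.1} := by
      refine ContDiffOn.prodMk (ContDiffOn.div (by fun_prop) (by fun_prop) ?_)
        (ContDiffOn.div (by fun_prop) (by fun_prop) ?_)
      · intro p hp; have : p.1 ≠ 0 := ne_of_gt hp; positivity
      · intro p hp; have : p.1 ≠ 0 := ne_of_gt hp; positivity
    exact (contDiff_fst.pow _).contDiffOn.mul (hG.comp_contDiffOn h1)
  refine ⟨2, totalDeriv H, (contDiffOn_totalDeriv hHc).mono fun p hp => hp.1, fun f hf r hr hfr =>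
    ⟨?_, eulerLagrange_totalDeriv hHc hf hr⟩⟩
  have hj0 : radialJet 2 f r 0 = f r := by simp [radialJet]
  have hj1 : radialJet 2 f r 1 = deriv f r := by simp [radialJet, iteratedDeriv_one]
  have hj2 : radialJet 2 f r 2 = deriv (deriv f) r := by
    simp [radialJet, iteratedDeriv_succ, iteratedDeriv_zero]
  simp only [reducedLagrangian, totalDeriv, hj0, hj1, hj2, h f hf r hr hfr, one_mul]
  set v₀ := f r
  set v₁ := deriv f r
  set v₂ := deriv (deriv f) r
  have hr0 : r ≠ 0 := hr.ne'
  have l : ∀ u v : ℝ, HasDerivAt (fun s : ℝ => u + s * v) v 0 := fun u v => by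
    simpa using ((hasDerivAt_id (0 : ℝ)).mul_const v).const_add u
  have l1 : HasDerivAt (fun s : ℝ => r + s) 1 0 := by
    simpa using (hasDerivAt_id (0 : ℝ)).const_add r
  have hc : HasDerivAt (fun s : ℝ => (r + s, v₀ + s * v₁, v₁ + s * v₂)) (1, v₁, v₂) 0 :=
    l1.prodMk ((l _ _).prodMk (l _ _))
  have hHd : HasFDerivAt H (fderiv ℝ H (r, v₀, v₁))
      ((fun s : ℝ => (r + s, v₀ + s * v₁, v₁ + s * v₂)) 0) := by
    simp only [add_zero, zero_mul]
    exact ((hHc.contDiffAt (isOpen_halfSpace.mem_nhds (x := (r, v₀, v₁)) hr)).differentiableAt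
      (by simp)).hasFDerivAt
  have h1 := hHd.comp_hasDerivAt (0 : ℝ) hc
  have hψ : HasDerivAt (fun s : ℝ => (1 - (v₀ + s * v₁)) / (r + s) ^ 2)
      ((-v₁ * r ^ 2 - (1 - v₀) * (2 * r)) / (r ^ 2) ^ 2) 0 := by
    refine (((l v₀ v₁).const_sub 1).div (l1.pow 2) (by simpa using hr0)).congr_deriv ?_
    simp
  have hB : HasDerivAt (fun s : ℝ => -(v₁ + s * v₂) / (2 * (r + s)))
      ((-v₂ * (2 * r) - -v₁ * 2) / (2 * r) ^ 2) 0 := by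
    refine ((l v₁ v₂).neg.div (l1.const_mul 2) (by simpa using hr0)).congr_deriv ?_
    simp
  have hGd : HasFDerivAt G (fderiv ℝ G ((1 - v₀) / r ^ 2, -v₁ / (2 * r)))
      ((fun s : ℝ => ((1 - (v₀ + s * v₁)) / (r + s) ^ 2, -(v₁ + s * v₂) / (2 * (r + s)))) 0) := by
    simp only [add_zero, zero_mul]
    exact (hG.differentiable (by simp) _).hasFDerivAt
  have h2 := (l1.pow (d + 1)).mul (hGd.comp_hasDerivAt (0 : ℝ) (hψ.prodMk hB))
  rw [h1.unique h2]
  -- These are the relations `r ψ' = 2 (B - ψ)` and `r B' = A - B`, at the level of jets.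
  have e : ((-v₁ * r ^ 2 - (1 - v₀) * (2 * r)) / (r ^ 2) ^ 2,
      (-v₂ * (2 * r) - -v₁ * 2) / (2 * r) ^ 2)
      = r⁻¹ • (2 * (-v₁ / (2 * r) - (1 - v₀) / r ^ 2), -v₂ / 2 - -v₁ / (2 * r)) := by
    simp only [Prod.smul_mk, smul_eq_mul, Prod.mk.injEq]
    constructor
    · field_simp
    · field_simp
  rw [e, map_smul]
  simp only [smul_eq_mul, Nat.add_sub_cancel, Function.comp, Pi.pow_apply, add_zero, zero_mul,
    mul_one]
  push_cast
  generalize fderiv ℝ G _ _ = y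
  field_simp
  ring

end EulerLagrange

/-! ## Curvature of diagonal metrics -/

section Diagonal

variable {D d : ℕ}

lemma pd_eq {a : Fin D} {F : (Fin D → ℝ) → ℝ} {x : Fin D → ℝ} {F' : (Fin D → ℝ) →L[ℝ] ℝ}
    (h : HasFDerivAt F F' x) : pd a F x = F' (Pi.single a 1) := by rw [pd, h.fderiv]

lemma pd_congr {a : Fin D} {F F' : (Fin D → ℝ) → ℝ} {x : Fin D → ℝ} (h : F =ᶠ[nhds x] F') :
    pd a F x = pd a F' x := by rw [pd, pd, h.fderiv_eq]

lemma pd_const (a : Fin D) (c : ℝ) (x : Fin D → ℝ) : pd a (fun _ => c) x = 0 := by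
  simp [pd]

lemma pd_add {a : Fin D} {F F' : (Fin D → ℝ) → ℝ} {x : Fin D → ℝ} (h : DifferentiableAt ℝ F x)
    (h' : DifferentiableAt ℝ F' x) : pd a (fun y => F y + F' y) x = pd a F x + pd a F' x := by
  rw [pd_eq (h.hasFDerivAt.fun_add h'.hasFDerivAt)]; rfl

lemma pd_sub {a : Fin D} {F F' : (Fin D → ℝ) → ℝ} {x : Fin D → ℝ} (h : DifferentiableAt ℝ F x)
    (h' : DifferentiableAt ℝ F' x) : pd a (fun y => F y - F' y) x = pd a F x - pd a F' x := by
  rw [pd_eq (h.hasFDerivAt.fun_sub h'.hasFDerivAt)]; rfl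

lemma pd_mul {a : Fin D} {F F' : (Fin D → ℝ) → ℝ} {x : Fin D → ℝ} (h : DifferentiableAt ℝ F x)
    (h' : DifferentiableAt ℝ F' x) :
    pd a (fun y => F y * F' y) x = pd a F x * F' x + F x * pd a F' x := by
  rw [pd_eq (h.hasFDerivAt.fun_mul h'.hasFDerivAt)]
  simp [pd]; ring

lemma pd_const_mul {a : Fin D} {F : (Fin D → ℝ) → ℝ} {x : Fin D → ℝ}
    (h : DifferentiableAt ℝ F x) (c : ℝ) : pd a (fun y => c * F y) x = c * pd a F x := by
  rw [pd_mul (differentiableAt_const c) h, pd_const]; ring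

lemma pd_sum {κ : Type*} (s : Finset κ) {a : Fin D} {F : κ → (Fin D → ℝ) → ℝ} {x : Fin D → ℝ}
    (h : ∀ i ∈ s, DifferentiableAt ℝ (F i) x) :
    pd a (fun y => ∑ i ∈ s, F i y) x = ∑ i ∈ s, pd a (F i) x := by
  rw [pd_eq (HasFDerivAt.fun_sum fun i hi => (h i hi).hasFDerivAt)]
  simp [pd]

lemma pd_inv {a : Fin D} {F : (Fin D → ℝ) → ℝ} {x : Fin D → ℝ} (h : DifferentiableAt ℝ F x)
    (h0 : F x ≠ 0) : pd a (fun y => (F y)⁻¹) x = -(pd a F x) / F x ^ 2 := by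
  have := (hasDerivAt_inv h0).comp_hasFDerivAt x h.hasFDerivAt
  rw [pd_eq (F := fun y => (F y)⁻¹) this]
  simp [pd]; ring

lemma differentiableAt_pd {F : (Fin D → ℝ) → ℝ} {x : Fin D → ℝ} (h : ContDiffAt ℝ 2 F x)
    (a : Fin D) : DifferentiableAt ℝ (pd a F) x := by
  have : ContDiffAt ℝ 1 (fderiv ℝ F) x := h.fderiv_right (by norm_num)
  exact (this.differentiableAt (by simp)).clm_apply (differentiableAt_const _)

lemma inverse_diagMat {h : Fin D → ℝ} (h0 : ∀ a, h a ≠ 0) (a b : Fin D) :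
    (Matrix.of (diagMat h))⁻¹ a b = diagMat h⁻¹ a b := by
  have e : Matrix.of (diagMat h) = Matrix.diagonal h := by
    ext a b; simp [diagMat, Matrix.diagonal_apply]
  have : (Matrix.diagonal h)⁻¹ = Matrix.diagonal h⁻¹ := by
    refine Matrix.inv_eq_right_inv ?_
    rw [Matrix.diagonal_mul_diagonal]
    simp [h0]
  rw [e, this, Matrix.diagonal_apply]; rfl

/-- The Christoffel symbols of `diag(h)`, where `D b a` stands for `∂_b h_a`. -/
def diagChristoffel (h : Fin D → ℝ) (D' : Fin D → Fin D → ℝ) (a b c : Fin D) : ℝ :=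
  (1 / 2) * (h a)⁻¹ * ((if a = c then D' b a else 0) + (if a = b then D' c a else 0)
    - (if b = c then D' a b else 0))

lemma pd_diagMat (H : Fin D → (Fin D → ℝ) → ℝ) (b e c : Fin D) (y : Fin D → ℝ) :
    pd b (fun y => diagMat (fun a => H a y) e c) y = if e = c then pd b (H e) y else 0 := by
  by_cases h : e = c
  · simp [diagMat, h]
  · simp [diagMat, h, pd_const]

lemma christoffel_diag {H : Fin D → (Fin D → ℝ) → ℝ} {y : Fin D → ℝ} (h0 : ∀ a, H a y ≠ 0)
    (a b c : Fin D) : christoffel (fun y => diagMat (fun a => H a y)) y a b c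
      = diagChristoffel (fun a => H a y) (fun b a => pd b (H a) y) a b c := by
  unfold christoffel inverseMetric
  simp only [inverse_diagMat h0, pd_diagMat]
  rw [Finset.sum_eq_single a]
  · simp only [diagMat, diagChristoffel, if_true, Pi.inv_apply]
    ring
  · intro e _ he; simp [diagMat, he.symm]
  · simp

lemma pd_christoffel_diag {H : Fin D → (Fin D → ℝ) → ℝ} {x : Fin D → ℝ} (h0 : ∀ a, H a x ≠ 0)
    (hH : ∀ a, ContDiffAt ℝ 2 (H a) x) (c a b e : Fin D) :
    pd c (fun y => christoffel (fun y => diagMat (fun a => H a y)) y a b e) x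
      = (1 / 2) * (-(pd c (H a) x) / H a x ^ 2) * ((if a = e then pd b (H a) x else 0)
          + (if a = b then pd e (H a) x else 0) - (if b = e then pd a (H b) x else 0))
        + (1 / 2) * (H a x)⁻¹ * ((if a = e then pd c (pd b (H a)) x else 0)
          + (if a = b then pd c (pd e (H a)) x else 0)
          - (if b = e then pd c (pd a (H b)) x else 0)) := by
  have hd : ∀ a, DifferentiableAt ℝ (H a) x := fun a => (hH a).differentiableAt (by simp)
  have hev : (fun y => christoffel (fun y => diagMat (fun a => H a y)) y a b e) =ᶠ[nhds x]
      fun y => diagChristoffel (fun a => H a y) (fun b a => pd b (H a) y) a b e := by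
    have : ∀ᶠ y in nhds x, ∀ a, H a y ≠ 0 :=
      Filter.eventually_all.2 fun a => (hd a).continuousAt.eventually_ne (h0 a)
    exact this.mono fun y hy => christoffel_diag hy a b e
  rw [pd_congr hev]
  unfold diagChristoffel
  have hite : ∀ (p : Prop) [Decidable p] (u v : Fin D), DifferentiableAt ℝ
      (fun y => if p then pd u (H v) y else 0) x := by
    intro p _ u v
    by_cases hp : p
    · simpa [hp] using differentiableAt_pd (hH v) u
    · simp [hp]
  have hpd : ∀ (p : Prop) [Decidable p] (u v : Fin D),
      pd c (fun y => if p then pd u (H v) y else 0) x = if p then pd c (pd u (H v)) x else 0 := by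
    intro p _ u v
    by_cases hp : p
    · simp only [hp, if_true]
    · simp [hp, pd_const]
  have hinv : DifferentiableAt ℝ (fun y => (1 / 2) * (H a y)⁻¹) x :=
    ((hd a).inv (h0 a)).const_mul _
  rw [pd_mul hinv (((hite _ _ _).fun_add (hite _ _ _)).fun_sub (hite _ _ _)),
    pd_const_mul ((hd a).fun_inv (h0 a)), pd_inv (hd a) (h0 a),
    pd_sub ((hite _ _ _).fun_add (hite _ _ _)) (hite _ _ _), pd_add (hite _ _ _) (hite _ _ _),
    hpd, hpd, hpd]

/-- The curvature `R_{abab}` of a diagonal metric whose components depend to first order on a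
single coordinate `z`, with diagonal second derivatives `q`. -/
def diagCurvature (z : Fin D) (h h' : Fin D → ℝ) (q : Fin D → Fin D → ℝ) (a b : Fin D) : ℝ :=
  -(1 / 2) * (q a b + q b a) + if a = z then (1 / 4) * (h' b ^ 2 / h b + h' z * h' b / h z)
    else if b = z then (1 / 4) * (h' a ^ 2 / h a + h' z * h' a / h z)
    else -(1 / 4) * (h' a * h' b / h z)

/-- The hypotheses on derivatives hold only at the point `x`. They describe the origin of the
stereographic coordinates, where first derivatives survive in the radial direction alone and mixed
second derivatives vanish. -/
lemma riemann_diag {H : Fin D → (Fin D → ℝ) → ℝ} {x : Fin D → ℝ} (z : Fin D) {h' : Fin D → ℝ}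
    {q : Fin D → Fin D → ℝ} (h0 : ∀ a, H a x ≠ 0) (hH : ∀ a, ContDiffAt ℝ 2 (H a) x)
    (h1 : ∀ b a, pd b (H a) x = if b = z then h' a else 0)
    (h2 : ∀ c b a, pd c (pd b (H a)) x = if c = b then q b a else 0) (a b c e : Fin D) :
    riemann (fun y => diagMat (fun a => H a y)) x a b c e
      = diagCurvature z (fun a => H a x) h' q a b * ((if a = c then 1 else 0) *
        (if b = e then 1 else 0) - (if a = e then 1 else 0) * (if b = c then 1 else 0)) := by
  have e₁ : riemann (fun y => diagMat (fun a => H a y)) x a b c e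
      = H a x * riemannUp (fun y => diagMat (fun a => H a y)) x a b c e := by
    unfold riemann
    rw [Finset.sum_eq_single a]
    · simp [diagMat]
    · intro k _ hk; simp [diagMat, hk.symm]
    · simp
  rw [e₁, riemannUp, pd_christoffel_diag h0 hH, pd_christoffel_diag h0 hH]
  simp only [christoffel_diag h0, h1, h2]
  generalize hh : (fun a => H a x) = h at *
  have h0' : ∀ a, h a ≠ 0 := by rw [← hh]; exact h0
  have hh' : ∀ a, H a x = h a := fun a => by rw [← hh]
  simp only [hh']
  set Γ := diagChristoffel h (fun b a => if b = z then h' a else 0) with hΓ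
  -- The deltas in the Christoffel symbols reduce the sum over `k` to at most three terms. What is
  -- left is a comparison for each pattern of coincidences among `a, b, c, e, z`.
  have e₂ : ∀ a b c e : Fin D, ∑ k, Γ a c k * Γ k e b
      = (1 / 2) * (h a)⁻¹ * ((if c = z then h' a * Γ a e b else 0)
        + (if a = c then h' a * Γ z e b else 0) - (if a = z then h' c * Γ c e b else 0)) := by
    intro a b c e
    have : ∀ k, Γ a c k * Γ k e b = (1 / 2) * (h a)⁻¹ *
        ((if a = k then (if c = z then h' a * Γ k e b else 0) else 0)
        + (if k = z then (if a = c then h' a * Γ k e b else 0) else 0)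
        - (if c = k then (if a = z then h' c * Γ k e b else 0) else 0)) := by
      intro k
      rw [hΓ]
      conv_lhs => enter [1]; simp only [diagChristoffel]
      split_ifs <;> ring
    simp only [this, ← Finset.mul_sum, Finset.sum_add_distrib, Finset.sum_sub_distrib,
      Finset.sum_ite_eq, Finset.sum_ite_eq', Finset.mem_univ, if_true]
  rw [Finset.sum_sub_distrib, e₂, e₂, hΓ]
  clear e₂ hΓ Γ h1 h2 hH e₁ hh' hh h0
  have ha := h0' a
  have hb := h0' b
  have hc := h0' c
  have he := h0' e
  have hz := h0' z
  simp only [diagChristoffel, diagCurvature]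
  rcases eq_or_ne c e with rfl | hce
  · simp
  rcases eq_or_ne a b with rfl | hab
  · by_cases hac : a = c
    · subst hac
      by_cases haz : a = z
      · subst haz
        simp [hce, hce.symm]
      · by_cases hez : e = z
        · subst hez; simp [hce, hce.symm]
        · simp [hce, hce.symm, haz, hez]
    · by_cases hae : a = e
      · subst hae
        by_cases haz : a = z
        · subst haz
          simp [hce, hce.symm]
        · by_cases hez : c = z
          · subst hez; simp [hce, hce.symm]
          · simp [hce, hce.symm, haz, hez]
      · have hca : ¬ c = a := Ne.symm hac
        have hea : ¬ e = a := Ne.symm hae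
        by_cases haz : a = z
        · subst haz
          simp [hac, hae, hca, hea, hce, hce.symm]
        · by_cases hcz : c = z
          · subst hcz
            simp [hac, hae, hca, hea, hce, hce.symm]
          · simp [hac, hae, hca, hea, hce, hce.symm, hcz, haz]
  have hba : ¬ b = a := hab.symm
  have hec : ¬ e = c := hce.symm
  by_cases hac : a = c
  · subst hac
    by_cases hbe : b = e
    · subst hbe
      by_cases haz : a = z
      · subst haz
        simp [hab, hba]
        field_simp
        ring
      · by_cases hbz : b = z
        · subst hbz
          simp [hab, hba]
          field_simp
          ring
        · simp [hab, hba, haz, hbz, Ne.symm hbz]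
          field_simp
          ring
    · have heb : ¬ e = b := Ne.symm hbe
      by_cases haz : a = z
      · subst haz
        simp [hab, hba, hbe, heb, hce, hec]
      · have hza : ¬ z = a := Ne.symm haz
        by_cases hbz : b = z
        · subst hbz
          simp [hab, hba, hbe, heb, hce]
        · simp [hab, hba, hbe, heb, hce, haz, hbz, Ne.symm hbz]
  · have hca : ¬ c = a := Ne.symm hac
    by_cases hae : a = e
    · subst hae
      by_cases hbc : b = c
      · subst hbc
        by_cases haz : a = z
        · subst haz
          simp [hab, hba]
          field_simp
          ring
        · by_cases hbz : b = z
          · subst hbz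
            simp [hab, hba]
            field_simp
            ring
          · simp [hab, hba, haz, hbz, Ne.symm hbz]
            field_simp
            ring
      · have hcb : ¬ c = b := Ne.symm hbc
        by_cases haz : a = z
        · subst haz
          simp [hab, hba, hbc, hcb, hce, hec]
        · have hza : ¬ z = a := Ne.symm haz
          by_cases hbz : b = z
          · subst hbz
            simp [hab, hba, hbc, hcb, hec]
          · simp [hab, hba, hbc, hcb, hec, haz, hbz, Ne.symm hbz]
    · have hea : ¬ e = a := Ne.symm hae
      by_cases haz : a = z
      · subst haz
        by_cases hbc : b = c
        · subst hbc; simp [hab, hba, hae, hce, hec, hea]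
        · by_cases hbe : b = e
          · subst hbe; simp [hab, hba, hac, hca, hce, hec]
          · simp [hab, hac, hca, hae, hea, hce, hec, hbc, hbe, Ne.symm hbc, Ne.symm hbe]
      · by_cases hcz : c = z
        · subst hcz; simp [hab, hac, hca, hae, hea, hec]
        · by_cases hez : e = z
          · subst hez; simp [hab, hac, hca, hae, hea, hce]
          · simp [hab, hac, hca, hae, hea, haz, hcz, hez]

end Diagonal

/-! ## Curvature of static spherically symmetric metrics -/

section SSS

variable {d : ℕ}

lemma eq_zero_or_one_or_succ (b : Fin (d + 2)) : b = 0 ∨ b = 1 ∨ ∃ i : Fin d, b = i.succ.succ :=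
  fin_add_two_cases (p := fun b => b = 0 ∨ b = 1 ∨ ∃ i : Fin d, b = i.succ.succ)
    (by simp) (by simp) (fun i => by simp) b

/-- The squared norm of the stereographic coordinates. -/
def angularSq (y : Fin (d + 2) → ℝ) : ℝ :=
  ∑ k ∈ Finset.univ.filter (fun k : Fin (d + 2) => 2 ≤ (k : ℕ)), y k ^ 2

lemma radialPoint_one (r : ℝ) : radialPoint d r 1 = r := by simp [radialPoint]

lemma radialPoint_of_two_le (r : ℝ) {b : Fin (d + 2)} (hb : 2 ≤ (b : ℕ)) :
    radialPoint d r b = 0 := by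
  have : b ≠ 1 := by rintro rfl; simp at hb
  simp [radialPoint, this]

lemma angularSq_radialPoint (r : ℝ) : angularSq (radialPoint d r) = 0 :=
  Finset.sum_eq_zero fun k hk => by
    rw [radialPoint_of_two_le r (Finset.mem_filter.1 hk).2]; simp

lemma pd_coord (b k : Fin (d + 2)) (y : Fin (d + 2) → ℝ) :
    pd b (fun y => y k) y = if k = b then 1 else 0 := by
  rw [pd_eq (hasFDerivAt_apply k y)]
  simp [Pi.single_apply]

lemma pd_angularSq (b : Fin (d + 2)) (y : Fin (d + 2) → ℝ) :
    pd b angularSq y = if 2 ≤ (b : ℕ) then 2 * y b else 0 := by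
  have : ∀ k : Fin (d + 2), pd b (fun y => y k ^ 2) y = if k = b then 2 * y b else 0 := by
    intro k
    simp only [pow_two]
    rw [pd_mul (by fun_prop) (by fun_prop), pd_coord]
    split_ifs with h
    · subst h; ring
    · simp
  unfold angularSq
  rw [pd_sum _ (fun k _ => by fun_prop)]
  simp only [this, Finset.sum_ite_eq', Finset.mem_filter, Finset.mem_univ, true_and]

lemma pd_comp {u : ℝ → ℝ} {u' : ℝ} {F : (Fin (d + 2) → ℝ) → ℝ} {y : Fin (d + 2) → ℝ}
    (b : Fin (d + 2)) (hu : HasDerivAt u u' (F y)) (hF : DifferentiableAt ℝ F y) :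
    pd b (fun y => u (F y)) y = u' * pd b F y := by
  have := hu.comp_hasFDerivAt y hF.hasFDerivAt
  rw [pd_eq (F := fun y => u (F y)) this]
  simp [pd]

lemma differentiable_angularSq : Differentiable ℝ (angularSq (d := d)) := by
  unfold angularSq; fun_prop

lemma pd_separable {u u₁ w w₁ : ℝ → ℝ} {y : Fin (d + 2) → ℝ} (b : Fin (d + 2))
    (hu : HasDerivAt u (u₁ (y 1)) (y 1)) (hw : HasDerivAt w (w₁ (angularSq y)) (angularSq y)) :
    pd b (fun y => u (y 1) * w (angularSq y)) y
      = (if b = 1 then u₁ (y 1) * w (angularSq y) else 0)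
        + (if 2 ≤ (b : ℕ) then 2 * (y b * (u (y 1) * w₁ (angularSq y))) else 0) := by
  have h1 : DifferentiableAt ℝ (fun y : Fin (d + 2) → ℝ => u (y 1)) y :=
    DifferentiableAt.comp y (f := fun y : Fin (d + 2) → ℝ => y 1) hu.differentiableAt (by fun_prop)
  have h2 : DifferentiableAt ℝ (fun y : Fin (d + 2) → ℝ => w (angularSq y)) y :=
    DifferentiableAt.comp y hw.differentiableAt (differentiable_angularSq y)
  rw [pd_mul h1 h2, pd_comp b hu (by fun_prop), pd_comp b hw (differentiable_angularSq y),
    pd_coord, pd_angularSq]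
  rcases eq_or_ne b 1 with rfl | hb
  · simp
  · simp only [hb, hb.symm, if_false]
    split_ifs <;> ring

/-- At the angular origin `|y|²` has zero gradient and Hessian twice the identity on the angular
coordinates, so mixed derivatives vanish and each angular direction contributes `2 u w₁`. -/
lemma pd_pd_separable {u u₁ w w₁ : ℝ → ℝ} {u₂ w₂ r : ℝ} (c b : Fin (d + 2))
    (hu : ∀ᶠ ρ in nhds r, HasDerivAt u (u₁ ρ) ρ) (hu₁ : HasDerivAt u₁ u₂ r)
    (hw : ∀ᶠ s in nhds 0, HasDerivAt w (w₁ s) s) (hw₁ : HasDerivAt w₁ w₂ 0) :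
    pd c (pd b (fun y => u (y 1) * w (angularSq y))) (radialPoint d r)
      = if c = b then (if b = 1 then u₂ * w 0 else if b = 0 then 0 else 2 * (u r * w₁ 0))
        else 0 := by
  set x := radialPoint d r with hx
  have hx1 : x 1 = r := radialPoint_one r
  have hxs : angularSq x = 0 := angularSq_radialPoint r
  have t1 : Filter.Tendsto (fun y : Fin (d + 2) → ℝ => y 1) (nhds x) (nhds r) := by
    rw [← hx1]; exact (continuous_apply 1).continuousAt
  have t2 : Filter.Tendsto (angularSq (d := d)) (nhds x) (nhds 0) := by
    rw [← hxs]; exact differentiable_angularSq.continuous.continuousAt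
  have hev : pd b (fun y => u (y 1) * w (angularSq y)) =ᶠ[nhds x] fun y =>
      (if b = 1 then u₁ (y 1) * w (angularSq y) else 0)
        + (if 2 ≤ (b : ℕ) then 2 * (y b * (u (y 1) * w₁ (angularSq y))) else 0) := by
    filter_upwards [t1.eventually hu, t2.eventually hw] with y hy hy'
    exact pd_separable b hy hy'
  rw [pd_congr hev]
  have hur : HasDerivAt u (u₁ (x 1)) (x 1) := by rw [hx1]; exact hu.self_of_nhds
  have hu₁r : HasDerivAt u₁ u₂ (x 1) := by rw [hx1]; exact hu₁
  have hw0 : HasDerivAt w (w₁ (angularSq x)) (angularSq x) := by rw [hxs]; exact hw.self_of_nhds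
  have hw₁0 : HasDerivAt w₁ w₂ (angularSq x) := by rw [hxs]; exact hw₁
  rcases eq_zero_or_one_or_succ b with rfl | rfl | ⟨i, rfl⟩
  · simp [pd_const]
  · have := pd_separable (u₁ := fun _ => u₂) c hu₁r hw0
    simp only [Fin.val_one, if_true]
    simp only [Nat.not_ofNat_le_one, if_false, add_zero]
    rw [this, hx1, hxs]
    rcases eq_or_ne c 1 with rfl | hc
    · simp
    · simp only [hc, if_false]
      split_ifs with h2
      · rw [hx, radialPoint_of_two_le r h2]; simp
      · simp
  · have hi : 2 ≤ ((i.succ.succ : Fin (d + 2)) : ℕ) := by simp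
    have h1 : (i.succ.succ : Fin (d + 2)) ≠ 1 := by simp [Fin.ext_iff]
    have h0 : (i.succ.succ : Fin (d + 2)) ≠ 0 := by simp [Fin.ext_iff]
    simp only [hi, h1, h0, if_true, if_false, zero_add]
    have d1 : DifferentiableAt ℝ (fun y : Fin (d + 2) → ℝ => u (y 1)) x :=
      DifferentiableAt.comp x (f := fun y : Fin (d + 2) → ℝ => y 1) hur.differentiableAt
        (by fun_prop)
    have d2 : DifferentiableAt ℝ (fun y : Fin (d + 2) → ℝ => w₁ (angularSq y)) x :=
      DifferentiableAt.comp x hw₁0.differentiableAt (differentiable_angularSq x)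
    rw [pd_const_mul (DifferentiableAt.fun_mul (by fun_prop) (d1.fun_mul d2)),
      pd_mul (by fun_prop) (d1.fun_mul d2), pd_coord, hx1, hxs, hx, radialPoint_of_two_le r hi]
    rcases eq_or_ne c i.succ.succ with rfl | hc
    · simp
    · simp [hc, hc.symm]

/-- The radial profile of the `a`-th diagonal component of an SSS metric. -/
def radialProfile (f : ℝ → ℝ) (a : Fin (d + 2)) (ρ : ℝ) : ℝ :=
  if a = 0 then -f ρ else if a = 1 then (f ρ)⁻¹ else ρ ^ 2

/-- The angular profile of the `a`-th diagonal component of an SSS metric. -/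
def angularProfile (a : Fin (d + 2)) (s : ℝ) : ℝ :=
  if a = 0 then 1 else if a = 1 then 1 else (2 / (1 + s)) ^ 2

lemma sssMetric_eq (f : ℝ → ℝ) : sssMetric d (fun _ => 1) f = fun y =>
    diagMat fun a => radialProfile f a (y 1) * angularProfile a (angularSq y) := by
  funext y a b
  simp only [sssMetric, diagMat, radialProfile, angularProfile, angularSq]
  split_ifs <;> simp

/-- The first derivative of the radial profile. -/
def radialProfile₁ (f : ℝ → ℝ) (a : Fin (d + 2)) (ρ : ℝ) : ℝ :=
  if a = 0 then -deriv f ρ else if a = 1 then -deriv f ρ / f ρ ^ 2 else 2 * ρ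

/-- The second derivative of the radial profile. -/
def radialProfile₂ (f : ℝ → ℝ) (a : Fin (d + 2)) (ρ : ℝ) : ℝ :=
  if a = 0 then -deriv (deriv f) ρ else if a = 1 then
    -deriv (deriv f) ρ / f ρ ^ 2 + 2 * deriv f ρ ^ 2 / f ρ ^ 3 else 2

/-- The first derivative of the angular profile. -/
def angularProfile₁ (a : Fin (d + 2)) (s : ℝ) : ℝ :=
  if a = 0 then 0 else if a = 1 then 0 else -8 / (1 + s) ^ 3

lemma hasDerivAt_radialProfile {f : ℝ → ℝ} {ρ : ℝ} (hf : DifferentiableAt ℝ f ρ) (h0 : f ρ ≠ 0)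
    (a : Fin (d + 2)) : HasDerivAt (radialProfile f a) (radialProfile₁ f a ρ) ρ := by
  unfold radialProfile radialProfile₁
  split_ifs
  · exact hf.hasDerivAt.neg
  · exact hf.hasDerivAt.fun_inv h0
  · simpa using hasDerivAt_pow 2 ρ

lemma hasDerivAt_radialProfile₁ {f : ℝ → ℝ} {ρ : ℝ} (hf : DifferentiableAt ℝ f ρ)
    (hf' : DifferentiableAt ℝ (deriv f) ρ) (h0 : f ρ ≠ 0) (a : Fin (d + 2)) :
    HasDerivAt (radialProfile₁ f a) (radialProfile₂ f a ρ) ρ := by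
  unfold radialProfile₁ radialProfile₂
  split_ifs
  · exact hf'.hasDerivAt.neg
  · refine (hf'.hasDerivAt.fun_neg.fun_div (hf.hasDerivAt.fun_pow 2)
      (pow_ne_zero 2 h0)).congr_deriv ?_
    field_simp
    push_cast
    ring
  · simpa using (hasDerivAt_id ρ).const_mul 2

lemma hasDerivAt_angularProfile {s : ℝ} (h0 : 1 + s ≠ 0) (a : Fin (d + 2)) :
    HasDerivAt (angularProfile a) (angularProfile₁ a s) s := by
  unfold angularProfile angularProfile₁
  split_ifs
  · exact hasDerivAt_const _ _
  · exact hasDerivAt_const _ _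
  · have h1 : HasDerivAt (fun s : ℝ => 1 + s) 1 s := (hasDerivAt_id s).const_add 1
    refine (((hasDerivAt_const s (2 : ℝ)).fun_div h1 h0).fun_pow 2).congr_deriv ?_
    generalize 1 + s = t at h0 ⊢
    norm_num
    field_simp
    norm_num

lemma differentiableAt_angularProfile₁ {s : ℝ} (h0 : 1 + s ≠ 0) (a : Fin (d + 2)) :
    DifferentiableAt ℝ (angularProfile₁ a) s := by
  unfold angularProfile₁
  split_ifs
  · fun_prop
  · fun_prop
  · exact DifferentiableAt.fun_div (by fun_prop) (by fun_prop) (pow_ne_zero 3 h0)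

/-- The diagonal of an SSS metric at a radial point. -/
def sssFrame (d : ℕ) (f : ℝ → ℝ) (r : ℝ) (a : Fin (d + 2)) : ℝ :=
  radialProfile f a r * angularProfile a 0

lemma sssFrame_ne_zero {f : ℝ → ℝ} {r : ℝ} (hr : 0 < r) (h0 : f r ≠ 0) (a : Fin (d + 2)) :
    sssFrame d f r a ≠ 0 := by
  unfold sssFrame radialProfile angularProfile
  split_ifs <;> simp [h0, hr.ne']

lemma inverseMetric_sss {f : ℝ → ℝ} {r : ℝ} (hr : 0 < r) (h0 : f r ≠ 0) :
    inverseMetric (sssMetric d (fun _ => 1) f) (radialPoint d r)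
      = diagMat (sssFrame d f r)⁻¹ := by
  have : sssMetric d (fun _ => 1) f (radialPoint d r) = diagMat (sssFrame d f r) := by
    rw [sssMetric_eq]
    funext a b
    simp only [radialPoint_one, angularSq_radialPoint]
    rfl
  funext a b
  rw [inverseMetric, this, inverse_diagMat (sssFrame_ne_zero hr h0)]

/-- The formula for diagonal metrics is applied with the radial coordinate as distinguished
direction. The second derivative of the stereographic factor produces the `1` in `(1 - f)/r²`, the
radial derivatives of `r²` produce the `-f`. -/
lemma riemann_sss {f : ℝ → ℝ} (hf : ContDiffOn ℝ ∞ f (Set.Ioi 0)) {r : ℝ} (hr : 0 < r)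
    (h0 : f r ≠ 0) :
    riemann (sssMetric d (fun _ => 1) f) (radialPoint d r)
      = sectional (sssCurv d (-deriv (deriv f) r / 2) (-deriv f r / (2 * r)) ((1 - f r) / r ^ 2))
        (sssFrame d f r) := by
  have hfr : ContDiffAt ℝ ∞ f r := hf.contDiffAt (Ioi_mem_nhds hr)
  have hf1 : ContDiffAt ℝ ∞ (deriv f) r :=
    (hf.deriv_of_isOpen isOpen_Ioi (m := ∞) (by simp)).contDiffAt (Ioi_mem_nhds hr)
  have hev : ∀ᶠ ρ in nhds r, DifferentiableAt ℝ f ρ ∧ f ρ ≠ 0 := by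
    refine Filter.Eventually.and ?_ (hfr.continuousAt.eventually_ne h0)
    filter_upwards [Ioi_mem_nhds hr] with ρ hρ
    exact (hf.contDiffAt (Ioi_mem_nhds hρ)).differentiableAt (by simp)
  have hu : ∀ a : Fin (d + 2), ∀ᶠ ρ in nhds r,
      HasDerivAt (radialProfile f a) (radialProfile₁ f a ρ) ρ := fun a =>
    hev.mono fun ρ hρ => hasDerivAt_radialProfile hρ.1 hρ.2 a
  have hu₁ : ∀ a : Fin (d + 2), HasDerivAt (radialProfile₁ f a) (radialProfile₂ f a r) r :=
    hasDerivAt_radialProfile₁ (hfr.differentiableAt (by simp)) (hf1.differentiableAt (by simp)) h0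
  have hw : ∀ a : Fin (d + 2), ∀ᶠ s in nhds 0,
      HasDerivAt (angularProfile a) (angularProfile₁ a s) s := by
    intro a
    have : ∀ᶠ s : ℝ in nhds 0, 1 + s ≠ 0 :=
      ContinuousAt.eventually_ne (by fun_prop) (by simp)
    exact this.mono fun s hs => hasDerivAt_angularProfile hs a
  have hw₁ : ∀ a : Fin (d + 2), HasDerivAt (angularProfile₁ a) _ 0 := fun a =>
    (differentiableAt_angularProfile₁ (by simp) a).hasDerivAt
  have hsm : ∀ a : Fin (d + 2), ContDiffAt ℝ 2
      (fun y => radialProfile f a (y 1) * angularProfile a (angularSq y)) (radialPoint d r) := by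
    intro a
    have hfr2 : ContDiffAt ℝ 2 f r := hfr.of_le (WithTop.coe_le_coe.2 le_top)
    refine ContDiffAt.mul ?_ ?_
    · have : ContDiffAt ℝ 2 (radialProfile f a) (radialPoint d r 1) := by
        rw [radialPoint_one]
        unfold radialProfile
        split_ifs
        · exact hfr2.neg
        · exact hfr2.inv h0
        · fun_prop
      exact this.comp (f := fun y : Fin (d + 2) → ℝ => y 1) _ (by fun_prop)
    · have : ContDiffAt ℝ 2 (angularProfile a) (angularSq (radialPoint d r)) := by
        rw [angularSq_radialPoint]
        unfold angularProfile
        split_ifs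
        · fun_prop
        · fun_prop
        · exact (contDiffAt_const.div (by fun_prop) (by simp)).pow 2
      refine this.comp _ ?_
      unfold angularSq
      fun_prop
  funext a b c e
  have hval : ∀ a : Fin (d + 2), radialProfile f a (radialPoint d r 1) *
      angularProfile a (angularSq (radialPoint d r)) = sssFrame d f r a := by
    intro a; rw [radialPoint_one, angularSq_radialPoint, sssFrame]
  rw [sssMetric_eq, riemann_diag 1 (h' := fun a => radialProfile₁ f a r * angularProfile a 0)
    (q := fun b a => if b = 1 then radialProfile₂ f a r * angularProfile a 0 else if b = 0 then 0
      else 2 * (radialProfile f a r * angularProfile₁ a 0))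
    _ hsm ?_ (fun c b a => pd_pd_separable c b (hu a) (hu₁ a) (hw a) (hw₁ a))]
  · simp only [hval]
    unfold sectional
    by_cases hab : a = b
    · subst hab
      by_cases hac : a = c <;> by_cases hae : a = e <;> simp [hac, hae]
    · congr 1
      unfold diagCurvature sssFrame radialProfile angularProfile radialProfile₁ radialProfile₂
        angularProfile₁
      rcases eq_zero_or_one_or_succ a with rfl | rfl | ⟨i, rfl⟩ <;>
        rcases eq_zero_or_one_or_succ b with rfl | rfl | ⟨j, rfl⟩
      · simp at hab
      · simp [sssCurv_zero_one]
        field_simp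
        ring
      · simp [sssCurv_zero_succ, Fin.ext_iff]
        field_simp
        ring
      · simp [sssCurv_one_zero]
        field_simp
        ring
      · simp at hab
      · simp [sssCurv_one_succ, Fin.ext_iff]
        field_simp
        ring
      · simp [sssCurv_succ_zero, Fin.ext_iff]
        field_simp
        ring
      · simp [sssCurv_succ_one, Fin.ext_iff]
        field_simp
        ring
      · have hij : ¬ i = j := by rintro rfl; simp at hab
        rw [sssCurv_succ_succ, if_neg hij]
        simp [Fin.ext_iff]
        field_simp
        ring
  · intro a
    rw [hval]
    exact sssFrame_ne_zero hr h0 a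
  · intro b a
    rw [pd_separable b (u₁ := radialProfile₁ f a) (w₁ := angularProfile₁ a)
      (by rw [radialPoint_one]; exact (hu a).self_of_nhds)
      (by rw [angularSq_radialPoint]; exact (hw a).self_of_nhds),
      radialPoint_one, angularSq_radialPoint]
    split_ifs with h1 h2 h2
    · subst h1; simp at h2
    · simp
    · rw [radialPoint_of_two_le r h2]; simp
    · simp

end SSS

/-! ## Local functionals of the metric -/

section Jets

variable {D : ℕ}

/-- The jets whose metric part is non-degenerate. -/
def nondegenerateJets (D k : ℕ) : Set (MetricJet D k) :=
  {j | (Matrix.of (j ⟨0, Fin.elim0⟩)).det ≠ 0}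

lemma continuous_det_jet (k : ℕ) :
    Continuous fun j : MetricJet D k => (Matrix.of (j ⟨0, Fin.elim0⟩)).det :=
  Continuous.matrix_det (by
    refine continuous_pi fun a => continuous_pi fun b => ?_
    simp only [Matrix.of_apply]
    fun_prop)

/-- Functions of jets have to be differentiated, which is convenient on an open domain. Lorentzian
jets are confined to symmetric matrices; the non-degenerate ones form an open set that contains
them. -/
lemma isOpen_nondegenerateJets (k : ℕ) : IsOpen (nondegenerateJets D k) :=
  isOpen_ne_fun (continuous_det_jet k) continuous_const

/-- Near `x`, `g` is a smooth, symmetric and non-degenerate field. -/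
def IsRegularAt (g : MetricField D) (x : Fin D → ℝ) : Prop :=
  ∀ᶠ y in nhds x, ContDiffAt ℝ ∞ g y ∧ (Matrix.of (g y)).det ≠ 0 ∧ ∀ b c, g y b c = g y c b

lemma IsRegularAt.eventually {g : MetricField D} {x : Fin D → ℝ} (h : IsRegularAt g x) :
    ∀ᶠ y in nhds x, IsRegularAt g y := eventually_eventually_nhds.2 h

lemma IsRegularAt.contDiffAt {g : MetricField D} {x : Fin D → ℝ} (h : IsRegularAt g x) :
    ContDiffAt ℝ ∞ g x := h.self_of_nhds.1

lemma IsMetricOn.isRegularAt {g : MetricField D} {U : Set (Fin D → ℝ)} (hU : IsOpen U)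
    (hg : IsMetricOn g U) {x : Fin D → ℝ} (hx : x ∈ U) : IsRegularAt g x := by
  filter_upwards [hU.mem_nhds hx] with y hy
  refine ⟨hg.smooth.contDiffAt (hU.mem_nhds hy), (hg.lorentzian y hy).det_ne_zero, fun b c => ?_⟩
  exact congr_fun (congr_fun (hg.lorentzian y hy).transpose_eq c) b

/-- `F` is a smooth function of the `k`-jet of the metric. -/
def IsJet (k : ℕ) (F : Density D) : Prop :=
  ∃ Φ : MetricJet D k → ℝ, ContDiffOn ℝ ∞ Φ (nondegenerateJets D k) ∧
    ∀ g x, IsRegularAt g x → F g x = Φ (metricJet k g x)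

/-- `F` is a smooth function of the metric and of finitely many of its derivatives. -/
def IsLocal (F : Density D) : Prop := ∃ k, IsJet k F

lemma metricJet_zero (k : ℕ) (g : MetricField D) (x : Fin D → ℝ) :
    metricJet k g x ⟨0, Fin.elim0⟩ = g x := by
  funext b c
  exact iteratedFDeriv_zero_apply _

lemma metricJet_mem {g : MetricField D} {x : Fin D → ℝ} (h : IsRegularAt g x) (k : ℕ) :
    metricJet k g x ∈ nondegenerateJets D k := by
  rw [nondegenerateJets, Set.mem_ofPred_eq, metricJet_zero]
  exact h.self_of_nhds.2.1

/-- Truncation of jets. -/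
def truncJet {k l : ℕ} (h : k ≤ l) (j : MetricJet D l) : MetricJet D k :=
  fun w => j ⟨Fin.castLE (Nat.succ_le_succ h) w.1, w.2⟩

/-- The derivative of a jet in the direction `a`. -/
def shiftJet {k : ℕ} (a : Fin D) (j : MetricJet D (k + 1)) : MetricJet D k :=
  fun w => j ⟨w.1.succ, Fin.cons (α := fun _ => Fin D) a w.2⟩

lemma contDiff_truncJet {k l : ℕ} (h : k ≤ l) : ContDiff ℝ ∞ (truncJet (D := D) h) := by
  unfold truncJet; fun_prop

lemma contDiff_shiftJet {k : ℕ} (a : Fin D) : ContDiff ℝ ∞ (shiftJet (k := k) a) := by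
  unfold shiftJet; fun_prop

lemma truncJet_mem {k l : ℕ} (h : k ≤ l) {j : MetricJet D l} (hj : j ∈ nondegenerateJets D l) :
    truncJet h j ∈ nondegenerateJets D k := hj

lemma truncJet_metricJet {k l : ℕ} (h : k ≤ l) (g : MetricField D) (x : Fin D → ℝ) :
    truncJet h (metricJet l g x) = metricJet k g x := rfl

lemma contDiffAt_metricJet {g : MetricField D} {x : Fin D → ℝ} (h : ContDiffAt ℝ ∞ g x) (k : ℕ) :
    ContDiffAt ℝ ∞ (metricJet k g) x := by
  refine contDiffAt_pi.2 fun w => contDiffAt_pi.2 fun b => contDiffAt_pi.2 fun c => ?_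
  have h1 : ContDiffAt ℝ ∞ (fun y => g y b c) x := contDiffAt_pi.1 (contDiffAt_pi.1 h b) c
  have h2 : ContDiffAt ℝ ∞ (iteratedFDeriv ℝ w.1 (fun y => g y b c)) x :=
    h1.iteratedFDeriv_right (by norm_cast)
  exact (ContinuousMultilinearMap.apply ℝ (fun _ : Fin w.1 => Fin D → ℝ) ℝ
    (fun s => Pi.single (w.2 s) 1)).contDiff.contDiffAt.comp x h2

lemma pd_iteratedFDeriv {F : (Fin D → ℝ) → ℝ} {x : Fin D → ℝ} (h : ContDiffAt ℝ ∞ F x) (i : ℕ)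
    (a : Fin D) (w : Fin i → Fin D) :
    pd a (fun y => iteratedFDeriv ℝ i F y (fun s => Pi.single (w s) 1)) x
      = iteratedFDeriv ℝ (i + 1) F x
        (fun s => Pi.single (Fin.cons (α := fun _ => Fin D) a w s : Fin D) 1) := by
  have h2 : DifferentiableAt ℝ (iteratedFDeriv ℝ i F) x :=
    (h.iteratedFDeriv_right (m := ∞) (by norm_cast)).differentiableAt (by simp)
  have h3 := ((ContinuousMultilinearMap.apply ℝ (fun _ : Fin i => Fin D → ℝ) ℝ
    (fun s => Pi.single (w s) 1)).hasFDerivAt).comp x h2.hasFDerivAt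
  rw [iteratedFDeriv_succ_apply_left, pd_eq
    (F := fun y => iteratedFDeriv ℝ i F y (fun s => Pi.single (w s) 1)) h3]
  rfl

lemma fderiv_metricJet {g : MetricField D} {x : Fin D → ℝ} (h : ContDiffAt ℝ ∞ g x) (k : ℕ)
    (a : Fin D) : fderiv ℝ (metricJet k g) x (Pi.single a 1) = shiftJet a (metricJet (k + 1) g x) := by
  have hd : DifferentiableAt ℝ (metricJet k g) x :=
    (contDiffAt_metricJet h k).differentiableAt (by simp)
  funext w b c
  have h1 : ContDiffAt ℝ ∞ (fun y => g y b c) x := contDiffAt_pi.1 (contDiffAt_pi.1 h b) c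
  have e := pd_iteratedFDeriv h1 w.1 a w.2
  have e' : fderiv ℝ (metricJet k g) x (Pi.single a 1) w b c
      = pd a (fun y => metricJet k g y w b c) x := by
    rw [pd_eq (F' := (((ContinuousLinearMap.proj (R := ℝ) (φ := fun _ : Fin D => ℝ) c).comp
      (ContinuousLinearMap.proj (R := ℝ) (φ := fun _ : Fin D => Fin D → ℝ) b)).comp
      (ContinuousLinearMap.proj (R := ℝ) (φ := fun _ => Fin D → Fin D → ℝ) w)).comp
      (fderiv ℝ (metricJet k g) x)) _]
    · rfl
    · exact (hasFDerivAt_pi'.1 (hasFDerivAt_pi'.1 (hasFDerivAt_pi'.1 hd.hasFDerivAt w) b) c)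
  rw [e']
  exact e

/-! ### Closure properties -/

lemma IsJet.mono {k l : ℕ} (h : k ≤ l) {F : Density D} (hF : IsJet k F) : IsJet l F := by
  obtain ⟨Φ, hΦ, e⟩ := hF
  refine ⟨Φ ∘ truncJet h, hΦ.comp (contDiff_truncJet h).contDiffOn fun j hj => truncJet_mem h hj,
    fun g x hg => ?_⟩
  rw [e g x hg, Function.comp, truncJet_metricJet]

lemma IsLocal.exists_common {κ : Type*} [Fintype κ] {F : κ → Density D} (h : ∀ i, IsLocal (F i)) :
    ∃ k, ∀ i, IsJet k (F i) := by
  choose k hk using h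
  exact ⟨Finset.univ.sup k, fun i => (hk i).mono (Finset.le_sup (Finset.mem_univ i))⟩

lemma IsLocal.congr {F F' : Density D} (hF : IsLocal F)
    (h : ∀ g x, IsRegularAt g x → F' g x = F g x) : IsLocal F' := by
  obtain ⟨k, Φ, hΦ, e⟩ := hF
  exact ⟨k, Φ, hΦ, fun g x hg => by rw [h g x hg, e g x hg]⟩

lemma isLocal_const (c : ℝ) : IsLocal (D := D) fun _ _ => c :=
  ⟨0, fun _ => c, contDiffOn_const, fun _ _ _ => rfl⟩

lemma IsLocal.add {F F' : Density D} (hF : IsLocal F) (hF' : IsLocal F') :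
    IsLocal fun g x => F g x + F' g x := by
  obtain ⟨k, h⟩ := IsLocal.exists_common (F := fun b : Bool => cond b F F')
    (fun b => by cases b <;> assumption)
  obtain ⟨Φ, hΦ, e⟩ := h true
  obtain ⟨Φ', hΦ', e'⟩ := h false
  exact ⟨k, fun j => Φ j + Φ' j, hΦ.add hΦ', fun g x hg => congr_arg₂ _ (e g x hg) (e' g x hg)⟩

lemma IsLocal.mul {F F' : Density D} (hF : IsLocal F) (hF' : IsLocal F') :
    IsLocal fun g x => F g x * F' g x := by
  obtain ⟨k, h⟩ := IsLocal.exists_common (F := fun b : Bool => cond b F F')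
    (fun b => by cases b <;> assumption)
  obtain ⟨Φ, hΦ, e⟩ := h true
  obtain ⟨Φ', hΦ', e'⟩ := h false
  exact ⟨k, fun j => Φ j * Φ' j, hΦ.mul hΦ', fun g x hg => congr_arg₂ _ (e g x hg) (e' g x hg)⟩

lemma IsLocal.const_mul {F : Density D} (hF : IsLocal F) (c : ℝ) :
    IsLocal fun g x => c * F g x := (isLocal_const c).mul hF

lemma IsLocal.sub {F F' : Density D} (hF : IsLocal F) (hF' : IsLocal F') :
    IsLocal fun g x => F g x - F' g x := by
  simpa [sub_eq_add_neg] using hF.add (hF'.const_mul (-1))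

lemma IsLocal.sum {κ : Type*} (s : Finset κ) {F : κ → Density D} (h : ∀ i ∈ s, IsLocal (F i)) :
    IsLocal fun g x => ∑ i ∈ s, F i g x := by
  classical
  induction s using Finset.induction_on with
  | empty => simpa using isLocal_const 0
  | insert i s hi ih =>
    simp only [Finset.sum_insert hi]
    exact (h i (by simp)).add (ih fun j hj => h j (by simp [hj]))

lemma IsLocal.prod {κ : Type*} (s : Finset κ) {F : κ → Density D} (h : ∀ i ∈ s, IsLocal (F i)) :
    IsLocal fun g x => ∏ i ∈ s, F i g x := by
  classical
  induction s using Finset.induction_on with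
  | empty => simpa using isLocal_const 1
  | insert i s hi ih =>
    simp only [Finset.prod_insert hi]
    exact (h i (by simp)).mul (ih fun j hj => h j (by simp [hj]))

lemma isLocal_metric (b c : Fin D) : IsLocal fun g x => g x b c :=
  ⟨0, fun j => j ⟨0, Fin.elim0⟩ b c, ContDiff.contDiffOn (by fun_prop),
    fun g x _ => by simp only [metricJet_zero]⟩

lemma IsLocal.comp {u : ℝ → ℝ} (hu : ∀ s, s ≠ 0 → ContDiffAt ℝ ∞ u s) :
    IsLocal (D := D) fun g x => u (Matrix.of (g x)).det := by
  refine ⟨0, fun j => u (Matrix.of (j ⟨0, Fin.elim0⟩)).det, fun j hj => ?_,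
    fun g x _ => by simp only [metricJet_zero]⟩
  have h : ContDiff ℝ ∞ fun j : MetricJet D 0 => (Matrix.of (j ⟨0, Fin.elim0⟩)).det := by
    simp only [Matrix.det_apply', Matrix.of_apply]
    fun_prop
  exact (ContDiffAt.comp j (hu (Matrix.of (j ⟨0, Fin.elim0⟩)).det hj) h.contDiffAt).contDiffWithinAt

lemma isLocal_volumeFactor : IsLocal (volumeFactor (D := D)) :=
  IsLocal.comp (u := fun s => Real.sqrt |s|) fun _ hs =>
    ContDiffAt.sqrt (contDiffAt_abs hs) (abs_ne_zero.2 hs)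

lemma isLocal_inverseMetric (a b : Fin D) : IsLocal fun g x => inverseMetric g x a b := by
  unfold inverseMetric
  simp only [Matrix.inv_def, Matrix.smul_apply, Ring.inverse_eq_inv', smul_eq_mul,
    Matrix.adjugate_apply]
  refine IsLocal.mul (IsLocal.comp (u := fun s => s⁻¹) fun s hs => contDiffAt_inv _ hs) ?_
  simp only [Matrix.det_apply']
  refine IsLocal.sum _ fun σ _ => (isLocal_const _).mul (IsLocal.prod _ fun i _ => ?_)
  by_cases h : σ i = b
  · simpa [h, Matrix.updateRow_apply] using isLocal_const _
  · simpa [h, Matrix.updateRow_apply] using isLocal_metric _ _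

/-- By the chain rule, differentiating a function of the `k`-jet pairs its derivative with the
shifted `(k+1)`-jet, so the order of the jet rises by one. -/
lemma IsLocal.pd {F : Density D} (hF : IsLocal F) (a : Fin D) :
    IsLocal fun g x => pd a (F g) x := by
  obtain ⟨k, Φ, hΦ, e⟩ := hF
  refine ⟨k + 1, fun j => fderiv ℝ Φ (truncJet (Nat.le_succ k) j) (shiftJet a j), ?_,
    fun g x hg => ?_⟩
  · have h1 := hΦ.fderiv_of_isOpen (isOpen_nondegenerateJets k) (m := ∞) (by simp)
    exact (h1.comp (contDiff_truncJet (Nat.le_succ k)).contDiffOn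
      fun j hj => truncJet_mem _ hj).clm_apply (contDiff_shiftJet a).contDiffOn
  · have h1 : F g =ᶠ[nhds x] fun y => Φ (metricJet k g y) :=
      hg.eventually.mono fun y hy => e g y hy
    have h2 : HasFDerivAt Φ (fderiv ℝ Φ (metricJet k g x)) (metricJet k g x) :=
      ((hΦ.contDiffAt ((isOpen_nondegenerateJets k).mem_nhds (metricJet_mem hg k))).differentiableAt
        (by simp)).hasFDerivAt
    have h3 := ((contDiffAt_metricJet hg.contDiffAt k).differentiableAt (by simp)).hasFDerivAt
    beta_reduce
    rw [pd_congr h1, pd_eq (F := fun y => Φ (metricJet k g y)) (h2.comp x h3),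
      ContinuousLinearMap.comp_apply, fderiv_metricJet hg.contDiffAt, truncJet_metricJet]

lemma IsLocal.contDiffAt {F : Density D} (hF : IsLocal F) {g : MetricField D} {x : Fin D → ℝ}
    (hg : IsRegularAt g x) : ContDiffAt ℝ ∞ (F g) x := by
  obtain ⟨k, Φ, hΦ, e⟩ := hF
  have h1 : F g =ᶠ[nhds x] fun y => Φ (metricJet k g y) :=
    hg.eventually.mono fun y hy => e g y hy
  refine ContDiffAt.congr_of_eventuallyEq ?_ h1
  exact (hΦ.contDiffAt ((isOpen_nondegenerateJets k).mem_nhds (metricJet_mem hg k))).comp x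
    (contDiffAt_metricJet hg.contDiffAt k)

lemma IsLocal.differentiableAt {F : Density D} (hF : IsLocal F) {g : MetricField D}
    {x : Fin D → ℝ} (hg : IsRegularAt g x) : DifferentiableAt ℝ (F g) x :=
  (hF.contDiffAt hg).differentiableAt (by simp)

lemma isLocal_christoffel (a b c : Fin D) : IsLocal fun g x => christoffel g x a b c :=
  (IsLocal.sum _ fun e _ => (isLocal_inverseMetric a e).mul
    ((((isLocal_metric e c).pd b).add ((isLocal_metric e b).pd c)).sub
      ((isLocal_metric b c).pd e))).const_mul _

lemma isLocal_riemannUp (a b c d : Fin D) : IsLocal fun g x => riemannUp g x a b c d :=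
  (((isLocal_christoffel a d b).pd c).sub ((isLocal_christoffel a c b).pd d)).add
    (IsLocal.sum _ fun e _ => ((isLocal_christoffel a c e).mul (isLocal_christoffel e d b)).sub
      ((isLocal_christoffel a d e).mul (isLocal_christoffel e c b)))

lemma isLocal_riemann (a b c d : Fin D) : IsLocal fun g x => riemann g x a b c d :=
  IsLocal.sum _ fun e _ => (isLocal_metric a e).mul (isLocal_riemannUp e b c d)

lemma isLocal_riemannPower (n : ℕ) (i : Fin n × Fin 4 → Fin D) :
    IsLocal fun g x => riemannPower n g x i :=
  IsLocal.prod _ fun _ _ => isLocal_riemann _ _ _ _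

lemma IsLocal.contract {S : Type} [Fintype S] [DecidableEq S] {m : ℕ} (e : S ≃ Fin m × Fin 2)
    {T : MetricField D → (Fin D → ℝ) → (S → Fin D) → ℝ} (hT : ∀ i, IsLocal fun g x => T g x i) :
    IsLocal fun g x => contract e (inverseMetric g x) (T g x) :=
  IsLocal.sum _ fun i _ => (hT i).mul (IsLocal.prod _ fun _ _ => isLocal_inverseMetric _ _)

lemma isLocal_of_mem_curvatureInvariants {n : ℕ} {L : Density D}
    (hL : L ∈ curvatureInvariants D n) : IsLocal L := by
  induction hL using Submodule.span_induction with
  | mem L h =>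
    obtain ⟨e, rfl⟩ := h
    exact IsLocal.contract e (isLocal_riemannPower n)
  | zero => exact isLocal_const 0
  | add L L' _ _ h h' => exact h.add h'
  | smul c L _ h => exact h.const_mul c

lemma isLocal_of_mem_symmetricCurvatureTensors {m : ℕ} {K : MetricField D → MetricField D}
    (hK : K ∈ symmetricCurvatureTensors D m) (a b : Fin D) : IsLocal fun g x => K g x a b := by
  induction hK using Submodule.span_induction with
  | mem K h =>
    obtain ⟨e, rfl⟩ := h
    have : ∀ a b : Fin D, IsLocal fun g x => tensorContraction m e g x a b := fun a b =>
      IsLocal.contract e fun i => (isLocal_riemannPower m _).mul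
        ((isLocal_metric _ _).mul (isLocal_metric _ _))
    exact (this a b).add (this b a)
  | zero => exact isLocal_const 0
  | add K K' _ _ h h' => exact h.add h'
  | smul c K _ h => exact h.const_mul c

lemma symm_of_mem_symmetricCurvatureTensors {m : ℕ} {K : MetricField D → MetricField D}
    (hK : K ∈ symmetricCurvatureTensors D m) (g : MetricField D) (x : Fin D → ℝ) (a b : Fin D) :
    K g x a b = K g x b a := by
  induction hK using Submodule.span_induction with
  | mem K h => obtain ⟨e, rfl⟩ := h; exact add_comm _ _
  | zero => rfl
  | add K K' _ _ h h' => exact congr_arg₂ (· + ·) h h'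
  | smul c K _ h => exact congr_arg (c * ·) h

end Jets

/-! ## Variations of local functionals -/

section Variation

variable {D : ℕ}

/-- The first variation of `F` under `g → g + ε K(g)`. -/
def variation (K : MetricField D → MetricField D) (F : Density D) : Density D :=
  fun g x => deriv (fun ε : ℝ => F (g + ε • K g) x) 0

/-- `K` is a local functional with values in symmetric tensor fields. -/
structure IsLocalTensor (K : MetricField D → MetricField D) : Prop where
  isLocal : ∀ a b, IsLocal fun g x => K g x a b
  symm : ∀ g x a b, K g x a b = K g x b a

variable {K : MetricField D → MetricField D} {g : MetricField D} {x : Fin D → ℝ}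

lemma IsLocalTensor.contDiffAt (hK : IsLocalTensor K) (hg : IsRegularAt g x) :
    ContDiffAt ℝ ∞ (K g) x :=
  contDiffAt_pi.2 fun a => contDiffAt_pi.2 fun b => (hK.isLocal a b).contDiffAt hg

/-- The neighbourhood is joint in `ε` and the point, because derivatives in both are taken and
exchanged. Regularity, unlike the Lorentzian condition, is visibly stable: it needs only smoothness,
symmetry and a non-zero determinant. -/
lemma eventually_isRegularAt (hK : IsLocalTensor K) (hg : IsRegularAt g x) :
    ∀ᶠ p : ℝ × (Fin D → ℝ) in nhds (0, x), IsRegularAt (g + p.1 • K g) p.2 := by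
  have hsnd : Filter.Tendsto (fun p : ℝ × (Fin D → ℝ) => p.2) (nhds (0, x)) (nhds x) :=
    continuous_snd.tendsto' _ _ rfl
  have hcont : ContinuousAt
      (fun p : ℝ × (Fin D → ℝ) => (Matrix.of ((g + p.1 • K g) p.2)).det) (0, x) := by
    have h1 : ContinuousAt (fun p : ℝ × (Fin D → ℝ) => g p.2) (0, x) :=
      ContinuousAt.comp (f := fun p : ℝ × (Fin D → ℝ) => p.2) (x := (0, x))
        hg.contDiffAt.continuousAt continuousAt_snd
    have h2 : ContinuousAt (fun p : ℝ × (Fin D → ℝ) => K g p.2) (0, x) :=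
      ContinuousAt.comp (f := fun p : ℝ × (Fin D → ℝ) => p.2) (x := (0, x))
        (hK.contDiffAt hg).continuousAt continuousAt_snd
    have h3 : ContinuousAt (fun p : ℝ × (Fin D → ℝ) => g p.2 + p.1 • K g p.2) (0, x) :=
      h1.add (continuousAt_fst.smul h2)
    have h4 : Continuous fun M : Fin D → Fin D → ℝ => (Matrix.of M).det :=
      Continuous.matrix_det continuous_id
    exact h4.continuousAt.comp h3
  have hdet : ∀ᶠ p : ℝ × (Fin D → ℝ) in nhds (0, x),
      (Matrix.of ((g + p.1 • K g) p.2)).det ≠ 0 := by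
    refine hcont.eventually_ne ?_
    simpa using hg.self_of_nhds.2.1
  have hall : ∀ᶠ p : ℝ × (Fin D → ℝ) in nhds (0, x), ContDiffAt ℝ ∞ (g + p.1 • K g) p.2 ∧
      (Matrix.of ((g + p.1 • K g) p.2)).det ≠ 0 ∧
      ∀ b c, (g + p.1 • K g) p.2 b c = (g + p.1 • K g) p.2 c b := by
    filter_upwards [hdet, hsnd.eventually hg.eventually] with p hp hp'
    refine ⟨hp'.contDiffAt.add (contDiffAt_const.smul (hK.contDiffAt hp')), hp, fun b c => ?_⟩
    simp only [Pi.add_apply, Pi.smul_apply, hp'.self_of_nhds.2.2 b c, hK.symm g p.2 b c]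
  filter_upwards [eventually_eventually_nhds.2 hall] with p hp
  have ht : Filter.Tendsto (fun y : Fin D → ℝ => (p.1, y)) (nhds p.2) (nhds p) :=
    Continuous.tendsto' (by fun_prop) _ _ rfl
  exact ht.eventually hp

lemma metricJet_perturb {g' : MetricField D} (k : ℕ) (hg : ContDiffAt ℝ ∞ g x)
    (hg' : ContDiffAt ℝ ∞ g' x) (ε : ℝ) :
    metricJet k (g + ε • g') x = metricJet k g x + ε • metricJet k g' x := by
  funext w b c
  have h1 : ContDiffAt ℝ w.1 (fun y => g y b c) x :=
    (contDiffAt_pi.1 (contDiffAt_pi.1 hg b) c).of_le (WithTop.coe_le_coe.2 le_top)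
  have h2 : ContDiffAt ℝ w.1 (fun y => g' y b c) x :=
    (contDiffAt_pi.1 (contDiffAt_pi.1 hg' b) c).of_le (WithTop.coe_le_coe.2 le_top)
  change iteratedFDeriv ℝ w.1 ((fun y => g y b c) + ε • fun y => g' y b c) x _ = _
  have h3 : ContDiffAt ℝ w.1 (ε • fun y => g' y b c) x := h2.const_smul ε
  rw [iteratedFDeriv_add_apply h1 h3, iteratedFDeriv_const_smul_apply h2]
  rfl

/-- Jets are linear in the metric, so near `(0, x)` the perturbed functional is a smooth `Φ`
evaluated at `j(g) + ε j(K g)`. -/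
lemma IsLocal.contDiffAt_perturb {F : Density D} (hF : IsLocal F) (hK : IsLocalTensor K)
    (hg : IsRegularAt g x) :
    ContDiffAt ℝ ∞ (fun p : ℝ × (Fin D → ℝ) => F (g + p.1 • K g) p.2) (0, x) := by
  obtain ⟨k, Φ, hΦ, e⟩ := hF
  have hsnd : Filter.Tendsto (fun p : ℝ × (Fin D → ℝ) => p.2) (nhds (0, x)) (nhds x) :=
    continuous_snd.tendsto' _ _ rfl
  have hev : (fun p : ℝ × (Fin D → ℝ) => F (g + p.1 • K g) p.2) =ᶠ[nhds (0, x)]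
      fun p => Φ (metricJet k g p.2 + p.1 • metricJet k (K g) p.2) := by
    filter_upwards [eventually_isRegularAt hK hg, hsnd.eventually hg.eventually] with p hp hp'
    rw [e _ _ hp, metricJet_perturb k hp'.contDiffAt (hK.contDiffAt hp')]
  refine ContDiffAt.congr_of_eventuallyEq ?_ hev
  have h1 : ContDiffAt ℝ ∞ (fun p : ℝ × (Fin D → ℝ) => metricJet k g p.2) (0, x) :=
    ContDiffAt.comp (f := fun p : ℝ × (Fin D → ℝ) => p.2) (0, x)
      (contDiffAt_metricJet hg.contDiffAt k) contDiffAt_snd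
  have h2 : ContDiffAt ℝ ∞ (fun p : ℝ × (Fin D → ℝ) => metricJet k (K g) p.2) (0, x) :=
    ContDiffAt.comp (f := fun p : ℝ × (Fin D → ℝ) => p.2) (0, x)
      (contDiffAt_metricJet (hK.contDiffAt hg) k) contDiffAt_snd
  have h3 : ContDiffAt ℝ ∞ Φ (metricJet k g x + (0 : ℝ) • metricJet k (K g) x) := by
    rw [zero_smul, add_zero]
    exact hΦ.contDiffAt ((isOpen_nondegenerateJets k).mem_nhds (metricJet_mem hg k))
  exact ContDiffAt.comp (f := fun p : ℝ × (Fin D → ℝ) =>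
    metricJet k g p.2 + p.1 • metricJet k (K g) p.2) (0, x) h3 (h1.add (contDiffAt_fst.smul h2))

lemma IsLocal.hasDerivAt {F : Density D} (hF : IsLocal F) (hK : IsLocalTensor K)
    (hg : IsRegularAt g x) :
    HasDerivAt (fun ε : ℝ => F (g + ε • K g) x) (variation K F g x) 0 := by
  refine DifferentiableAt.hasDerivAt ?_
  have h := (hF.contDiffAt_perturb hK hg).differentiableAt (by simp)
  exact DifferentiableAt.comp (f := fun ε : ℝ => (ε, x)) 0 h (by fun_prop)

/-- The derivatives in `ε` and in the coordinate commute by symmetry of the second derivative of `f`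
on the product space. -/
lemma hasDerivAt_pd {f : ℝ × (Fin D → ℝ) → ℝ} (hf : ContDiffAt ℝ ∞ f (0, x)) (a : Fin D) :
    HasDerivAt (fun ε => pd a (fun y => f (ε, y)) x)
      (pd a (fun y => deriv (fun ε => f (ε, y)) 0) x) 0 := by
  have h2 : ContDiffAt ℝ 2 f (0, x) := hf.of_le (WithTop.coe_le_coe.2 le_top)
  have hd : ∀ᶠ p in nhds ((0 : ℝ), x), DifferentiableAt ℝ f p :=
    (h2.eventually (by simp)).mono fun p hp => hp.differentiableAt (by simp)
  have hD : HasFDerivAt (fderiv ℝ f) (fderiv ℝ (fderiv ℝ f) (0, x)) (0, x) :=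
    ((h2.fderiv_right (m := 1) (by norm_num)).differentiableAt (by simp)).hasFDerivAt
  have hsym : fderiv ℝ (fderiv ℝ f) (0, x) (1, 0) (0, Pi.single a 1)
      = fderiv ℝ (fderiv ℝ f) (0, x) (0, Pi.single a 1) (1, 0) :=
    (h2.isSymmSndFDerivAt (by simp)).eq _ _
  have ht₁ : Filter.Tendsto (fun ε : ℝ => (ε, x)) (nhds 0) (nhds (0, x)) :=
    Continuous.tendsto' (by fun_prop) _ _ rfl
  have ht₂ : Filter.Tendsto (fun y : Fin D → ℝ => ((0 : ℝ), y)) (nhds x) (nhds (0, x)) :=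
    Continuous.tendsto' (by fun_prop) _ _ rfl
  have hin : ∀ (ε : ℝ) (y : Fin D → ℝ), HasFDerivAt (fun y : Fin D → ℝ => (ε, y))
      (ContinuousLinearMap.inr ℝ ℝ (Fin D → ℝ)) y := fun ε y =>
    (hasFDerivAt_const ε y).prodMk (hasFDerivAt_id y)
  have hin' : ∀ (y : Fin D → ℝ), HasDerivAt (fun ε : ℝ => (ε, y)) ((1 : ℝ), (0 : Fin D → ℝ)) 0 :=
    fun y => (hasDerivAt_id (0 : ℝ)).prodMk (hasDerivAt_const (0 : ℝ) y)
  have e₁ : (fun ε => pd a (fun y => f (ε, y)) x) =ᶠ[nhds 0]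
      fun ε => fderiv ℝ f (ε, x) (0, Pi.single a 1) := by
    filter_upwards [ht₁.eventually hd] with ε hε
    have h : HasFDerivAt (fun y => f (ε, y)) _ x := HasFDerivAt.comp x hε.hasFDerivAt (hin ε x)
    rw [pd_eq h]
    rfl
  have e₂ : (fun y => deriv (fun ε => f (ε, y)) 0) =ᶠ[nhds x]
      fun y => fderiv ℝ f (0, y) (1, 0) := by
    filter_upwards [ht₂.eventually hd] with y hy
    have h : HasDerivAt (fun ε => f (ε, y)) _ 0 := hy.hasFDerivAt.comp_hasDerivAt 0 (hin' y)
    exact h.deriv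
  rw [pd_congr e₂]
  have h₂ : HasFDerivAt (fun y => fderiv ℝ f (0, y))
      ((fderiv ℝ (fderiv ℝ f) (0, x)).comp (ContinuousLinearMap.inr ℝ ℝ (Fin D → ℝ))) x :=
    HasFDerivAt.comp x hD (hin 0 x)
  have h₂' : HasFDerivAt (fun y => fderiv ℝ f (0, y) (1, 0)) _ x :=
    (ContinuousLinearMap.apply ℝ ℝ ((1 : ℝ), (0 : Fin D → ℝ))).hasFDerivAt.comp x h₂
  have h₁ : HasDerivAt (fun ε => fderiv ℝ f (ε, x)) (fderiv ℝ (fderiv ℝ f) (0, x) (1, 0)) 0 :=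
    hD.comp_hasDerivAt 0 (hin' x)
  have h₁' : HasDerivAt (fun ε => fderiv ℝ f (ε, x) (0, Pi.single a 1)) _ 0 :=
    (ContinuousLinearMap.apply ℝ ℝ ((0 : ℝ), (Pi.single a 1 : Fin D → ℝ))).hasFDerivAt.comp_hasDerivAt
      0 h₁
  rw [pd_eq h₂']
  exact (h₁'.congr_deriv hsym).congr_of_eventuallyEq e₁

lemma variation_pd {F : Density D} (hF : IsLocal F) (hK : IsLocalTensor K)
    (hg : IsRegularAt g x) (a : Fin D) :
    variation K (fun g x => pd a (F g) x) g x = pd a (variation K F g) x :=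
  (hasDerivAt_pd (hF.contDiffAt_perturb hK hg) a).deriv

/-- The components of the jets of a local tensor field are local. -/
lemma IsLocalTensor.isLocal_metricJet (hK : IsLocalTensor K) (i : ℕ) (w : Fin i → Fin D)
    (b c : Fin D) : IsLocal fun g x =>
      iteratedFDeriv ℝ i (fun y => K g y b c) x (fun s => Pi.single (w s) 1) := by
  induction i with
  | zero => exact (hK.isLocal b c).congr fun g x _ => iteratedFDeriv_zero_apply _
  | succ i ih =>
    refine ((ih (Fin.tail w)).pd (w 0)).congr fun g x hg => ?_
    rw [pd_iteratedFDeriv ((hK.isLocal b c).contDiffAt hg)]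
    congr 1
    funext s
    rw [show (Fin.cons (α := fun _ => Fin D) (w 0) (Fin.tail w)) = w from Fin.cons_self_tail w]

lemma jet_eq_sum {k : ℕ} (j : MetricJet D k) :
    j = ∑ w, ∑ b, ∑ c, j w b c • Pi.single w (Pi.single b (Pi.single c 1)) := by
  funext w b c
  simp only [Finset.sum_apply, Pi.smul_apply, smul_eq_mul]
  rw [Finset.sum_eq_single w, Finset.sum_eq_single b, Finset.sum_eq_single c]
  · simp
  · intro c' _ h; simp [Pi.single_eq_of_ne h.symm]
  · simp
  · intro b' _ h; simp [Pi.single_eq_of_ne h.symm]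
  · simp
  · intro w' _ h; simp [Pi.single_eq_of_ne h.symm]
  · simp

/-- The variation is the linearisation `dΦ(j(g))` applied to the jet of `K g`, and the components of
that jet are themselves local. This makes `δΓ`, and with it the Palatini current, an admissible
current. -/
lemma IsLocal.variation {F : Density D} (hF : IsLocal F) (hK : IsLocalTensor K) :
    IsLocal (variation K F) := by
  have hF' := hF
  obtain ⟨k, Φ, hΦ, e⟩ := hF'
  have h1 : IsLocal fun g x => ∑ w, ∑ b, ∑ c, metricJet k (K g) x w b c *
      fderiv ℝ Φ (metricJet k g x) (Pi.single w (Pi.single b (Pi.single c 1))) := by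
    refine IsLocal.sum _ fun w _ => IsLocal.sum _ fun b _ => IsLocal.sum _ fun c _ =>
      (hK.isLocal_metricJet w.1 w.2 b c).mul ⟨k, fun j => fderiv ℝ Φ j _, ?_, fun g x _ => rfl⟩
    exact (hΦ.fderiv_of_isOpen (isOpen_nondegenerateJets k) (m := ∞) (by simp)).clm_apply
      contDiffOn_const
  refine h1.congr fun g x hg => ?_
  have ht₁ : Filter.Tendsto (fun ε : ℝ => (ε, x)) (nhds 0) (nhds (0, x)) :=
    Continuous.tendsto' (by fun_prop) _ _ rfl
  have hev : (fun ε : ℝ => F (g + ε • K g) x) =ᶠ[nhds 0]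
      fun ε => Φ (metricJet k g x + ε • metricJet k (K g) x) := by
    filter_upwards [ht₁.eventually (eventually_isRegularAt hK hg)] with ε hε
    rw [e _ _ hε, metricJet_perturb k hg.contDiffAt (hK.contDiffAt hg)]
  have h2 : HasFDerivAt Φ (fderiv ℝ Φ (metricJet k g x))
      (metricJet k g x + (0 : ℝ) • metricJet k (K g) x) := by
    rw [zero_smul, add_zero]
    exact ((hΦ.contDiffAt ((isOpen_nondegenerateJets k).mem_nhds
      (metricJet_mem hg k))).differentiableAt (by simp)).hasFDerivAt
  have h3 : HasDerivAt (fun ε : ℝ => metricJet k g x + ε • metricJet k (K g) x)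
      ((1 : ℝ) • metricJet k (K g) x) 0 :=
    ((hasDerivAt_id (0 : ℝ)).smul_const _).const_add _
  have h4 := (h2.comp_hasDerivAt (0 : ℝ) h3).congr_of_eventuallyEq hev
  rw [GQTG.variation, h4.deriv, one_smul]
  conv_lhs => rw [jet_eq_sum (metricJet k (K g) x)]
  simp only [map_sum, map_smul, smul_eq_mul]

lemma isTotalDerivativeOn_divergence {J : Fin D → Density D} (hJ : ∀ a, IsLocal (J a))
    (C : MetricField D → Set (Fin D → ℝ) → Prop) :
    IsTotalDerivativeOn C fun g x => ∑ a, pd a (J a g) x := by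
  obtain ⟨k, h⟩ := IsLocal.exists_common hJ
  choose Φ hΦ e using h
  refine ⟨k, fun j a => Φ a j, contDiffOn_pi.2 fun a => (hΦ a).mono fun j hj => ?_,
    fun U g hU hg _ x hx => Finset.sum_congr rfl fun a _ => ?_⟩
  · exact IsLorentzian.det_ne_zero hj
  · exact pd_congr ((hg.isRegularAt hU hx).eventually.mono fun y hy => e a g y hy)

end Variation

/-! ## Derivatives of determinants and inverse matrices -/

section MatrixDerivatives

variable {D : ℕ} {M : ℝ → Matrix (Fin D) (Fin D) ℝ} {M' N' : Matrix (Fin D) (Fin D) ℝ}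

/-- Jacobi's formula: the Leibniz expansion is differentiated column by column, and by Cramer's rule
the determinant with column `i` replaced is a diagonal entry of `adj(M) M'`. -/
lemma hasDerivAt_det (hM : ∀ i j, HasDerivAt (fun t => M t i j) (M' i j) 0) :
    HasDerivAt (fun t => (M t).det) ((M 0).adjugate * M').trace 0 := by
  have h : HasDerivAt (fun t => (M t).det) (∑ σ : Equiv.Perm (Fin D), ((σ.sign : ℤ) : ℝ) *
      ∑ i, (∏ j ∈ Finset.univ.erase i, M 0 (σ j) j) * M' (σ i) i) 0 := by
    simp only [Matrix.det_apply']
    refine HasDerivAt.fun_sum fun σ _ => HasDerivAt.const_mul _ ?_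
    have := HasDerivAt.fun_finsetProd (u := Finset.univ)
      (f := fun i t => M t (σ i) i) (f' := fun i => M' (σ i) i) (x := (0 : ℝ)) fun i _ => hM _ _
    simpa using this
  refine h.congr_deriv ?_
  have h1 : ∀ i, ((M 0).adjugate * M') i i = ((M 0).updateCol i (fun k => M' k i)).det := by
    intro i
    rw [← Matrix.cramer_apply, Matrix.cramer_eq_adjugate_mulVec]
    rfl
  simp only [Matrix.trace, Matrix.diag, h1, Matrix.det_apply', Finset.mul_sum]
  rw [Finset.sum_comm]
  refine Finset.sum_congr rfl fun i _ => Finset.sum_congr rfl fun σ _ => ?_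
  rw [← Finset.mul_prod_erase Finset.univ _ (Finset.mem_univ i)]
  simp only [Matrix.updateCol_self]
  rw [mul_comm (M' (σ i) i)]
  congr 2
  refine Finset.prod_congr rfl fun j hj => ?_
  rw [Matrix.updateCol_ne (Finset.ne_of_mem_erase hj)]

lemma hasDerivAt_sqrt_abs_det (hM : ∀ i j, HasDerivAt (fun t => M t i j) (M' i j) 0)
    (h0 : (M 0).det ≠ 0) : HasDerivAt (fun t => Real.sqrt |(M t).det|)
      (1 / 2 * Real.sqrt |(M 0).det| * ((M 0)⁻¹ * M').trace) 0 := by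
  have h1 : HasDerivAt (fun t => |(M t).det|) _ 0 :=
    HasDerivAt.comp (h₂ := fun s : ℝ => |s|) (0 : ℝ) (hasDerivAt_abs h0) (hasDerivAt_det hM)
  have h2 := h1.sqrt (abs_ne_zero.2 h0)
  refine h2.congr_deriv ?_
  have hs : Real.sqrt |(M 0).det| ≠ 0 := (Real.sqrt_pos.2 (abs_pos.2 h0)).ne'
  have e : ((M 0).adjugate * M').trace = (M 0).det * ((M 0)⁻¹ * M').trace := by
    rw [Matrix.inv_def, Matrix.smul_mul, Matrix.trace_smul, smul_eq_mul, Ring.inverse_eq_inv',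
      mul_inv_cancel_left₀ h0]
  rw [e, div_eq_iff (by positivity)]
  have e₂ : Real.sqrt |(M 0).det| * Real.sqrt |(M 0).det| = SignType.sign (M 0).det * (M 0).det := by
    rw [Real.mul_self_sqrt (abs_nonneg _), sign_mul_self]
  linear_combination (-((M 0)⁻¹ * M').trace) * e₂

/-- Differentiate `M⁻¹ M = 1`, valid near 0, and multiply by `M⁻¹` on the right. -/
lemma deriv_matrix_inv (hM : ∀ i j, HasDerivAt (fun t => M t i j) (M' i j) 0)
    (hN : ∀ i j, HasDerivAt (fun t => (M t)⁻¹ i j) (N' i j) 0)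
    (h0 : ∀ᶠ t in nhds 0, (M t).det ≠ 0) : N' = -((M 0)⁻¹ * M' * (M 0)⁻¹) := by
  have h1 : N' * M 0 + (M 0)⁻¹ * M' = 0 := by
    ext i j
    have e : (fun t => ∑ k, (M t)⁻¹ i k * M t k j) =ᶠ[nhds 0]
        fun _ => (1 : Matrix (Fin D) (Fin D) ℝ) i j := by
      filter_upwards [h0] with t ht
      rw [← Matrix.mul_apply, Matrix.nonsing_inv_mul _ (isUnit_iff_ne_zero.2 ht)]
    have h2 : HasDerivAt (fun t => ∑ k, (M t)⁻¹ i k * M t k j)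
        (∑ k, (N' i k * M 0 k j + (M 0)⁻¹ i k * M' k j)) 0 :=
      HasDerivAt.fun_sum fun k _ => (hN i k).mul (hM k j)
    have h3 := h2.unique ((hasDerivAt_const (0 : ℝ) _).congr_of_eventuallyEq e)
    rw [Finset.sum_add_distrib] at h3
    exact h3
  have hu : IsUnit (M 0).det := isUnit_iff_ne_zero.2 h0.self_of_nhds
  calc N' = N' * M 0 * (M 0)⁻¹ := by rw [Matrix.mul_assoc, Matrix.mul_nonsing_inv _ hu, Matrix.mul_one]
    _ = _ := by rw [eq_neg_of_add_eq_zero_left h1, Matrix.neg_mul]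

end MatrixDerivatives

/-! ## The first variation of the Einstein–Hilbert Lagrangian -/

section Palatini

variable {D : ℕ} {K : MetricField D → MetricField D} {g : MetricField D} {x : Fin D → ℝ}

lemma hasDerivAt_line {F : (Fin D → ℝ) → ℝ} (hF : DifferentiableAt ℝ F x) (a : Fin D) :
    HasDerivAt (fun t : ℝ => F (x + t • Pi.single a 1)) (pd a F x) 0 := by
  have h1 : HasDerivAt (fun t : ℝ => x + t • (Pi.single a 1 : Fin D → ℝ))
      ((1 : ℝ) • Pi.single a 1) 0 := ((hasDerivAt_id (0 : ℝ)).smul_const _).const_add _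
  have h2 : HasFDerivAt F (fderiv ℝ F x) (x + (0 : ℝ) • (Pi.single a 1 : Fin D → ℝ)) := by
    rw [zero_smul, add_zero]; exact hF.hasFDerivAt
  exact (h2.comp_hasDerivAt (0 : ℝ) h1).congr_deriv (by rw [one_smul]; rfl)

/-- The matrix of the inverse metric. -/
lemma inverseMetric_eq (g : MetricField D) (x : Fin D → ℝ) :
    Matrix.of (inverseMetric g x) = (Matrix.of (g x))⁻¹ := rfl

lemma IsRegularAt.transpose_eq (hg : IsRegularAt g x) :
    (Matrix.of (g x)).transpose = Matrix.of (g x) := by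
  ext b c; exact hg.self_of_nhds.2.2 c b

lemma inverseMetric_symm (hg : IsRegularAt g x) (b c : Fin D) :
    inverseMetric g x b c = inverseMetric g x c b := by
  have h : ((Matrix.of (g x))⁻¹).transpose = (Matrix.of (g x))⁻¹ := by
    rw [Matrix.transpose_nonsing_inv, hg.transpose_eq]
  exact congr_fun (congr_fun h c) b

lemma christoffel_symm (hg : IsRegularAt g x) (a b c : Fin D) :
    christoffel g x a b c = christoffel g x a c b := by
  have h : ∀ e, pd e (fun y => g y b c) x = pd e (fun y => g y c b) x := fun e =>
    pd_congr (hg.mono fun y hy => hy.2.2 b c)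
  unfold christoffel
  congr 1
  refine Finset.sum_congr rfl fun e _ => ?_
  rw [h]; ring

/-- The connection matrix `Γ^·_{a·}`. -/
def connectionMatrix (g : MetricField D) (x : Fin D → ℝ) (a : Fin D) : Matrix (Fin D) (Fin D) ℝ :=
  Matrix.of fun e c => christoffel g x e a c

/-- Metric compatibility of the connection. Lowering the first index of the connection matrix gives
`Λ`, and in `Λ + Λᵀ` only the derivative in the direction `a` survives. -/
lemma pd_metric (hg : IsRegularAt g x) (a : Fin D) :
    (Matrix.of fun b c => pd a (fun y => g y b c) x) = Matrix.of (g x) * connectionMatrix g x a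
      + (connectionMatrix g x a).transpose * Matrix.of (g x) := by
  have hu : IsUnit (Matrix.of (g x)).det := isUnit_iff_ne_zero.2 hg.self_of_nhds.2.1
  set Λ : Matrix (Fin D) (Fin D) ℝ := Matrix.of fun e c => (1 / 2) *
    (pd a (fun y => g y e c) x + pd c (fun y => g y e a) x - pd e (fun y => g y a c) x) with hΛ
  have h1 : connectionMatrix g x a = (Matrix.of (g x))⁻¹ * Λ := by
    ext e c
    rw [Matrix.mul_apply]
    simp only [connectionMatrix, christoffel, hΛ, Matrix.of_apply, Finset.mul_sum]
    exact Finset.sum_congr rfl fun k _ => by rw [inverseMetric]; ring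
  have h2 : Matrix.of (g x) * connectionMatrix g x a = Λ := by
    rw [h1, ← Matrix.mul_assoc, Matrix.mul_nonsing_inv _ hu, Matrix.one_mul]
  have h3 : (connectionMatrix g x a).transpose * Matrix.of (g x) = Λ.transpose := by
    rw [← h2, Matrix.transpose_mul, hg.transpose_eq]
  have h : ∀ e b c, pd e (fun y => g y b c) x = pd e (fun y => g y c b) x := fun e b c =>
    pd_congr (hg.mono fun y hy => hy.2.2 b c)
  rw [h2, h3]
  ext b c
  simp only [hΛ, Matrix.add_apply, Matrix.transpose_apply, Matrix.of_apply]
  rw [h a c b, h c b a, h b c a]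
  ring

lemma pd_inverseMetric (hg : IsRegularAt g x) (a b c : Fin D) :
    pd a (fun y => inverseMetric g y b c) x = -∑ e, christoffel g x b a e * inverseMetric g x e c
      - ∑ e, christoffel g x c a e * inverseMetric g x e b := by
  have hu : IsUnit (Matrix.of (g x)).det := isUnit_iff_ne_zero.2 hg.self_of_nhds.2.1
  have ht : Filter.Tendsto (fun t : ℝ => x + t • (Pi.single a 1 : Fin D → ℝ)) (nhds 0) (nhds x) :=
    Continuous.tendsto' (by fun_prop) _ _ (by simp)
  have h1 := deriv_matrix_inv (M := fun t : ℝ => Matrix.of (g (x + t • Pi.single a 1)))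
    (M' := Matrix.of fun b c => pd a (fun y => g y b c) x)
    (N' := Matrix.of fun b c => pd a (fun y => inverseMetric g y b c) x)
    (fun i j => hasDerivAt_line ((isLocal_metric i j).differentiableAt hg) a)
    (fun i j => hasDerivAt_line ((isLocal_inverseMetric i j).differentiableAt hg) a)
    (ht.eventually (hg.mono fun y hy => hy.2.1))
  simp only [zero_smul, add_zero] at h1
  have h2 : (Matrix.of fun b c => pd a (fun y => inverseMetric g y b c) x)
      = -(connectionMatrix g x a * Matrix.of (inverseMetric g x))
        - (connectionMatrix g x a * Matrix.of (inverseMetric g x)).transpose := by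
    have hs : (Matrix.of (inverseMetric g x)).transpose = Matrix.of (inverseMetric g x) := by
      ext i j; exact inverseMetric_symm hg j i
    rw [h1, pd_metric hg, Matrix.mul_add, Matrix.add_mul, Matrix.transpose_mul, hs,
      inverseMetric_eq, ← Matrix.mul_assoc, Matrix.nonsing_inv_mul _ hu, Matrix.one_mul,
      Matrix.mul_assoc, Matrix.mul_assoc, Matrix.mul_nonsing_inv _ hu, Matrix.mul_one, neg_add,
      sub_eq_add_neg]
  exact congr_fun (congr_fun h2 b) c

/-- Jacobi's formula along the coordinate line, combined with metric compatibility: both terms of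
`pd_metric` contribute the trace of the connection matrix, cancelling the factor `1/2`. -/
lemma pd_volumeFactor (hg : IsRegularAt g x) (a : Fin D) :
    pd a (volumeFactor g) x = volumeFactor g x * ∑ e, christoffel g x e a e := by
  have hu : IsUnit (Matrix.of (g x)).det := isUnit_iff_ne_zero.2 hg.self_of_nhds.2.1
  have h1 := hasDerivAt_sqrt_abs_det (M := fun t : ℝ => Matrix.of (g (x + t • Pi.single a 1)))
    (M' := Matrix.of fun b c => pd a (fun y => g y b c) x)
    (fun i j => hasDerivAt_line ((isLocal_metric i j).differentiableAt hg) a)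
    (by simpa using hg.self_of_nhds.2.1)
  have h2 := (hasDerivAt_line (isLocal_volumeFactor.differentiableAt hg) a).unique h1
  simp only [zero_smul, add_zero] at h2
  rw [h2, pd_metric hg, Matrix.mul_add, Matrix.trace_add, ← Matrix.mul_assoc,
    Matrix.nonsing_inv_mul _ hu, Matrix.one_mul, Matrix.trace_mul_comm, Matrix.mul_assoc,
    Matrix.mul_nonsing_inv _ hu, Matrix.mul_one, Matrix.trace_transpose]
  have e : (connectionMatrix g x a).trace = ∑ e, christoffel g x e a e := rfl
  rw [e, volumeFactor]
  ring

lemma hasDerivAt_metric (g k : MetricField D) (x : Fin D → ℝ) (i j : Fin D) :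
    HasDerivAt (fun ε : ℝ => Matrix.of ((g + ε • k) x) i j) (k x i j) 0 := by
  have := ((hasDerivAt_id (0 : ℝ)).mul_const (k x i j)).const_add (g x i j)
  rw [one_mul] at this
  exact this

lemma eventually_isRegularAt_perturb (hK : IsLocalTensor K) (hg : IsRegularAt g x) :
    ∀ᶠ ε : ℝ in nhds 0, IsRegularAt (g + ε • K g) x :=
  Filter.Tendsto.eventually (f := fun ε : ℝ => (ε, x))
    (Continuous.tendsto' (by fun_prop) _ _ rfl) (eventually_isRegularAt hK hg)

lemma hasDerivAt_volumeFactor (k : MetricField D) (hg : IsRegularAt g x) :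
    HasDerivAt (fun ε : ℝ => volumeFactor (g + ε • k) x)
      (1 / 2 * volumeFactor g x * ∑ a, ∑ b, inverseMetric g x a b * k x b a) 0 := by
  have h0 : Matrix.of ((g + (0 : ℝ) • k) x) = Matrix.of (g x) := by simp
  have h := hasDerivAt_sqrt_abs_det (M := fun ε : ℝ => Matrix.of ((g + ε • k) x))
    (M' := Matrix.of (k x)) (hasDerivAt_metric g k x) (by rw [h0]; exact hg.self_of_nhds.2.1)
  rw [h0] at h
  exact h

lemma hasDerivAt_inverseMetric (hK : IsLocalTensor K) (hg : IsRegularAt g x) (b c : Fin D) :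
    HasDerivAt (fun ε : ℝ => inverseMetric (g + ε • K g) x b c)
      (-∑ q, (∑ p, inverseMetric g x b p * K g x p q) * inverseMetric g x q c) 0 := by
  have hN := fun i j => (isLocal_inverseMetric i j).hasDerivAt hK hg
  have h1 := deriv_matrix_inv (M := fun ε : ℝ => Matrix.of ((g + ε • K g) x))
    (M' := Matrix.of (K g x))
    (N' := Matrix.of fun i j => variation K (fun g x => inverseMetric g x i j) g x)
    (hasDerivAt_metric g (K g) x) hN
    ((eventually_isRegularAt_perturb hK hg).mono fun ε hε => hε.self_of_nhds.2.1)
  simp only [zero_smul, add_zero] at h1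
  refine (hN b c).congr_deriv ?_
  exact congr_fun (congr_fun h1 b) c

end Palatini

/-! ### The Palatini identity and the variation of the Lagrangian -/

section EinsteinHilbert

variable {D : ℕ} {K : MetricField D → MetricField D} {g : MetricField D} {x : Fin D → ℝ}

/-- The variation `δΓ^a_{bc}` of the Levi-Civita connection. -/
def christoffelVariation (K : MetricField D → MetricField D) (a b c : Fin D) : Density D :=
  variation K fun g x => christoffel g x a b c

/-- The current of the Palatini identity,
`√|g| (g^{bd} δΓ^a_{bd} - g^{ab} δΓ^c_{cb})`. -/
def palatiniCurrent (K : MetricField D → MetricField D) (a : Fin D) : Density D := fun g x =>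
  ∑ b, ∑ d, (volumeFactor g x * inverseMetric g x b d * christoffelVariation K a b d g x
    - volumeFactor g x * inverseMetric g x a b * christoffelVariation K d d b g x)

lemma isLocal_christoffelVariation (hK : IsLocalTensor K) (a b c : Fin D) :
    IsLocal (christoffelVariation K a b c) := (isLocal_christoffel a b c).variation hK

lemma isLocal_palatiniCurrent (hK : IsLocalTensor K) (a : Fin D) :
    IsLocal (palatiniCurrent K a) :=
  IsLocal.sum _ fun b _ => IsLocal.sum _ fun d _ =>
    ((isLocal_volumeFactor.mul (isLocal_inverseMetric b d)).mul
      (isLocal_christoffelVariation hK a b d)).sub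
    ((isLocal_volumeFactor.mul (isLocal_inverseMetric a b)).mul
      (isLocal_christoffelVariation hK d d b))

lemma christoffelVariation_symm (hK : IsLocalTensor K) (hg : IsRegularAt g x) (a b c : Fin D) :
    christoffelVariation K a b c g x = christoffelVariation K a c b g x :=
  Filter.EventuallyEq.deriv_eq ((eventually_isRegularAt_perturb hK hg).mono fun _ hε =>
    christoffel_symm hε a b c)

lemma pd_christoffelVariation_symm (hK : IsLocalTensor K) (hg : IsRegularAt g x)
    (e a b c : Fin D) : pd e (christoffelVariation K a b c g) x
      = pd e (christoffelVariation K a c b g) x :=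
  pd_congr (hg.eventually.mono fun _ hy => christoffelVariation_symm hK hy a b c)

lemma hasDerivAt_ricci (hK : IsLocalTensor K) (hg : IsRegularAt g x) (b d : Fin D) :
    HasDerivAt (fun ε : ℝ => ricci (g + ε • K g) x b d)
      (∑ a, (pd a (christoffelVariation K a d b g) x - pd d (christoffelVariation K a a b g) x
        + ∑ e, (christoffelVariation K a a e g x * christoffel g x e d b
            + christoffel g x a a e * christoffelVariation K e d b g x
          - (christoffelVariation K a d e g x * christoffel g x e a b
            + christoffel g x a d e * christoffelVariation K e a b g x)))) 0 := by
  have h1 : ∀ a b c, HasDerivAt (fun ε : ℝ => christoffel (g + ε • K g) x a b c)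
      (christoffelVariation K a b c g x) 0 := fun a b c =>
    (isLocal_christoffel a b c).hasDerivAt hK hg
  have h2 : ∀ e a b c, HasDerivAt
      (fun ε : ℝ => pd e (fun y => christoffel (g + ε • K g) y a b c) x)
      (pd e (christoffelVariation K a b c g) x) 0 := by
    intro e a b c
    have := ((isLocal_christoffel a b c).pd e).hasDerivAt hK hg
    rw [variation_pd (isLocal_christoffel a b c) hK hg] at this
    exact this
  refine HasDerivAt.fun_sum fun a _ => ((h2 a a d b).sub (h2 d a a b)).add
    (HasDerivAt.fun_sum fun e _ => ?_)
  have h3 := ((h1 a a e).mul (h1 e d b)).sub ((h1 a d e).mul (h1 e a b))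
  simp only [zero_smul, add_zero] at h3
  exact h3

lemma sum_relabel {f f' : Fin D → Fin D → Fin D → Fin D → ℝ}
    (σ : Fin D × Fin D × Fin D × Fin D ≃ Fin D × Fin D × Fin D × Fin D)
    (h : ∀ p, f p.1 p.2.1 p.2.2.1 p.2.2.2 = f' (σ p).1 (σ p).2.1 (σ p).2.2.1 (σ p).2.2.2) :
    ∑ a, ∑ b, ∑ c, ∑ d, f a b c d = ∑ a, ∑ b, ∑ c, ∑ d, f' a b c d := by
  have e : ∀ f : Fin D → Fin D → Fin D → Fin D → ℝ, ∑ a, ∑ b, ∑ c, ∑ d, f a b c d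
      = ∑ p : Fin D × Fin D × Fin D × Fin D, f p.1 p.2.1 p.2.2.1 p.2.2.2 := by
    intro f; simp only [Fintype.sum_prod_type]
  rw [e, e]
  exact Fintype.sum_equiv σ _ _ h

lemma pairing_eq_sum {γ : Fin D → Fin D → ℝ} (hγ : ∀ a b, γ a b = γ b a)
    (A B : Fin D → Fin D → ℝ) :
    ∑ b, ∑ d, (∑ q, (∑ p, γ b p * A p q) * γ q d) * B b d = pairing γ A B := by
  simp only [Finset.sum_mul, pairing]
  exact sum_relabel ⟨fun p => (p.2.2.2, p.2.2.1, p.1, p.2.1),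
    fun p => (p.2.2.1, p.2.2.2, p.2.1, p.1), fun _ => rfl, fun _ => rfl⟩ fun p => by
      simp only [Equiv.coe_fn_mk]; rw [hγ p.1]; ring

/-- The index gymnastics of the Palatini identity. -/
lemma palatini_algebra (v : ℝ) {γ : Fin D → Fin D → ℝ} {Γ C : Fin D → Fin D → Fin D → ℝ}
    {dC : Fin D → Fin D → Fin D → Fin D → ℝ} (hγ : ∀ a b, γ a b = γ b a)
    (hΓ : ∀ a b c, Γ a b c = Γ a c b) (hC : ∀ a b c, C a b c = C a c b)
    (hdC : ∀ e a b c, dC e a b c = dC e a c b) :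
    ∑ a, ∑ b, ∑ d, (((v * ∑ e, Γ e a e) * γ b d
          + v * (-∑ e, Γ b a e * γ e d - ∑ e, Γ d a e * γ e b)) * C a b d
        + v * γ b d * dC a a b d
        - (((v * ∑ e, Γ e a e) * γ a b
          + v * (-∑ e, Γ a a e * γ e b - ∑ e, Γ b a e * γ e a)) * C d d b
        + v * γ a b * dC a d d b))
      = v * ∑ b, ∑ d, γ b d * ∑ a, (dC a a d b - dC d a a b
        + ∑ e, (C a a e * Γ e d b + Γ a a e * C e d b
          - (C a d e * Γ e a b + Γ a d e * C e a b))) := by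
  have hl : ∀ a b d, ((v * ∑ e, Γ e a e) * γ b d
          + v * (-∑ e, Γ b a e * γ e d - ∑ e, Γ d a e * γ e b)) * C a b d
        + v * γ b d * dC a a b d
        - (((v * ∑ e, Γ e a e) * γ a b
          + v * (-∑ e, Γ a a e * γ e b - ∑ e, Γ b a e * γ e a)) * C d d b
        + v * γ a b * dC a d d b)
      = v * (∑ e, Γ e a e * γ b d * C a b d - ∑ e, Γ b a e * γ e d * C a b d
        - ∑ e, Γ d a e * γ e b * C a b d - ∑ e, Γ e a e * γ a b * C d d b
        + ∑ e, Γ a a e * γ e b * C d d b + ∑ e, Γ b a e * γ e a * C d d b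
        + γ b d * dC a a b d - γ a b * dC a d d b) := by
    intro a b d
    simp only [← Finset.sum_mul]
    ring
  have hr : ∀ b d a, γ b d * (dC a a d b - dC d a a b
        + ∑ e, (C a a e * Γ e d b + Γ a a e * C e d b
          - (C a d e * Γ e a b + Γ a d e * C e a b)))
      = γ b d * dC a a d b - γ b d * dC d a a b + ∑ e, γ b d * C a a e * Γ e d b
        + ∑ e, γ b d * Γ a a e * C e d b - ∑ e, γ b d * C a d e * Γ e a b
        - ∑ e, γ b d * Γ a d e * C e a b := by
    intro b d a
    simp only [Finset.sum_add_distrib, Finset.sum_sub_distrib, mul_assoc, ← Finset.mul_sum]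
    ring
  have hr' : ∀ b d, γ b d * ∑ a, (dC a a d b - dC d a a b
        + ∑ e, (C a a e * Γ e d b + Γ a a e * C e d b
          - (C a d e * Γ e a b + Γ a d e * C e a b)))
      = ∑ a, (γ b d * dC a a d b - γ b d * dC d a a b + ∑ e, γ b d * C a a e * Γ e d b
        + ∑ e, γ b d * Γ a a e * C e d b - ∑ e, γ b d * C a d e * Γ e a b
        - ∑ e, γ b d * Γ a d e * C e a b) := fun b d => by
    rw [Finset.mul_sum]
    exact Finset.sum_congr rfl fun a _ => hr b d a
  simp only [hl, ← Finset.mul_sum]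
  congr 1
  rw [Finset.sum_congr rfl fun b _ => Finset.sum_congr rfl fun d _ => hr' b d]
  simp only [Finset.sum_add_distrib, Finset.sum_sub_distrib]
  -- The first two relabellings match the derivatives of `δΓ`. `s₃` is a cancellation inside the
  -- divergence, between the derivative of the volume factor and the derivative of the inverse
  -- metric; `s₄` to `s₇` match the four products of `Γ` with `δΓ` in the variation of the Ricci
  -- tensor.
  have s₁ : ∑ a, ∑ b, ∑ d, γ b d * dC a a b d = ∑ b, ∑ d, ∑ a, γ b d * dC a a d b := by
    rw [Finset.sum_comm]
    refine Finset.sum_congr rfl fun b _ => ?_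
    rw [Finset.sum_comm]
    exact Finset.sum_congr rfl fun d _ => Finset.sum_congr rfl fun a _ => by rw [hdC]
  have s₂ : ∑ a, ∑ b, ∑ d, γ a b * dC a d d b = ∑ b, ∑ d, ∑ a, γ b d * dC d a a b := by
    rw [Finset.sum_comm]
    exact Finset.sum_congr rfl fun d _ => Finset.sum_congr rfl fun a _ =>
      Finset.sum_congr rfl fun _ _ => by rw [hγ]
  have s₃ : ∑ a, ∑ b, ∑ d, ∑ e, Γ a a e * γ e b * C d d b
      = ∑ a, ∑ b, ∑ d, ∑ e, Γ e a e * γ a b * C d d b :=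
    sum_relabel ⟨fun p => (p.2.2.2, p.2.1, p.2.2.1, p.1), fun p => (p.2.2.2, p.2.1, p.2.2.1, p.1),
      fun _ => rfl, fun _ => rfl⟩ fun p => by simp only [Equiv.coe_fn_mk]; rw [hΓ p.1]
  have s₄ : ∑ a, ∑ b, ∑ d, ∑ e, Γ b a e * γ e a * C d d b
      = ∑ b, ∑ d, ∑ a, ∑ e, γ b d * C a a e * Γ e d b :=
    sum_relabel ⟨fun p => (p.2.2.2, p.1, p.2.2.1, p.2.1), fun p => (p.2.1, p.2.2.2, p.2.2.1, p.1),
      fun _ => rfl, fun _ => rfl⟩ fun p => by simp only [Equiv.coe_fn_mk]; ring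
  have s₅ : ∑ a, ∑ b, ∑ d, ∑ e, Γ e a e * γ b d * C a b d
      = ∑ b, ∑ d, ∑ a, ∑ e, γ b d * Γ a a e * C e d b :=
    sum_relabel ⟨fun p => (p.2.1, p.2.2.1, p.2.2.2, p.1), fun p => (p.2.2.2, p.1, p.2.1, p.2.2.1),
      fun _ => rfl, fun _ => rfl⟩ fun p => by
        simp only [Equiv.coe_fn_mk]; rw [hΓ p.2.2.2, hC p.1]; ring
  have s₆ : ∑ a, ∑ b, ∑ d, ∑ e, Γ b a e * γ e d * C a b d
      = ∑ b, ∑ d, ∑ a, ∑ e, γ b d * C a d e * Γ e a b :=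
    sum_relabel ⟨fun p => (p.2.2.2, p.2.2.1, p.1, p.2.1), fun p => (p.2.2.1, p.2.2.2, p.2.1, p.1),
      fun _ => rfl, fun _ => rfl⟩ fun p => by
        simp only [Equiv.coe_fn_mk]; rw [hC p.1]; ring
  have s₇ : ∑ a, ∑ b, ∑ d, ∑ e, Γ d a e * γ e b * C a b d
      = ∑ b, ∑ d, ∑ a, ∑ e, γ b d * Γ a d e * C e a b :=
    sum_relabel ⟨fun p => (p.2.1, p.2.2.2, p.2.2.1, p.1), fun p => (p.2.2.2, p.1, p.2.2.1, p.2.1),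
      fun _ => rfl, fun _ => rfl⟩ fun p => by
        simp only [Equiv.coe_fn_mk]; rw [hΓ p.2.2.1, hC p.1, hγ p.2.2.2]; ring
  rw [s₁, s₂, s₃, s₄, s₅, s₆, s₇]
  ring

/-- The Palatini identity. -/
lemma divergence_palatiniCurrent (hK : IsLocalTensor K) (hg : IsRegularAt g x) :
    ∑ a, pd a (palatiniCurrent K a g) x
      = volumeFactor g x * ∑ b, ∑ d, inverseMetric g x b d *
        ∑ a, (pd a (christoffelVariation K a d b g) x - pd d (christoffelVariation K a a b g) x
        + ∑ e, (christoffelVariation K a a e g x * christoffel g x e d b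
            + christoffel g x a a e * christoffelVariation K e d b g x
          - (christoffelVariation K a d e g x * christoffel g x e a b
            + christoffel g x a d e * christoffelVariation K e a b g x))) := by
  rw [← palatini_algebra (volumeFactor g x) (inverseMetric_symm hg) (christoffel_symm hg)
    (C := fun a b c => christoffelVariation K a b c g x)
    (dC := fun e a b c => pd e (christoffelVariation K a b c g) x)
    (christoffelVariation_symm hK hg) (pd_christoffelVariation_symm hK hg)]
  refine Finset.sum_congr rfl fun a _ => ?_
  have hv : DifferentiableAt ℝ (volumeFactor g) x := isLocal_volumeFactor.differentiableAt hg
  have hi : ∀ b d, DifferentiableAt ℝ (fun y => inverseMetric g y b d) x := fun b d =>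
    (isLocal_inverseMetric b d).differentiableAt hg
  have hC : ∀ a b c, DifferentiableAt ℝ (christoffelVariation K a b c g) x := fun a b c =>
    (isLocal_christoffelVariation hK a b c).differentiableAt hg
  have h1 : ∀ b c p q r, DifferentiableAt ℝ (fun y => volumeFactor g y * inverseMetric g y b c *
      christoffelVariation K p q r g y) x := fun b c p q r => (hv.fun_mul (hi b c)).fun_mul (hC p q r)
  unfold palatiniCurrent
  rw [pd_sum _ fun b _ => DifferentiableAt.fun_sum fun d _ => (h1 _ _ _ _ _).fun_sub (h1 _ _ _ _ _)]
  refine Finset.sum_congr rfl fun b _ => ?_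
  rw [pd_sum _ fun d _ => (h1 _ _ _ _ _).fun_sub (h1 _ _ _ _ _)]
  refine Finset.sum_congr rfl fun d _ => ?_
  rw [pd_sub (h1 _ _ _ _ _) (h1 _ _ _ _ _), pd_mul (hv.fun_mul (hi _ _)) (hC _ _ _),
    pd_mul (hv.fun_mul (hi _ _)) (hC _ _ _), pd_mul hv (hi _ _), pd_mul hv (hi _ _),
    pd_volumeFactor hg, pd_inverseMetric hg, pd_inverseMetric hg]

/-- The first variation of `√|g| (R + ε ℒ)` under `g → g + ε K(g)`. -/
lemma hasDerivAt_lagrangian (hK : IsLocalTensor K) (hg : IsRegularAt g x) {L : Density D}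
    (hL : IsLocal L) :
    HasDerivAt (fun ε : ℝ => volumeFactor (g + ε • K g) x *
        (scalarCurvature (g + ε • K g) x + ε * L (g + ε • K g) x))
      (volumeFactor g x * (L g x - pairing (inverseMetric g x) (K g x) (ricci g x)
        + 1 / 2 * scalarCurvature g x * ∑ a, ∑ b, inverseMetric g x a b * K g x a b)
        + ∑ a, pd a (palatiniCurrent K a g) x) 0 := by
  have hR : HasDerivAt (fun ε : ℝ => scalarCurvature (g + ε • K g) x) _ 0 :=
    HasDerivAt.fun_sum fun b _ => HasDerivAt.fun_sum fun d _ =>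
      (hasDerivAt_inverseMetric hK hg b d).mul (hasDerivAt_ricci hK hg b d)
  have hεL := (hasDerivAt_id (0 : ℝ)).mul (hL.hasDerivAt hK hg)
  refine ((hasDerivAt_volumeFactor (K g) hg).mul (hR.add hεL)).congr_deriv ?_
  -- The variation of Ricci accounts for the divergence. The volume factor and the inverse metric
  -- give the Einstein tensor contracted with `K`, and `ε ℒ` contributes only `ℒ`, as its own
  -- variation carries a factor `ε = 0`.
  rw [divergence_palatiniCurrent hK hg]
  simp only [Pi.add_apply, Pi.mul_apply, id_eq, zero_smul, add_zero, zero_mul, one_mul,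
    Finset.sum_add_distrib]
  have e₁ : ∑ a, ∑ b, inverseMetric g x a b * K g x b a
      = ∑ a, ∑ b, inverseMetric g x a b * K g x a b :=
    Finset.sum_congr rfl fun a _ => Finset.sum_congr rfl fun b _ => by rw [hK.symm]
  have e₂ : ∑ b, ∑ d, (-∑ q, (∑ p, inverseMetric g x b p * K g x p q) * inverseMetric g x q d) *
      ricci g x b d = -pairing (inverseMetric g x) (K g x) (ricci g x) := by
    rw [← pairing_eq_sum (inverseMetric_symm hg)]
    simp only [neg_mul, Finset.sum_neg_distrib]
  rw [e₁, e₂]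
  ring

end EinsteinHilbert

/-! ## Completion to GQTG densities -/

section Completion

variable {d : ℕ}

lemma isGQTG_invariantOf {n : ℕ}
    {φ : (Fin (d + 2) → Fin (d + 2) → ℝ) → ((Fin n × Fin 4 → Fin (d + 2)) → ℝ) →ₗ[ℝ] ℝ}
    (hφ : φ ∈ contractions (d + 2) (Fin n × Fin 4)) {G : ℝ × ℝ → ℝ} (hG : ContDiff ℝ ∞ G)
    (h : ∀ A B ψ, φ (diagMat 1) (tensorPower n (sectional (sssCurv d A B ψ) 1))
      = (d + 1) * G (ψ, B) + fderiv ℝ G (ψ, B) (2 * (B - ψ), A - B)) :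
    IsGQTG (invariantOf n φ) := by
  refine isGQTG_of_potential hG fun f hf r hr h0 => ?_
  rw [invariantOf, inverseMetric_sss hr h0, riemann_sss hf hr h0,
    contractions_sectional hφ _ (sssFrame_ne_zero hr h0), h]

/-- Up to contractions with the Schouten tensor, every invariant is a GQTG density. -/
lemma exists_gqtg (hd : 1 ≤ d) {m : ℕ}
    {φ : (Fin (d + 2) → Fin (d + 2) → ℝ) → ((Fin (m + 1) × Fin 4 → Fin (d + 2)) → ℝ) →ₗ[ℝ] ℝ}
    (hφ : φ ∈ contractions (d + 2) (Fin (m + 1) × Fin 4)) :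
    ∃ ζ ∈ contractions (d + 2) (Fin (m + 1) × Fin 4), IsGQTG (invariantOf (m + 1) ζ) ∧
      ∃ ψ ∈ contractions (d + 2) ((Fin m × Fin 4) ⊕ Fin 2), ∀ G γ R, IsInversePair G γ →
        φ γ (tensorPower (m + 1) R) - ζ γ (tensorPower (m + 1) R)
          = ψ γ (tprod (tensorPower m R) (tens₂ (schouten G γ R))) := by
  obtain ⟨φ', hφ', h'⟩ := exists_weylPart hφ
  obtain ⟨ψ, hψ, h⟩ := exists_schouten_part hφ
  have hone : IsInversePair (diagMat (1 : Fin (d + 2) → ℝ)) (diagMat 1) := isInversePair_one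
  have hsss : ∀ A B ψ, φ' (diagMat 1) (tensorPower (m + 1) (sectional (sssCurv d A B ψ) 1))
      = weylAmp d A B ψ ^ (m + 1) * weylCoeff φ := fun A B ψ => by
    rw [h' _ _ _ hone, weylCoeff_spec hd]
  -- If the Weyl part vanishes on these metrics, it is itself a GQTG density with zero potential.
  -- Otherwise `d ≥ 2`, because the amplitude vanishes for `d = 1`, and `m ≥ 1`, because a single
  -- Weyl tensor has no non-zero contraction.
  by_cases hzero : ∀ A B ψ, weylAmp d A B ψ ^ (m + 1) * weylCoeff φ = 0
  · refine ⟨φ', hφ', isGQTG_invariantOf hφ' (G := fun _ => 0) contDiff_const fun A B ψ => ?_,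
      ψ, hψ, fun G γ R hG => ?_⟩
    · rw [hsss, hzero]; simp
    · rw [h' _ _ _ hG, h _ _ _ hG]; ring
  · have hd2 : 2 ≤ d := by
      by_contra hlt
      obtain rfl : d = 1 := by omega
      exact hzero fun A B ψ => by simp [weylAmp]
    obtain ⟨N, rfl⟩ : ∃ N, m = N + 1 := by
      rcases m with _ | N
      · exact absurd (fun A B ψ => by
          rw [weylCoeff, contractions_weylCurv_one hd2 hφ, mul_zero]) hzero
      · exact ⟨N, rfl⟩
    obtain ⟨φ₁, hφ₁, h₁⟩ := isRealized_gqtgPoly hd2 N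
    obtain ⟨φ₁', hφ₁', h₁'⟩ := exists_weylPart hφ₁
    obtain ⟨ψ₁, hψ₁, h₁''⟩ := exists_schouten_part hφ₁
    have hne := weylCoeff_ne_zero hd2 h₁
    set t : ℝ := weylCoeff φ / weylCoeff φ₁ with ht
    -- By the choice of `t` the first two terms cancel on static spherically symmetric metrics,
    -- leaving `t` times the explicit GQTG density; by construction the combination has the same
    -- Weyl part as `φ`.
    have hmem : φ' - t • φ₁' + t • φ₁ ∈ contractions (d + 2) (Fin (N + 2) × Fin 4) :=
      Submodule.add_mem _ (Submodule.sub_mem _ hφ' (Submodule.smul_mem _ _ hφ₁'))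
        (Submodule.smul_mem _ _ hφ₁)
    refine ⟨_, hmem, isGQTG_invariantOf hmem (G := fun p => t • gqtgPotential d N p)
      ((contDiff_gqtgPotential N).const_smul t) fun A B ψ => ?_, ψ - t • ψ₁,
      Submodule.sub_mem _ hψ (Submodule.smul_mem _ _ hψ₁), fun G γ R hG => ?_⟩
    · change φ' _ _ - t * φ₁' _ _ + t * φ₁ _ _ = _
      rw [hsss, h₁' _ _ _ hone, weylCoeff_spec hd, h₁, gqtgPotential_spec hd2,
        fderiv_fun_const_smul ((contDiff_gqtgPotential N).differentiable (by simp)).differentiableAt]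
      have : weylCoeff φ = t * weylCoeff φ₁ := by rw [ht, div_mul_cancel₀ _ hne]
      rw [this]
      simp only [smul_apply, smul_eq_mul]
      ring
    · change _ - (φ' _ _ - t * φ₁' _ _ + t * φ₁ _ _) = ψ _ _ - t * ψ₁ _ _
      rw [h _ _ _ hG, h' _ _ _ hG, h₁' _ _ _ hG]
      linear_combination (-t) * h₁'' _ _ _ hG

lemma pairing_zero_right (γ A : Fin (d + 2) → Fin (d + 2) → ℝ) : pairing γ A 0 = 0 := by
  simp [pairing]

lemma pairing_zero_left (γ A : Fin (d + 2) → Fin (d + 2) → ℝ) : pairing γ 0 A = 0 := by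
  simp [pairing]

/-- If `ℒ - 𝒬` is the contraction of the Einstein tensor with `K`, then it is reducible, and a
field redefinition maps `ℒ` to `𝒬`. -/
lemma isReducible_and_isMapped {m : ℕ} {L Q : Density (d + 2)} (hL : IsLocal L)
    {K : MetricField (d + 2) → MetricField (d + 2)} (hK : K ∈ symmetricCurvatureTensors (d + 2) m)
    (h : ∀ g x, IsInversePair (g x) (inverseMetric g x) → L g x - Q g x
      = pairing (inverseMetric g x) (K g x) (ricci g x)
        - 1 / 2 * scalarCurvature g x * ∑ a, ∑ b, inverseMetric g x a b * K g x a b) :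
    IsReducible (L - Q) ∧ IsMappedByFieldRedefinition m L Q := by
  have hK' : IsLocalTensor K :=
    ⟨isLocal_of_mem_symmetricCurvatureTensors hK, symm_of_mem_symmetricCurvatureTensors hK⟩
  constructor
  -- The zero current suffices: the difference itself vanishes on Ricci-flat metrics.
  · refine ⟨0, 0, contDiffOn_const, fun U g hU hg hflat x hx => ?_⟩
    have hric : ricci g x = 0 := by funext b c; exact hflat x hx b c
    have hR : scalarCurvature g x = 0 := by simp [scalarCurvature, hric]
    have := h g x (isInversePair_of_isLorentzian (hg.lorentzian x hx))
    rw [hric, hR, pairing_zero_right] at this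
    simp only [Pi.sub_apply, this, Pi.zero_apply, pd_const]
    simp
  · refine ⟨K, hK, fun g x => ∑ a, pd a (palatiniCurrent K a g) x,
      isTotalDerivativeOn_divergence (isLocal_palatiniCurrent hK') _, fun U g hU hg x hx => ?_⟩
    refine (hasDerivAt_lagrangian hK' (hg.isRegularAt hU hx) hL).congr_deriv ?_
    linear_combination volumeFactor g x *
      h g x (isInversePair_of_isLorentzian (hg.lorentzian x hx))

/-- On these metrics an invariant of order zero is a constant `c`, and `c r^d` is the derivative of
`c r^(d+1)/(d+1)`. -/
lemma isGQTG_of_order_zero {L : Density (d + 2)} (hL : L ∈ curvatureInvariants (d + 2) 0) :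
    IsGQTG L := by
  obtain ⟨φ, hφ, rfl⟩ := exists_invariantOf hL
  refine isGQTG_invariantOf hφ (G := fun _ => φ (diagMat 1) (fun _ => 1) / (d + 1))
    contDiff_const fun A B ψ => ?_
  have hd : (d + 1 : ℝ) ≠ 0 := by positivity
  have e : tensorPower 0 (sectional (sssCurv d A B ψ) 1) = fun _ => 1 := by
    funext i; simp [tensorPower]
  rw [e]
  simp
  field_simp

end Completion

end GQTG

end

/-! ### The theorem -/

theorem corollary1 (d n : ℕ) (hd : 1 ≤ d)
    (h : ∃ Q₀ ∈ GQTG.curvatureInvariants (d + 2) n,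
      GQTG.IsGQTG Q₀ ∧ GQTG.IsIrreducible Q₀ ∧ GQTG.IsNonTrivial Q₀) :
    ∀ L ∈ GQTG.curvatureInvariants (d + 2) n,
      GQTG.IsCompletable n L ∧
      ∃ Q ∈ GQTG.curvatureInvariants (d + 2) n,
        GQTG.IsGQTG Q ∧ GQTG.IsReducible (L - Q) ∧
          GQTG.IsMappedByFieldRedefinition (n - 1) L Q := by
  intro L hL
  suffices hQ : ∃ Q ∈ GQTG.curvatureInvariants (d + 2) n, GQTG.IsGQTG Q ∧
      GQTG.IsReducible (L - Q) ∧ GQTG.IsMappedByFieldRedefinition (n - 1) L Q by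
    obtain ⟨Q, hQ, hG, hR, hM⟩ := hQ
    exact ⟨⟨Q, hQ, hG, hR⟩, Q, hQ, hG, hR, hM⟩
  have hloc := GQTG.isLocal_of_mem_curvatureInvariants hL
  rcases n with _ | m
  -- At order zero `Q = L` and `K = 0`; here `n - 1` is truncated to `0`.
  · refine ⟨L, hL, GQTG.isGQTG_of_order_zero hL,
      GQTG.isReducible_and_isMapped hloc (Submodule.zero_mem _) fun g x _ => ?_⟩
    simp only [Pi.zero_apply, mul_zero, Finset.sum_const_zero, sub_self]
    exact ((sub_zero _).trans (GQTG.pairing_zero_left _ _)).symm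
  · obtain ⟨φ, hφ, rfl⟩ := GQTG.exists_invariantOf hL
    obtain ⟨ζ, hζ, hG, ψ, hψ, hdiff⟩ := GQTG.exists_gqtg hd hφ
    obtain ⟨K, hK, hpair⟩ := GQTG.exists_einstein_pairing hd hψ
    exact ⟨GQTG.invariantOf (m + 1) ζ, GQTG.invariantOf_mem hζ, hG,
      GQTG.isReducible_and_isMapped hloc hK fun g x hgx =>
        (hdiff _ _ _ hgx).trans (hpair g x hgx)⟩
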